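/- Let $M$ be a sphere with a Euclidean polyhedral metric and let $T$ be a geodesic triangulation of $M$ with vertices $i\in V$ (loops, multiple edges and triangles with self-identifications are allowed); thus $M$ is glued from the finitely many non-degenerate Euclidean triangles of $T$. The angle defect of $M$ at $i$ is $\delta_i=2\pi-(\text{the sum of the angles at } i \text{ of the triangles of } T)$. Let $r=(r_i)_{i\in V}$ be positive numbers (radii) such that over every triangle $ijk$ of $T$ there is a non-degenerate Euclidean pyramid with base $ijk$ and lateral edges of lengths $r_i,r_j,r_k$. The generalized polytope $(T,r)$ is the complex glued from these pyramids according to $T$, all apices being identified to one point $a$. Its curvature at the edge $ai$ is $\kappa_i=2\pi-\omega_i$, where $\omega_i$ is the sum of the dihedral angles of the pyramids at $ai$. It is a generalized convex polytope if for every edge $ij$ of $T$ the sum $\theta_{ij}$ of the dihedral angles of the pyramids at $ij$ is at most $\pi$. Let $P$ be a generalized convex polytope with boundary $M$, and let $(T,r)$ be any couple as above that represents $P$. Suppose that $$0<\kappa_i<\delta_i\qquad\text{for all } i.$$ Then the curvatures $\kappa=(\kappa_i)_{i\in V}$, as functions of the radii of the generalized polytopes over the triangulation $T$, are differentiable at $r$,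 and the Jacobian matrix $\left(\dfrac{\partial\kappa_i}{\partial r_j}\right)_{i,j\in V}$ at $r$ is non-degenerate: $\det\left(\dfrac{\partial\kappa_i}{\partial r_j}\right)\neq 0$. -/

import Mathlib

/-- The angle opposite to the side `a` in a Euclidean triangle with side lengths `a`, `b`, `c`
(law of cosines). -/
noncomputable def euclAngle (a b c : ℝ) : ℝ :=
  Real.arccos ((b ^ 2 + c ^ 2 - a ^ 2) / (2 * b * c))

/-- The angle opposite to the side `a` in a spherical triangle on the unit sphere with side
lengths `a`, `b`, `c` (spherical law of cosines).  If three rays issue from a point of `ℝ³` and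
`a`, `b`, `c` are the plane angles between them, this is the dihedral angle at the ray which is
common to the plane angles `b` and `c`. -/
noncomputable def sphAngle (a b c : ℝ) : ℝ :=
  Real.arccos ((Real.cos a - Real.cos b * Real.cos c) / (Real.sin b * Real.sin c))

/-- A geodesic triangulation of the sphere with a Euclidean polyhedral metric, that is, a sphere
glued from finitely many Euclidean triangles along sides of equal length.

`D` is the set of oriented edges (darts); each dart lies on the boundary of exactly one triangle,
the one on its left, and every edge carries two darts `d` and `rev d`.  `V` is the set of
vertices.  Loops, multiple edges and triangles with self-identifications on the boundary are
allowed. -/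
structure GeodesicTriangulation (V D : Type*) [Fintype V] [Fintype D] where
  /-- The next dart in the boundary of the same triangle. -/
  next : Equiv.Perm D
  /-- The same edge with the opposite orientation, on the boundary of the adjacent triangle. -/
  rev : Equiv.Perm D
  /-- The initial vertex of a dart. -/
  src : D → V
  /-- The length of a dart. -/
  len : D → ℝ
  next_ne : ∀ d, next d ≠ d
  next_next_next : ∀ d, next (next (next d)) = d
  rev_ne : ∀ d, rev d ≠ d
  rev_rev : ∀ d, rev (rev d) = d
  src_surjective : Function.Surjective src
  /-- The darts with a given initial vertex form one cycle under the rotation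
  `d ↦ rev (next (next d))` about that vertex. -/
  src_eq_iff : ∀ d e, src d = src e ↔
    Equiv.Perm.SameCycle ((next.trans next).trans rev) d e
  /-- The surface is connected. -/
  connected : ∀ d e, ∃ g ∈ Subgroup.closure {next, rev}, g d = e
  /-- The Euler characteristic, vertices minus edges plus triangles, is that of the sphere. -/
  euler : (Fintype.card V : ℚ) - (Fintype.card D : ℚ) / 2 + (Fintype.card D : ℚ) / 3 = 2
  len_pos : ∀ d, 0 < len d
  len_rev : ∀ d, len (rev d) = len d
  /-- The triangles are non-degenerate. -/
  triangle : ∀ d, len d < len (next d) + len (next (next d))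

namespace GeodesicTriangulation

variable {V D : Type*} [Fintype V] [Fintype D] (T : GeodesicTriangulation V D)

/-- The dart that follows `d` in the rotation about the initial vertex of `d`: it is the other
side, issuing from that vertex, of the triangle of `d`. -/
def rot (d : D) : D := T.rev (T.next (T.next d))

/-- The angle of the triangle of `d` at the initial vertex of `d`. -/
noncomputable def corner (d : D) : ℝ :=
  euclAngle (T.len (T.next d)) (T.len d) (T.len (T.next (T.next d)))

/-- The angle defect `δ_i` of the polyhedral metric at the vertex `i`. -/
noncomputable def angleDefect [DecidableEq V] (i : V) : ℝ :=
  2 * Real.pi - ∑ d with T.src d = i, T.corner d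

/-- There is a (non-degenerate) pyramid whose base is the triangle of `d` and whose lateral edges
have the lengths prescribed by `r`. -/
def HasPyramid (r : V → ℝ) (d : D) : Prop :=
  ∃ a p q s : EuclideanSpace ℝ (Fin 3), AffineIndependent ℝ ![a, p, q, s] ∧
    dist p q = T.len d ∧ dist q s = T.len (T.next d) ∧ dist s p = T.len (T.next (T.next d)) ∧
    dist a p = r (T.src d) ∧ dist a q = r (T.src (T.next d)) ∧
    dist a s = r (T.src (T.next (T.next d)))

/-- The angle between the edge `d` and the lateral edge at its initial vertex, i.e. the angle at
the initial vertex of `d` in the triangle spanned by `d` and the apex. -/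
noncomputable def rho (r : V → ℝ) (d : D) : ℝ :=
  euclAngle (r (T.src (T.next d))) (r (T.src d)) (T.len d)

/-- The dihedral angle of the pyramid over the triangle of `d` at the lateral edge that joins the
apex to the initial vertex of `d`. -/
noncomputable def lateralDihedral (r : V → ℝ) (d : D) : ℝ :=
  sphAngle (T.corner d) (T.rho r d) (T.rho r (T.rot d))

/-- The dihedral angle of the pyramid over the triangle of `d` at its base edge `d`. -/
noncomputable def baseDihedral (r : V → ℝ) (d : D) : ℝ :=
  sphAngle (T.rho r (T.rot d)) (T.rho r d) (T.corner d)

/-- The total dihedral angle `θ` of the generalized polytope at the boundary edge `d`. -/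
noncomputable def boundaryDihedral (r : V → ℝ) (d : D) : ℝ :=
  T.baseDihedral r d + T.baseDihedral r (T.rev d)

/-- The curvature `κ_i` of the generalized polytope `(T, r)` at the edge that joins the apex to
the vertex `i`. -/
noncomputable def curvature [DecidableEq V] (r : V → ℝ) (i : V) : ℝ :=
  2 * Real.pi - ∑ d with T.src d = i, T.lateralDihedral r d

/-- `(T, r)` is a generalized polytope: the radii are positive and over every triangle there is a
pyramid whose lateral edges are the radii. -/
def IsGeneralizedPolytope (r : V → ℝ) : Prop :=
  (∀ i, 0 < r i) ∧ ∀ d, T.HasPyramid r d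

/-- `(T, r)` is a generalized convex polytope: the dihedral angles at the boundary edges are at
most `π`. -/
def IsGeneralizedConvexPolytope (r : V → ℝ) : Prop :=
  T.IsGeneralizedPolytope r ∧ ∀ d, T.boundaryDihedral r d ≤ Real.pi

/-- The Jacobian matrix `(∂κ_i / ∂r_j)` of the curvatures with respect to the radii. -/
noncomputable def curvatureJacobian [DecidableEq V] (r : V → ℝ) : Matrix V V ℝ :=
  Matrix.of fun i j => fderiv ℝ T.curvature r (Pi.single j 1) i

end GeodesicTriangulation

/-!
Let `V_i` be the quadratic form that sends a variation `x` of the radii to the signed area of the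
polygon (with a cone point) whose edge normals are the traces of the lateral faces at the edge `ai`
and whose support numbers are the numbers `rhoVariation r x`, one for each dart issuing from `i`.

* The derivative of `κ_i` in the direction `x` is the polarization of `V_i` at the support numbers
  `cotRho` and at `x`, divided by `r_i` (`exists_hasFDerivAt_curvature`). Since the inverse radii
  `h = 1 / r` have the variation `cotRho / r_i`, this is `V_i(h, x)`.
* The cubic form `∑ h_i V_i(x, x)` is a sum over the pyramids of forms with a symmetric
  polarization (`apex_trilinear`), so that `∑ h_i V_i(x, x) = ∑ x_i V_i(h, x)` (`sum_vertexForm`).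
  For `x` in the kernel of the Jacobian both sides vanish.
* `κ_i > 0` says that the total angle of the normals at `i` is less than `2π`. Then the area form is
  positive on at most a line (`exists_functional_area_neg`), and, as in Minkowski's inequality,
  `V_i(h, h) > 0` and `V_i(h, x) = 0` imply `V_i(x, x) ≤ 0`, with equality only if the variation
  of `x` at `i` vanishes (`mixedArea_self_nonpos_of_orthogonal`).

Hence in the kernel every `V_i(x, x)` is zero, all variations are zero, and `x = 0`.

It remains to see that `V_i(h, h) > 0`, and this is where convexity and `κ_i < δ_i` enter. Convexity
at the boundary edges says that the support numbers `cotRho` are those of a convex polygon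
(`slopeIn_le_slopeOut`), and `δ_i - κ_i` is the sum of `ω - L` over the triangles at `i`, with `ω`
the lateral dihedral angle and `L` the corner; this sum is the signed area of the central projection
of the polygon to the sphere. If all support numbers are positive, this is an ordinary area and
the planar area dominates it. Support numbers of both signs can occur; then there is exactly one
run of each sign, the areas are differences of areas of two radial regions, and the positive region
lies farther from the origin than the negative one in the sense that the difference of their angular
sizes changes its sign only once (`angular_size_single_crossing`). The spherical density decreases
with the distance, so that a positive spherical difference forces a positive planar difference
(`capArea_sub_le`, `mixedArea_pos_of_sphDefect_pos`).
-/

/-! ### Mixed areas of support numbers -/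

/-- Twice the mixed area, in a sector of angle `θ`, of two sinusoids given by their values
`u, v` and `u', v'` on the two sides of the sector, that is `∫ (f f₁ - f' f₁')` over the sector
for the solutions `f`, `f₁` of `f'' + f = 0` with these boundary values. -/
noncomputable def sectorForm (θ u v u' v' : ℝ) : ℝ :=
  (u * v' + u' * v - Real.cos θ * (u * u' + v * v')) / Real.sin θ

/-- Twice the mixed area of two polygons with the same edge directions, whose consecutive edge normals
make the angles `ω 0, …, ω (n - 1)`, in terms of their support numbers. -/
noncomputable def mixedArea (n : ℕ) (ω x y : ℕ → ℝ) : ℝ :=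
  ∑ j ∈ Finset.range n, sectorForm (ω j) (x j) (x (j + 1)) (y j) (y (j + 1))

theorem mixedArea_add_left (n : ℕ) (ω x x' y : ℕ → ℝ) :
    mixedArea n ω (x + x') y = mixedArea n ω x y + mixedArea n ω x' y := by
  simp only [mixedArea, sectorForm, ← Finset.sum_add_distrib, Pi.add_apply]
  exact Finset.sum_congr rfl fun j _ => by ring

theorem mixedArea_smul_left (n : ℕ) (ω x y : ℕ → ℝ) (t : ℝ) :
    mixedArea n ω (t • x) y = t * mixedArea n ω x y := by
  simp only [mixedArea, sectorForm, Finset.mul_sum, Pi.smul_apply, smul_eq_mul]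
  exact Finset.sum_congr rfl fun j _ => by ring

theorem mixedArea_comm (n : ℕ) (ω x y : ℕ → ℝ) :
    mixedArea n ω x y = mixedArea n ω y x := by
  simp only [mixedArea, sectorForm]
  exact Finset.sum_congr rfl fun j _ => by ring

/-- Two adjacent sectors: replacing the middle value `w` by the value of the sinusoid through
`u` and `v` changes the area by a square. -/
theorem sectorForm_merge {a b : ℝ} (ha : Real.sin a ≠ 0) (hb : Real.sin b ≠ 0)
    (hab : Real.sin (a + b) ≠ 0) (u v w : ℝ) :
    sectorForm a u w u w + sectorForm b w v w v =
      sectorForm (a + b) u v u v - Real.sin (a + b) / (Real.sin a * Real.sin b) *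
        (w - (u * Real.sin b + v * Real.sin a) / Real.sin (a + b)) ^ 2 := by
  have h1 : Real.cos (a + b) = Real.cos a * Real.cos b - Real.sin a * Real.sin b := Real.cos_add a b
  have h2 : Real.sin (a + b) = Real.sin a * Real.cos b + Real.cos a * Real.sin b := Real.sin_add a b
  have e1 : Real.sin (a + b) / (Real.sin a * Real.sin b) *
        (w - (u * Real.sin b + v * Real.sin a) / Real.sin (a + b)) ^ 2 =
      Real.sin (a + b) / (Real.sin a * Real.sin b) * w ^ 2
        - 2 * w * (u / Real.sin a + v / Real.sin b)
        + (u * Real.sin b + v * Real.sin a) ^ 2 /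
          (Real.sin a * Real.sin b * Real.sin (a + b)) := by
    field_simp
    ring
  have e2 : Real.sin (a + b) / (Real.sin a * Real.sin b) =
      Real.cos b / Real.sin b + Real.cos a / Real.sin a := by
    rw [h2]; field_simp
  have e3 : (u * Real.sin b + v * Real.sin a) ^ 2 /
          (Real.sin a * Real.sin b * Real.sin (a + b)) =
      2 * u * v / Real.sin (a + b) + u ^ 2 * (Real.sin b / (Real.sin a * Real.sin (a + b)))
        + v ^ 2 * (Real.sin a / (Real.sin b * Real.sin (a + b))) := by
    field_simp
    ring
  have e4 : Real.sin b / (Real.sin a * Real.sin (a + b)) =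
      Real.cos a / Real.sin a - Real.cos (a + b) / Real.sin (a + b) := by
    field_simp
    rw [h1, h2]
    have := Real.sin_sq_add_cos_sq a
    linear_combination (-Real.sin b) * this
  have e5 : Real.sin a / (Real.sin b * Real.sin (a + b)) =
      Real.cos b / Real.sin b - Real.cos (a + b) / Real.sin (a + b) := by
    field_simp
    rw [h1, h2]
    have := Real.sin_sq_add_cos_sq b
    linear_combination (-Real.sin a) * this
  rw [e1, e2, e3, e4, e5]
  unfold sectorForm
  ring

/-- A chain of sectors of total angle less than `π` has at most the area of the single sector with
the same end values; if the end values vanish, equality forces all values to vanish. -/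
theorem chain_area_le {ω : ℕ → ℝ} (hω : ∀ j, 0 < ω j) (y : ℕ → ℝ) (k : ℕ)
    (hk : ∑ j ∈ Finset.range (k + 1), ω j < Real.pi) :
    mixedArea (k + 1) ω y y ≤
        sectorForm (∑ j ∈ Finset.range (k + 1), ω j) (y 0) (y (k + 1)) (y 0) (y (k + 1)) ∧
      (y 0 = 0 → y (k + 1) = 0 → mixedArea (k + 1) ω y y = 0 → ∀ j ≤ k + 1, y j = 0) := by
  induction k with
  | zero =>
    simp only [mixedArea, zero_add, Finset.sum_range_one, le_refl, true_and]
    intro h0 h1 _ j hj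
    interval_cases j <;> assumption
  | succ k ih =>
    set A := ∑ j ∈ Finset.range (k + 1), ω j with hA
    have hAB : ∑ j ∈ Finset.range (k + 1 + 1), ω j = A + ω (k + 1) := Finset.sum_range_succ _ _
    have hApos : 0 < A := Finset.sum_pos (fun j _ => hω j) (by simp)
    rw [hAB] at hk ⊢
    have hb := hω (k + 1)
    obtain ⟨ih1, ih2⟩ := ih (by linarith)
    have sA : 0 < Real.sin A := Real.sin_pos_of_pos_of_lt_pi hApos (by linarith)
    have sb : 0 < Real.sin (ω (k + 1)) := Real.sin_pos_of_pos_of_lt_pi hb (by linarith)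
    have sAb : 0 < Real.sin (A + ω (k + 1)) := Real.sin_pos_of_pos_of_lt_pi (by linarith) hk
    have key := sectorForm_merge sA.ne' sb.ne' sAb.ne' (y 0) (y (k + 1 + 1)) (y (k + 1))
    have hs : mixedArea (k + 1 + 1) ω y y = mixedArea (k + 1) ω y y +
        sectorForm (ω (k + 1)) (y (k + 1)) (y (k + 1 + 1)) (y (k + 1)) (y (k + 1 + 1)) :=
      Finset.sum_range_succ _ _
    have hc : 0 < Real.sin (A + ω (k + 1)) / (Real.sin A * Real.sin (ω (k + 1))) := by positivity
    set d := y (k + 1) - (y 0 * Real.sin (ω (k + 1)) + y (k + 1 + 1) * Real.sin A) /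
      Real.sin (A + ω (k + 1)) with hd
    have hd2 : 0 ≤ Real.sin (A + ω (k + 1)) / (Real.sin A * Real.sin (ω (k + 1))) * d ^ 2 := by
      positivity
    refine ⟨by rw [hs]; linarith, ?_⟩
    intro h0 h2 hz
    have hq : sectorForm (A + ω (k + 1)) (y 0) (y (k + 1 + 1)) (y 0) (y (k + 1 + 1)) = 0 := by
      simp [sectorForm, h0, h2]
    have hd0 : Real.sin (A + ω (k + 1)) / (Real.sin A * Real.sin (ω (k + 1))) * d ^ 2 = 0 := by
      rw [hs] at hz; linarith
    have hd1 : d = 0 := by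
      rcases mul_eq_zero.1 hd0 with h | h
      · exact absurd h hc.ne'
      · exact pow_eq_zero_iff (two_ne_zero) |>.1 h
    have hy : y (k + 1) = 0 := by
      rw [hd, h0, h2] at hd1; simpa using hd1
    have hz' : mixedArea (k + 1) ω y y = 0 := by
      rw [hs] at hz
      have : sectorForm (ω (k + 1)) (y (k + 1)) (y (k + 1 + 1)) (y (k + 1)) (y (k + 1 + 1)) = 0 := by
        simp [sectorForm, hy, h2]
      linarith
    intro j hj
    rcases Nat.lt_or_ge j (k + 2) with h | h
    · exact ih2 h0 hy hz' j (by omega)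
    · have : j = k + 1 + 1 := by omega
      rw [this, h2]

theorem sectorForm_eq_half_tan {θ : ℝ} (h0 : 0 < θ) (h1 : θ < Real.pi) (u v : ℝ) :
    sectorForm θ u v u v =
      (Real.tan (θ / 2) * (u + v) ^ 2 - (1 / Real.tan (θ / 2)) * (u - v) ^ 2) / 2 := by
  have hs : 0 < Real.sin (θ / 2) := Real.sin_pos_of_pos_of_lt_pi (by linarith) (by linarith)
  have hc : 0 < Real.cos (θ / 2) := Real.cos_pos_of_mem_Ioo ⟨by linarith, by linarith⟩
  have e1 : Real.sin θ = 2 * Real.sin (θ / 2) * Real.cos (θ / 2) := by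
    rw [← Real.sin_two_mul]; congr 1; ring
  have e2 : Real.cos θ = Real.cos (θ / 2) ^ 2 - Real.sin (θ / 2) ^ 2 := by
    rw [← Real.cos_two_mul']; congr 1; ring
  have e3 := Real.sin_sq_add_cos_sq (θ / 2)
  unfold sectorForm
  rw [e1, e2, Real.tan_eq_sin_div_cos]
  field_simp
  linear_combination (-2 * u * v) * e3

theorem tan_half_pos {θ : ℝ} (h0 : 0 < θ) (h1 : θ < Real.pi) : 0 < Real.tan (θ / 2) :=
  Real.tan_pos_of_pos_of_lt_pi_div_two (by linarith) (by linarith)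

theorem tan_half_mul_lt {a b c : ℝ} (ha : 0 < a) (ha' : a < Real.pi) (hb : 0 < b)
    (hb' : b < Real.pi) (hc : 0 < c) (hc' : c < Real.pi) (h : a + b + c < 2 * Real.pi) :
    Real.tan (a / 2) * Real.tan (b / 2) * Real.tan (c / 2) <
      Real.tan (a / 2) + Real.tan (b / 2) + Real.tan (c / 2) := by
  have ca : 0 < Real.cos (a / 2) := Real.cos_pos_of_mem_Ioo ⟨by linarith, by linarith⟩
  have cb : 0 < Real.cos (b / 2) := Real.cos_pos_of_mem_Ioo ⟨by linarith, by linarith⟩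
  have cc : 0 < Real.cos (c / 2) := Real.cos_pos_of_mem_Ioo ⟨by linarith, by linarith⟩
  have hs : 0 < Real.sin (a / 2 + b / 2 + c / 2) :=
    Real.sin_pos_of_pos_of_lt_pi (by linarith) (by linarith)
  have e : Real.sin (a / 2 + b / 2 + c / 2) = Real.cos (a / 2) * Real.cos (b / 2) * Real.cos (c / 2)
      * ((Real.tan (a / 2) + Real.tan (b / 2) + Real.tan (c / 2)) -
        Real.tan (a / 2) * Real.tan (b / 2) * Real.tan (c / 2)) := by
    rw [Real.sin_add, Real.sin_add, Real.cos_add]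
    simp only [Real.tan_eq_sin_div_cos]
    field_simp
    ring
  rw [e] at hs
  have := (mul_pos_iff_of_pos_left (by positivity)).1 hs
  linarith

/-- The area form of three support numbers with total angle less than `2π` is negative definite
on a plane. -/
theorem three_sector_neg {a b c : ℝ} (ha : 0 < a) (ha' : a < Real.pi) (hb : 0 < b)
    (hb' : b < Real.pi) (hc : 0 < c) (hc' : c < Real.pi) (h : a + b + c < 2 * Real.pi)
    {x y z : ℝ} (hl : Real.tan (a / 2) * (x + y) + Real.tan (b / 2) * (y + z) +
      Real.tan (c / 2) * (z + x) = 0)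
    (hq : 0 ≤ sectorForm a x y x y + sectorForm b y z y z + sectorForm c z x z x) :
    x = 0 ∧ y = 0 ∧ z = 0 := by
  rw [sectorForm_eq_half_tan ha ha', sectorForm_eq_half_tan hb hb',
    sectorForm_eq_half_tan hc hc'] at hq
  have ht := tan_half_mul_lt ha ha' hb hb' hc hc' h
  have pa := tan_half_pos ha ha'
  have pb := tan_half_pos hb hb'
  have pc := tan_half_pos hc hc'
  set s := Real.tan (a / 2)
  set t := Real.tan (b / 2)
  set w := Real.tan (c / 2)
  have hS : 0 < s + t + w := by positivity
  -- Lagrange's identity for the weighted squares of the sums of adjacent values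
  have lag : (s + t + w) * (s * (x + y) ^ 2 + t * (y + z) ^ 2 + w * (z + x) ^ 2) =
      s * t * (x - z) ^ 2 + t * w * (y - x) ^ 2 + w * s * (z - y) ^ 2 := by
    linear_combination (s * (x + y) + t * (y + z) + w * (z + x)) * hl
  have hG : 0 < (s + t + w - s * t * w) := by linarith
  have hq2 : 0 ≤ s * (x + y) ^ 2 + t * (y + z) ^ 2 + w * (z + x) ^ 2
      - (1 / s * (x - y) ^ 2 + 1 / t * (y - z) ^ 2 + 1 / w * (z - x) ^ 2) := by linarith
  have e : (s + t + w) * (s * (x + y) ^ 2 + t * (y + z) ^ 2 + w * (z + x) ^ 2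
      - (1 / s * (x - y) ^ 2 + 1 / t * (y - z) ^ 2 + 1 / w * (z - x) ^ 2)) =
      - ((s + t + w - s * t * w) * (1 / s * (x - y) ^ 2 + 1 / t * (y - z) ^ 2
        + 1 / w * (z - x) ^ 2)) := by
    rw [mul_sub, lag]
    field_simp
    ring
  have h3 : 0 ≤ (s + t + w) * (s * (x + y) ^ 2 + t * (y + z) ^ 2 + w * (z + x) ^ 2
      - (1 / s * (x - y) ^ 2 + 1 / t * (y - z) ^ 2 + 1 / w * (z - x) ^ 2)) := by positivity
  rw [e] at h3
  have h4 : 1 / s * (x - y) ^ 2 + 1 / t * (y - z) ^ 2 + 1 / w * (z - x) ^ 2 ≤ 0 := by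
    by_contra hcon
    push Not at hcon
    have := mul_pos hG hcon
    linarith
  have p1 : 0 ≤ 1 / s * (x - y) ^ 2 := by positivity
  have p2 : 0 ≤ 1 / t * (y - z) ^ 2 := by positivity
  have p3 : 0 ≤ 1 / w * (z - x) ^ 2 := by positivity
  have q1 : x - y = 0 := by
    have : 1 / s * (x - y) ^ 2 = 0 := by linarith
    simpa [pa.ne'] using this
  have q2 : y - z = 0 := by
    have : 1 / t * (y - z) ^ 2 = 0 := by linarith
    simpa [pb.ne'] using this
  have hxy : y = x := by linarith
  have hxz : z = x := by linarith
  subst hxy; subst hxz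
  have : (s + t + w) * (2 * z) = 0 := by linarith
  have : z = 0 := by
    rcases mul_eq_zero.1 this with h | h
    · exact absurd h hS.ne'
    · linarith
  simp [this]

/-- Split of the area at an index. -/
theorem mixedArea_split (m k : ℕ) (ω x y : ℕ → ℝ) :
    mixedArea (m + k) ω x y = mixedArea m ω x y +
      mixedArea k (fun j => ω (m + j)) (fun j => x (m + j)) (fun j => y (m + j)) := by
  simp only [mixedArea, Finset.sum_range_add, add_assoc]

/-- The area form of a polygon with total angle less than `2π` is negative definite on the kernel
of some linear functional. -/
theorem exists_functional_area_neg {n : ℕ} (hn : 0 < n) {ω : ℕ → ℝ} (hω : ∀ j, 0 < ω j)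
    (hω' : ∀ j, ω j < Real.pi) (htot : ∑ j ∈ Finset.range n, ω j < 2 * Real.pi) :
    ∃ f : (ℕ → ℝ) →ₗ[ℝ] ℝ, ∀ y : ℕ → ℝ, y n = y 0 → f y = 0 → 0 ≤ mixedArea n ω y y →
      ∀ j < n, y j = 0 := by
  have hmono : ∀ k, 0 < k → 0 < ∑ j ∈ Finset.range k, ω j := fun k hk =>
    Finset.sum_pos (fun j _ => hω j) (by simp; omega)
  by_cases hsmall : ∑ j ∈ Finset.range n, ω j < Real.pi
  · obtain ⟨k, rfl⟩ : ∃ k, n = k + 1 := ⟨n - 1, by omega⟩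
    refine ⟨LinearMap.proj 0, fun y hy hf hq j hj => ?_⟩
    have hf : y 0 = 0 := hf
    obtain ⟨h1, h2⟩ := chain_area_le hω y k hsmall
    rw [hy, hf] at h1
    have : mixedArea (k + 1) ω y y = 0 := by
      refine le_antisymm (h1.trans ?_) hq
      simp [sectorForm]
    exact h2 hf (hy.trans hf) this j (by omega)
  · push Not at hsmall
    have hex : ∃ k, Real.pi ≤ ∑ j ∈ Finset.range k, ω j := ⟨n, hsmall⟩
    classical
    set k := Nat.find hex with hk
    have hk1 : Real.pi ≤ ∑ j ∈ Finset.range k, ω j := Nat.find_spec hex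
    have hkn : k ≤ n := Nat.find_min' hex hsmall
    have hk2 : 2 ≤ k := by
      by_contra hcon
      have : k = 0 ∨ k = 1 := by omega
      rcases this with h | h
      · rw [h] at hk1; simp at hk1; linarith [Real.pi_pos]
      · rw [h] at hk1; simp at hk1; linarith [hω' 0]
    obtain ⟨m, hm⟩ : ∃ m, k = m + 1 + 1 := ⟨k - 2, by omega⟩
    have hlt : ∑ j ∈ Finset.range (m + 1), ω j < Real.pi := by
      have := Nat.find_min hex (m := m + 1) (by omega)
      linarith [not_le.1 this]
    rw [hm] at hk1 hkn
    set a := ∑ j ∈ Finset.range (m + 1), ω j with ha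
    have ha0 : 0 < a := hmono _ (by omega)
    have hab : ∑ j ∈ Finset.range (m + 1 + 1), ω j = a + ω (m + 1) := Finset.sum_range_succ _ _
    rw [hab] at hk1
    rcases Nat.lt_or_ge (m + 1 + 1) n with hlt2 | hge
    · -- three groups of sectors
      obtain ⟨l, hl⟩ : ∃ l, n = (m + 1 + 1) + (l + 1) := ⟨n - (m + 1 + 1) - 1, by omega⟩
      set ω' : ℕ → ℝ := fun j => ω (m + 1 + 1 + j) with hω'd
      set c := ∑ j ∈ Finset.range (l + 1), ω' j with hc
      have hc0 : 0 < c := Finset.sum_pos (fun j _ => hω _) (by simp)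
      have htot' : a + ω (m + 1) + c < 2 * Real.pi := by
        rw [hl, Finset.sum_range_add, hab] at htot
        exact htot
      have hcpi : c < Real.pi := by linarith
      refine ⟨Real.tan (a / 2) • ((LinearMap.proj 0 : (ℕ → ℝ) →ₗ[ℝ] ℝ) + LinearMap.proj (m + 1)) +
        Real.tan (ω (m + 1) / 2) • ((LinearMap.proj (m + 1) : (ℕ → ℝ) →ₗ[ℝ] ℝ) + LinearMap.proj (m + 1 + 1)) +
        Real.tan (c / 2) • ((LinearMap.proj (m + 1 + 1) : (ℕ → ℝ) →ₗ[ℝ] ℝ) + LinearMap.proj 0),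
        fun y hy hf hq => ?_⟩
      simp only [LinearMap.add_apply, LinearMap.smul_apply, LinearMap.proj_apply,
        smul_eq_mul] at hf
      set y' : ℕ → ℝ := fun j => y (m + 1 + 1 + j) with hy'
      have hyl : y' (l + 1) = y 0 := by rw [← hy, hl]
      have hy0 : y' 0 = y (m + 1 + 1) := rfl
      obtain ⟨h1, h2⟩ := chain_area_le hω y m hlt
      obtain ⟨h3, h4⟩ := chain_area_le (ω := ω') (fun j => hω _) y' l hcpi
      rw [hyl, hy0] at h3 h4
      have hsplit : mixedArea n ω y y = mixedArea (m + 1) ω y y +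
          sectorForm (ω (m + 1)) (y (m + 1)) (y (m + 1 + 1)) (y (m + 1)) (y (m + 1 + 1)) +
          mixedArea (l + 1) ω' y' y' := by
        rw [hl, mixedArea_split]
        congr 1
        exact Finset.sum_range_succ _ _
      obtain ⟨z0, z1, z2⟩ := three_sector_neg ha0 hlt (hω _) (hω' _) hc0 hcpi htot' hf
        (by rw [hsplit] at hq; linarith)
      rw [z0, z1] at h1 h2
      rw [z2, z0] at h3 h4
      have hz : ∀ θ, sectorForm θ 0 0 0 0 = 0 := fun θ => by simp [sectorForm]
      rw [hz] at h1 h3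
      rw [hsplit, z1, z2, hz] at hq
      have w1 := h2 rfl rfl (by linarith)
      have w2 := h4 rfl rfl (by linarith)
      intro j hj
      rcases Nat.lt_or_ge j (m + 1 + 1) with h | h
      · exact w1 j (by omega)
      · have := w2 (j - (m + 1 + 1)) (by omega)
        simp only [hy'] at this
        rwa [show m + 1 + 1 + (j - (m + 1 + 1)) = j by omega] at this
    · -- two groups of sectors
      have hnm : n = m + 1 + 1 := by omega
      refine ⟨(LinearMap.proj 0 : (ℕ → ℝ) →ₗ[ℝ] ℝ) + LinearMap.proj (m + 1), fun y hy hf hq => ?_⟩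
      simp only [LinearMap.add_apply, LinearMap.proj_apply] at hf
      obtain ⟨h1, h2⟩ := chain_area_le hω y m hlt
      have hsplit : mixedArea n ω y y = mixedArea (m + 1) ω y y +
          sectorForm (ω (m + 1)) (y (m + 1)) (y 0) (y (m + 1)) (y 0) := by
        rw [← hy, hnm]
        exact Finset.sum_range_succ _ _
      have hym : y (m + 1) = - y 0 := by linarith
      rw [hym] at h1 h2 hsplit
      rw [sectorForm_eq_half_tan ha0 hlt] at h1
      rw [sectorForm_eq_half_tan (hω _) (hω' _)] at hsplit
      have t1 : 0 < 1 / Real.tan (a / 2) := one_div_pos.2 (tan_half_pos ha0 hlt)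
      have t2 : 0 < 1 / Real.tan (ω (m + 1) / 2) := one_div_pos.2 (tan_half_pos (hω _) (hω' _))
      have hb : mixedArea n ω y y ≤
          - (2 * (1 / Real.tan (a / 2) + 1 / Real.tan (ω (m + 1) / 2)) * y 0 ^ 2) := by
        rw [hsplit]
        nlinarith [h1]
      have hy0 : y 0 = 0 := by
        by_contra hne
        have : 0 < (2 * (1 / Real.tan (a / 2) + 1 / Real.tan (ω (m + 1) / 2)) * y 0 ^ 2) := by
          positivity
        linarith
      rw [hy0] at h1 h2 hsplit hym
      have w1 := h2 rfl (by simp) (by simp at h1 hsplit; linarith)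
      intro j hj
      exact w1 j (by omega)

theorem mixedArea_self_eq_zero {n : ℕ} (ω : ℕ → ℝ) {y : ℕ → ℝ} (hy : y n = y 0)
    (hz : ∀ j < n, y j = 0) : mixedArea n ω y y = 0 := by
  refine Finset.sum_eq_zero fun j hj => ?_
  have hj := Finset.mem_range.1 hj
  have h2 : y (j + 1) = 0 := by
    rcases Nat.lt_or_ge (j + 1) n with h' | h'
    · exact hz _ h'
    · rw [show j + 1 = n by omega, hy]; exact hz 0 (by omega)
  simp [sectorForm, hz j hj, h2]

/-- Minkowski's inequality in the form of a signature: for a polygon of total angle less than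
`2π`, the area form is negative definite on the orthogonal complement of a vector of positive
area. -/
theorem mixedArea_self_nonpos_of_orthogonal {n : ℕ} (hn : 0 < n) {ω : ℕ → ℝ} (hω : ∀ j, 0 < ω j)
    (hω' : ∀ j, ω j < Real.pi) (htot : ∑ j ∈ Finset.range n, ω j < 2 * Real.pi)
    {h x : ℕ → ℝ} (hh : h n = h 0) (hx : x n = x 0) (hpos : 0 < mixedArea n ω h h)
    (horth : mixedArea n ω h x = 0) :
    mixedArea n ω x x ≤ 0 ∧ (mixedArea n ω x x = 0 → ∀ j < n, x j = 0) := by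
  obtain ⟨f, hf⟩ := exists_functional_area_neg hn hω hω' htot
  have hfh : f h ≠ 0 := by
    intro h0
    have hz := hf h hh h0 hpos.le
    have := mixedArea_self_eq_zero ω hh hz
    linarith
  set t : ℝ := - (f x / f h) with ht
  have hfy : f (x + t • h) = 0 := by
    rw [map_add, map_smul, smul_eq_mul, ht]; field_simp; ring
  have hyn : (x + t • h) n = (x + t • h) 0 := by simp [hh, hx]
  have hV : mixedArea n ω (x + t • h) (x + t • h) =
      mixedArea n ω x x + t ^ 2 * mixedArea n ω h h := by
    rw [mixedArea_add_left, mixedArea_smul_left, mixedArea_comm n ω x, mixedArea_comm n ω h,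
      mixedArea_add_left, mixedArea_smul_left, mixedArea_add_left, mixedArea_smul_left,
      mixedArea_comm n ω x h, horth]
    ring
  have key := hf _ hyn hfy
  have zero_of : 0 ≤ mixedArea n ω x x → t = 0 ∧ ∀ j < n, x j = 0 := by
    intro h0
    have ht2 : 0 ≤ t ^ 2 * mixedArea n ω h h := by positivity
    have hz := key (by rw [hV]; linarith)
    have := mixedArea_self_eq_zero ω hyn hz
    have ht0 : t ^ 2 * mixedArea n ω h h = 0 := by linarith
    have ht1 : t = 0 := by
      rcases mul_eq_zero.1 ht0 with h' | h'
      · exact pow_eq_zero_iff two_ne_zero |>.1 h'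
      · exact absurd h' hpos.ne'
    refine ⟨ht1, fun j hj => ?_⟩
    simpa [ht1] using hz j hj
  refine ⟨?_, fun h0 => (zero_of h0.ge).2⟩
  by_contra hcon
  push Not at hcon
  have hz := (zero_of hcon.le).2
  have := mixedArea_self_eq_zero ω hx hz
  linarith

section

open MeasureTheory

/-! ### Comparison of radial areas -/

/-- The area of the central projection, to the unit sphere, of a planar sector of radius `r` and
unit angle; the plane touches the sphere at the vertex of the sector. -/
noncomputable def capArea (r : ℝ) : ℝ := 1 - 1 / √(1 + r ^ 2)

/-- The density of the spherical area with respect to the planar one at distance `r`. -/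
noncomputable def capDensity (r : ℝ) : ℝ := 1 / √(1 + r ^ 2) ^ 3

theorem sqrt_one_add_sq_pos (r : ℝ) : 0 < √(1 + r ^ 2) := Real.sqrt_pos.2 (by positivity)

theorem one_le_sqrt_one_add_sq (r : ℝ) : 1 ≤ √(1 + r ^ 2) :=
  Real.one_le_sqrt.2 (by nlinarith [sq_nonneg r])

theorem continuous_capDensity : Continuous capDensity := by
  unfold capDensity
  exact continuous_const.div (by fun_prop) fun r => (pow_pos (sqrt_one_add_sq_pos r) 3).ne'

theorem continuous_capArea : Continuous capArea := by
  unfold capArea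
  exact continuous_const.sub
    (continuous_const.div (by fun_prop) fun r => (sqrt_one_add_sq_pos r).ne')

theorem capDensity_pos (r : ℝ) : 0 < capDensity r := by
  have := sqrt_one_add_sq_pos r
  unfold capDensity; positivity

theorem capDensity_le_one (r : ℝ) : capDensity r ≤ 1 := by
  unfold capDensity
  rw [div_le_one (pow_pos (sqrt_one_add_sq_pos r) 3)]
  exact one_le_pow₀ (one_le_sqrt_one_add_sq r)

theorem capDensity_anti {r s : ℝ} (hr : 0 ≤ r) (hrs : r ≤ s) : capDensity s ≤ capDensity r := by
  have := sqrt_one_add_sq_pos r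
  unfold capDensity
  gcongr

theorem hasDerivAt_sqrt_one_add_sq (r : ℝ) :
    HasDerivAt (fun s : ℝ => √(1 + s ^ 2)) (r / √(1 + r ^ 2)) r := by
  have h : HasDerivAt (fun s : ℝ => 1 + s ^ 2) (2 * r) r := by
    simpa using (hasDerivAt_pow 2 r).const_add 1
  convert h.sqrt (by positivity) using 1
  rw [mul_div_mul_left _ _ two_ne_zero]

theorem integral_mul_capDensity (r : ℝ) : ∫ s in (0 : ℝ)..r, s * capDensity s = capArea r := by
  have hd : ∀ s : ℝ, HasDerivAt capArea (s * capDensity s) s := by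
    intro s
    have hs := sqrt_one_add_sq_pos s
    have h : HasDerivAt (fun x : ℝ => 1 - 1 / √(1 + x ^ 2))
        (-(-(s / √(1 + s ^ 2)) / √(1 + s ^ 2) ^ 2)) s := by
      simp only [one_div]
      exact ((hasDerivAt_sqrt_one_add_sq s).inv hs.ne').const_sub 1
    refine h.congr_deriv ?_
    unfold capDensity
    field_simp
  rw [intervalIntegral.integral_eq_sub_of_hasDerivAt (fun s _ => hd s)
    ((continuous_id.mul continuous_capDensity).intervalIntegrable _ _)]
  simp [capArea]

theorem capArea_nonneg (r : ℝ) : 0 ≤ capArea r := by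
  have h := one_le_sqrt_one_add_sq r
  unfold capArea
  rw [sub_nonneg, div_le_one (by linarith)]
  exact h

theorem capArea_le {r : ℝ} (hr : 0 ≤ r) : capArea r ≤ r ^ 2 / 2 := by
  have : r ^ 2 / 2 = ∫ s in (0 : ℝ)..r, s := by simp
  rw [← integral_mul_capDensity, this]
  refine intervalIntegral.integral_mono_on hr
    ((continuous_id.mul continuous_capDensity).intervalIntegrable _ _)
    (continuous_id.intervalIntegrable _ _) fun s hs => ?_
  exact mul_le_of_le_one_right hs.1 (capDensity_le_one s)

/-- If a continuous function `p` on `[0, a]` stays above `f` as soon as it is above `f`, and `f` is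
at least `c` on an interval that is longer by `κ` than the set where `p` is at least `c`, then
`p` is at most `f` to the left of this interval. -/
theorem le_left_of_volume_le {a κ c x y : ℝ} {p f : ℝ → ℝ} (hκ : 0 < κ) (hp : Continuous p)
    (hup : ∀ s t, 0 ≤ s → s ≤ t → t ≤ a → f s < p s → f t < p t)
    (hy : y ≤ a + κ) (hf : ∀ t ∈ Set.Icc x y, c ≤ f t)
    (hvol : volume ({t | c ≤ p t} ∩ Set.Icc 0 a) + ENNReal.ofReal κ ≤ ENNReal.ofReal (y - x)) :
    ∀ s, 0 ≤ s → s < x → p s ≤ f s := by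
  intro s hs hsx
  by_contra hcon
  push Not at hcon
  have hxy : κ ≤ y - x := by
    have h1 : ENNReal.ofReal κ ≤ ENNReal.ofReal (y - x) := le_trans (by simp) hvol
    by_contra h
    push Not at h
    exact absurd h1 (not_le.2 ((ENNReal.ofReal_lt_ofReal_iff hκ).2 h))
  have hpx : c < p x := lt_of_le_of_lt (hf x ⟨le_rfl, by linarith⟩)
    (hup s x hs hsx.le (by linarith) hcon)
  obtain ⟨ε, hε, hεp⟩ : ∃ ε > 0, ∀ t, |t - x| < ε → c < p t := by
    have := Metric.eventually_nhds_iff.1 (hp.continuousAt.eventually (lt_mem_nhds hpx))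
    obtain ⟨ε, hε, h⟩ := this
    exact ⟨ε, hε, fun t ht => h (by rwa [Real.dist_eq])⟩
  set x₁ := max s (x - ε / 2) with hx₁
  have hx₁x : x₁ < x := max_lt hsx (by linarith)
  have hsub : Set.Icc x₁ (min y a) ⊆ {t | c ≤ p t} ∩ Set.Icc 0 a := by
    intro t ht
    have hta : t ≤ a := ht.2.trans (min_le_right _ _)
    refine ⟨?_, hs.trans ((le_max_left _ _).trans ht.1), hta⟩
    rcases lt_or_ge t x with h | h
    · refine (hεp t ?_).le
      have := (le_max_right s (x - ε / 2)).trans ht.1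
      rw [abs_lt]; constructor <;> linarith
    · exact (hf t ⟨h, ht.2.trans (min_le_left _ _)⟩).trans
        (hup s t hs (hsx.le.trans h) hta hcon).le
  have hv := measure_mono (μ := volume) hsub
  rw [Real.volume_Icc] at hv
  have h2 : ENNReal.ofReal (min y a - x₁) + ENNReal.ofReal κ ≤ ENNReal.ofReal (y - x) :=
    (by gcongr : _ ≤ _).trans hvol
  have hmin : y - κ ≤ min y a := le_min (by linarith) (by linarith)
  rw [← ENNReal.ofReal_add (by linarith) hκ.le, ENNReal.ofReal_le_ofReal_iff (by linarith)] at h2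
  linarith

section compare

variable {a κ : ℝ} {p f : ℝ → ℝ}

/-- The difference between the angular sizes, outside radius `ρ`, of the regions with radial
functions `1 / p` on `[0, a]` and `1 / f` on `[0, a + κ]` changes its sign only once as `ρ`
grows. -/
theorem angular_size_single_crossing (hκ : 0 < κ) (ha : 0 ≤ a) (hp : Continuous p)
    (hfc : Continuous f) (hp0 : ∀ t ∈ Set.Icc 0 a, 0 < p t)
    (hf0 : ∀ t ∈ Set.Icc 0 (a + κ), 0 < f t)
    (hup : ∀ s t, 0 ≤ s → s ≤ t → t ≤ a → f s < p s → f t < p t)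
    (hdown : ∀ s t, 0 ≤ s → s ≤ t → t ≤ a → f (t + κ) < p t → f (s + κ) < p s)
    (hquasi : ∀ c > 0, ∀ s t u, 0 ≤ s → s ≤ t → t ≤ u → u ≤ a + κ → c ≤ f s → c ≤ f u → c ≤ f t)
    {ρ ρ' : ℝ} (hρ : 0 < ρ) (hρρ' : ρ ≤ ρ')
    (h : volume ({t | ρ < 1 / f t} ∩ Set.Icc 0 (a + κ)) ≤
      volume ({t | ρ < 1 / p t} ∩ Set.Icc 0 a)) :
    volume ({t | ρ' < 1 / f t} ∩ Set.Icc 0 (a + κ)) ≤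
      volume ({t | ρ' < 1 / p t} ∩ Set.Icc 0 a) := by
  have hρ' : 0 < ρ' := hρ.trans_le hρρ'
  set c := 1 / ρ with hc
  have hc0 : 0 < c := by positivity
  have key : ∀ {σ : ℝ} (_ : 0 < σ) {v : ℝ} (_ : 0 < v), (σ < 1 / v ↔ v < 1 / σ) :=
    fun hσ _ hv => lt_one_div hσ hv
  -- measure of the complements
  have hcompl : ∀ {q : ℝ → ℝ} {l : ℝ}, Continuous q → 0 ≤ l → (∀ t ∈ Set.Icc 0 l, 0 < q t) →
      volume ({t | ρ < 1 / q t} ∩ Set.Icc 0 l) + volume ({t | c ≤ q t} ∩ Set.Icc 0 l) =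
        ENNReal.ofReal l := by
    intro q l hq hl hq0
    have e : {t | ρ < 1 / q t} ∩ Set.Icc 0 l = Set.Icc 0 l \ {t | c ≤ q t} := by
      ext t
      simp only [Set.mem_inter_iff, Set.mem_ofPred_eq, Set.mem_sdiff, not_le]
      constructor
      · rintro ⟨h1, h2⟩; exact ⟨h2, (key hρ (hq0 t h2)).1 h1⟩
      · rintro ⟨h1, h2⟩; exact ⟨(key hρ (hq0 t h1)).2 h2, h1⟩
    rw [e, Set.inter_comm, measure_sdiff_add_inter _ (measurableSet_le measurable_const hq.measurable),
      Real.volume_Icc, sub_zero]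
  have cP := hcompl hp ha hp0
  have cN := hcompl hfc (by linarith) hf0
  have fin : ∀ {q : ℝ → ℝ} {l : ℝ}, volume ({t | ρ < 1 / q t} ∩ Set.Icc 0 l) ≠ ⊤ := fun {q l} =>
    ((measure_mono Set.inter_subset_right).trans_lt (by simp [Real.volume_Icc])).ne
  have hvol : volume ({t | c ≤ p t} ∩ Set.Icc 0 a) + ENNReal.ofReal κ ≤
      volume ({t | c ≤ f t} ∩ Set.Icc 0 (a + κ)) := by
    rw [ENNReal.ofReal_add ha hκ.le, ← cP] at cN
    have : volume ({t | ρ < 1 / p t} ∩ Set.Icc 0 a) +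
        (volume ({t | c ≤ p t} ∩ Set.Icc 0 a) + ENNReal.ofReal κ) ≤
        volume ({t | ρ < 1 / p t} ∩ Set.Icc 0 a) +
          volume ({t | c ≤ f t} ∩ Set.Icc 0 (a + κ)) := by
      rw [← add_assoc, ← cN]
      gcongr
    exact (ENNReal.add_le_add_iff_left fin).1 this
  obtain ⟨x, y, hI⟩ : ∃ x y, {t | c ≤ f t} ∩ Set.Icc 0 (a + κ) = Set.Icc x y := by
    have hne : ({t | c ≤ f t} ∩ Set.Icc 0 (a + κ)).Nonempty := by
      rw [Set.nonempty_iff_ne_empty]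
      intro h0
      rw [h0, measure_empty] at hvol
      have : ENNReal.ofReal κ ≤ 0 := le_trans (by simp) hvol
      simp at this; linarith
    have hcpt : IsCompact ({t | c ≤ f t} ∩ Set.Icc 0 (a + κ)) :=
      isCompact_Icc.inter_left (isClosed_le continuous_const hfc)
    have hord : Set.OrdConnected ({t | c ≤ f t} ∩ Set.Icc 0 (a + κ)) :=
      ⟨fun s hs u hu t ht => ⟨hquasi c hc0 s t u hs.2.1 ht.1 ht.2 hu.2.2 hs.1 hu.1,
        hs.2.1.trans ht.1, ht.2.trans hu.2.2⟩⟩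
    exact ⟨_, _, eq_Icc_of_connected_compact ⟨hne, hord.isPreconnected⟩ hcpt⟩
  rw [hI, Real.volume_Icc] at hvol
  have hxy : κ ≤ y - x := by
    have h1 : ENNReal.ofReal κ ≤ ENNReal.ofReal (y - x) := le_trans (by simp) hvol
    by_contra h
    push Not at h
    exact absurd h1 (not_le.2 ((ENNReal.ofReal_lt_ofReal_iff hκ).2 h))
  have hfI : ∀ t ∈ Set.Icc x y, c ≤ f t := fun t ht => by rw [← hI] at ht; exact ht.1
  have hx0 : 0 ≤ x := by
    have : x ∈ Set.Icc x y := ⟨le_rfl, by linarith⟩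
    rw [← hI] at this; exact this.2.1
  have hyb : y ≤ a + κ := by
    have : y ∈ Set.Icc x y := ⟨by linarith, le_rfl⟩
    rw [← hI] at this; exact this.2.2
  have left := le_left_of_volume_le hκ hp hup hyb hfI hvol
  -- the same statement for the reflected functions
  have right : ∀ s, s ≤ a → y - κ < s → p s ≤ f (s + κ) := by
    have := le_left_of_volume_le (a := a) (κ := κ) (c := c) (x := a + κ - y) (y := a + κ - x)
      (p := fun t => p (a - t)) (f := fun t => f (a - t + κ)) hκ (by fun_prop)
      (fun s t hs hst ht hlt => hdown (a - t) (a - s) (by linarith) (by linarith) (by linarith) hlt)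
      (by linarith) (fun t ht => hfI _ ⟨by linarith [ht.2], by linarith [ht.1]⟩) ?_
    · intro s hs hys
      have := this (a - s) (by linarith) (by linarith)
      simpa using this
    · have e : {t | c ≤ p (a - t)} ∩ Set.Icc 0 a = (fun t => a - t) ⁻¹' ({t | c ≤ p t} ∩ Set.Icc 0 a) := by
        ext t
        simp only [Set.mem_inter_iff, Set.mem_ofPred_eq, Set.mem_Icc, Set.mem_preimage]
        constructor
        · rintro ⟨h1, h2, h3⟩; exact ⟨h1, by linarith, by linarith⟩
        · rintro ⟨h1, h2, h3⟩; exact ⟨h1, by linarith, by linarith⟩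
      rw [e, (Measure.measurePreserving_sub_left volume a).measure_preimage
        ((measurableSet_le measurable_const hp.measurable).inter measurableSet_Icc).nullMeasurableSet]
      convert hvol using 2
      ring
  set c' := 1 / ρ' with hc'
  have hcc' : c' ≤ c := one_div_le_one_div_of_le hρ hρρ'
  have hsubN : {t | ρ' < 1 / f t} ∩ Set.Icc 0 (a + κ) ⊆
      ({t | p t < c'} ∩ Set.Ico 0 x) ∪ (fun t => t - κ) ⁻¹' ({t | p t < c'} ∩ Set.Ioc (y - κ) a) := by
    rintro t ⟨h1, h2⟩
    have h3 : f t < c' := (key hρ' (hf0 t h2)).1 h1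
    rcases lt_or_ge t x with hx | hx
    · exact Or.inl ⟨lt_of_le_of_lt (left t h2.1 hx) h3, h2.1, hx⟩
    · rcases lt_or_ge y t with hy | hy
      · refine Or.inr ⟨?_, by linarith, by linarith [h2.2]⟩
        have := right (t - κ) (by linarith [h2.2]) (by linarith)
        rw [sub_add_cancel] at this
        exact lt_of_le_of_lt this h3
      · exact absurd (hfI t ⟨hx, hy⟩) (not_le.2 (h3.trans_le hcc'))
  have hsubP : ({t | p t < c'} ∩ Set.Ico 0 x) ∪ ({t | p t < c'} ∩ Set.Ioc (y - κ) a) ⊆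
      {t | ρ' < 1 / p t} ∩ Set.Icc 0 a := by
    rintro t (⟨h1, h2⟩ | ⟨h1, h2⟩)
    · have : t ∈ Set.Icc 0 a := ⟨h2.1, by linarith [h2.2]⟩
      exact ⟨(key hρ' (hp0 t this)).2 h1, this⟩
    · have : t ∈ Set.Icc 0 a := ⟨by linarith [h2.1], h2.2⟩
      exact ⟨(key hρ' (hp0 t this)).2 h1, this⟩
  have hdisj : Disjoint ({t | p t < c'} ∩ Set.Ico 0 x) ({t | p t < c'} ∩ Set.Ioc (y - κ) a) := by
    rw [Set.disjoint_left]
    rintro t ⟨_, h2⟩ ⟨_, h3⟩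
    linarith [h2.2, h3.1]
  calc volume ({t | ρ' < 1 / f t} ∩ Set.Icc 0 (a + κ))
      ≤ volume ({t | p t < c'} ∩ Set.Ico 0 x) +
        volume ((fun t => t - κ) ⁻¹' ({t | p t < c'} ∩ Set.Ioc (y - κ) a)) :=
        (measure_mono hsubN).trans (measure_union_le _ _)
    _ = volume ({t | p t < c'} ∩ Set.Ico 0 x) + volume ({t | p t < c'} ∩ Set.Ioc (y - κ) a) := by
        rw [(measurePreserving_sub_right volume κ).measure_preimage
          ((measurableSet_lt hp.measurable measurable_const).inter
            measurableSet_Ioc).nullMeasurableSet]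
    _ = volume (({t | p t < c'} ∩ Set.Ico 0 x) ∪ ({t | p t < c'} ∩ Set.Ioc (y - κ) a)) :=
        (measure_union hdisj ((measurableSet_lt hp.measurable measurable_const).inter
          measurableSet_Ioc)).symm
    _ ≤ _ := measure_mono hsubP

/-- The layer cake formula for a region with radial function `1 / q`. -/
theorem ofReal_integral_radial {q : ℝ → ℝ} {l : ℝ} (hl : 0 ≤ l) (hq : Continuous q)
    (hq0 : ∀ t ∈ Set.Icc 0 l, 0 < q t) {g : ℝ → ℝ} (hg : Continuous g) (hg0 : ∀ t, 0 ≤ t → 0 ≤ g t)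
    {G : ℝ → ℝ} (hG : ∀ r, ∫ s in (0 : ℝ)..r, g s = G r) (hGc : Continuous G) :
    ENNReal.ofReal (∫ t in (0 : ℝ)..l, G (1 / q t)) =
      ∫⁻ ρ in Set.Ioi (0 : ℝ), volume ({t | ρ < 1 / q t} ∩ Set.Icc 0 l) * ENNReal.ofReal (g ρ) := by
  have hpos : ∀ t ∈ Set.Icc 0 l, 0 ≤ 1 / q t := fun t ht => (one_div_pos.2 (hq0 t ht)).le
  have hG0 : ∀ r, 0 ≤ r → 0 ≤ G r := fun r hr => by
    rw [← hG]; exact intervalIntegral.integral_nonneg hr fun s hs => hg0 s hs.1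
  have hmeas : Measurable fun t => 1 / q t := by
    simp only [one_div]; exact hq.measurable.inv
  have lc := lintegral_comp_eq_lintegral_meas_lt_mul (volume.restrict (Set.Icc 0 l))
    (f := fun t => 1 / q t) (g := g)
    ((ae_restrict_iff' measurableSet_Icc).2 (Filter.Eventually.of_forall hpos))
    hmeas.aemeasurable (fun t _ => hg.intervalIntegrable _ _)
    ((ae_restrict_iff' measurableSet_Ioi).2
      (Filter.Eventually.of_forall fun t ht => hg0 t (le_of_lt ht)))
  simp only [hG] at lc
  have e : ∀ ρ, (volume.restrict (Set.Icc 0 l)) {t | ρ < 1 / q t} =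
      volume ({t | ρ < 1 / q t} ∩ Set.Icc 0 l) := fun ρ =>
    Measure.restrict_apply (measurableSet_lt measurable_const hmeas)
  simp only [e] at lc
  rw [← lc, intervalIntegral.integral_of_le hl, ← integral_Icc_eq_integral_Ioc,
    ofReal_integral_eq_lintegral_ofReal]
  · refine ContinuousOn.integrableOn_compact isCompact_Icc ?_
    exact hGc.comp_continuousOn (continuousOn_const.div hq.continuousOn fun t ht => (hq0 t ht).ne')
  · exact (ae_restrict_iff' measurableSet_Icc).2
      (Filter.Eventually.of_forall fun t ht => hG0 _ (hpos t ht))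

/-- Comparison of the spherical and the planar area of the difference of two radial regions: the
difference lies far from the origin where it is positive and near it where it is negative, and the
density of the spherical area decreases with the distance. -/
theorem capArea_sub_le (hκ : 0 < κ) (ha : 0 ≤ a) (hp : Continuous p)
    (hfc : Continuous f) (hp0 : ∀ t ∈ Set.Icc 0 a, 0 < p t)
    (hf0 : ∀ t ∈ Set.Icc 0 (a + κ), 0 < f t)
    (hup : ∀ s t, 0 ≤ s → s ≤ t → t ≤ a → f s < p s → f t < p t)
    (hdown : ∀ s t, 0 ≤ s → s ≤ t → t ≤ a → f (t + κ) < p t → f (s + κ) < p s)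
    (hquasi : ∀ c > 0, ∀ s t u, 0 ≤ s → s ≤ t → t ≤ u → u ≤ a + κ → c ≤ f s → c ≤ f u → c ≤ f t) :
    ∃ l : ℝ, 0 ≤ l ∧ l ≤ 1 ∧
      (∫ t in (0 : ℝ)..a, capArea (1 / p t)) - (∫ t in (0 : ℝ)..(a + κ), capArea (1 / f t)) ≤
        l * ((∫ t in (0 : ℝ)..a, (1 / p t) ^ 2 / 2) -
          ∫ t in (0 : ℝ)..(a + κ), (1 / f t) ^ 2 / 2) := by
  have hb : 0 ≤ a + κ := by linarith
  set P : ℝ → ENNReal := fun ρ => volume ({t | ρ < 1 / p t} ∩ Set.Icc 0 a) with hP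
  set N : ℝ → ENNReal := fun ρ => volume ({t | ρ < 1 / f t} ∩ Set.Icc 0 (a + κ)) with hN
  have hw : Continuous fun s => s * capDensity s := continuous_id.mul continuous_capDensity
  have hw0 : ∀ s, 0 ≤ s → 0 ≤ s * capDensity s := fun s hs => mul_nonneg hs (capDensity_pos s).le
  have hsq : ∀ r : ℝ, ∫ s in (0 : ℝ)..r, s = r ^ 2 / 2 := fun r => by simp
  have hsqc : Continuous fun r : ℝ => r ^ 2 / 2 := by fun_prop
  have e1 := ofReal_integral_radial ha hp hp0 hw hw0 integral_mul_capDensity continuous_capArea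
  have e2 := ofReal_integral_radial hb hfc hf0 hw hw0 integral_mul_capDensity continuous_capArea
  have e3 := ofReal_integral_radial ha hp hp0 continuous_id (fun t ht => ht) hsq hsqc
  have e4 := ofReal_integral_radial hb hfc hf0 continuous_id (fun t ht => ht) hsq hsqc
  have hcross : ∀ {ρ ρ' : ℝ}, 0 < ρ → ρ ≤ ρ' → N ρ ≤ P ρ → N ρ' ≤ P ρ' := fun hρ hρρ' h =>
    angular_size_single_crossing hκ ha hp hfc hp0 hf0 hup hdown hquasi hρ hρρ' h
  -- the value of the density at the radius where the sign changes
  obtain ⟨l, hl0, hl1, hl⟩ : ∃ l : ℝ, 0 ≤ l ∧ l ≤ 1 ∧ ∀ ρ > 0,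
      (N ρ ≤ P ρ ∧ capDensity ρ ≤ l) ∨ (P ρ ≤ N ρ ∧ l ≤ capDensity ρ) := by
    set S := {ρ : ℝ | 0 < ρ ∧ N ρ ≤ P ρ} with hS
    by_cases hne : S.Nonempty
    · have hbdd : BddBelow S := ⟨0, fun ρ hρ => hρ.1.le⟩
      have hinf : 0 ≤ sInf S := le_csInf hne fun ρ hρ => hρ.1.le
      refine ⟨capDensity (sInf S), (capDensity_pos _).le, capDensity_le_one _, fun ρ hρ => ?_⟩
      by_cases hm : N ρ ≤ P ρ
      · exact Or.inl ⟨hm, capDensity_anti hinf (csInf_le hbdd ⟨hρ, hm⟩)⟩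
      · refine Or.inr ⟨(not_le.1 hm).le, capDensity_anti hρ.le ?_⟩
        refine le_csInf hne fun σ hσ => ?_
        by_contra hlt
        exact hm (hcross hσ.1 (not_le.1 hlt).le hσ.2)
    · refine ⟨0, le_rfl, zero_le_one, fun ρ hρ => Or.inr ⟨?_, (capDensity_pos ρ).le⟩⟩
      by_contra hlt
      exact hne ⟨ρ, hρ, (not_le.1 hlt).le⟩
  refine ⟨l, hl0, hl1, ?_⟩
  have nn : ∀ {q : ℝ → ℝ} {m : ℝ}, 0 ≤ m → (∀ t ∈ Set.Icc 0 m, 0 < q t) →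
      0 ≤ ∫ t in (0 : ℝ)..m, capArea (1 / q t) ∧ 0 ≤ ∫ t in (0 : ℝ)..m, (1 / q t) ^ 2 / 2 :=
    fun hm _ => ⟨intervalIntegral.integral_nonneg hm fun _ _ => capArea_nonneg _,
      intervalIntegral.integral_nonneg hm fun _ _ => by positivity⟩
  obtain ⟨p1, p2⟩ := nn ha hp0
  obtain ⟨n1, n2⟩ := nn hb hf0
  set IP := ∫ t in (0 : ℝ)..a, capArea (1 / p t)
  set IN := ∫ t in (0 : ℝ)..(a + κ), capArea (1 / f t)
  set QP := ∫ t in (0 : ℝ)..a, (1 / p t) ^ 2 / 2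
  set QN := ∫ t in (0 : ℝ)..(a + κ), (1 / f t) ^ 2 / 2
  suffices hsuff : ENNReal.ofReal (IP + l * QN) ≤ ENNReal.ofReal (IN + l * QP) by
    rw [ENNReal.ofReal_le_ofReal_iff (by positivity)] at hsuff
    linarith
  have anti : ∀ {q : ℝ → ℝ} {m : ℝ}, Measurable fun ρ : ℝ =>
      volume ({t | ρ < 1 / q t} ∩ Set.Icc 0 m) := fun {q m} =>
    Antitone.measurable fun ρ σ h => measure_mono fun t ht => ⟨lt_of_le_of_lt h ht.1, ht.2⟩
  rw [ENNReal.ofReal_add p1 (by positivity), ENNReal.ofReal_add n1 (by positivity),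
    ENNReal.ofReal_mul hl0, ENNReal.ofReal_mul hl0, e1, e2, e3, e4,
    ← lintegral_const_mul' _ _ ENNReal.ofReal_ne_top,
    ← lintegral_const_mul' _ _ ENNReal.ofReal_ne_top,
    ← lintegral_add_left (by
      exact anti.mul (ENNReal.measurable_ofReal.comp hw.measurable)),
    ← lintegral_add_left (by
      exact anti.mul (ENNReal.measurable_ofReal.comp hw.measurable))]
  refine setLIntegral_mono' measurableSet_Ioi fun ρ hρ => ?_
  have hρ : 0 < ρ := hρ
  have finP : P ρ ≠ ⊤ := ((measure_mono Set.inter_subset_right).trans_lt (by simp)).ne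
  have finN : N ρ ≠ ⊤ := ((measure_mono Set.inter_subset_right).trans_lt (by simp)).ne
  change P ρ * ENNReal.ofReal (ρ * capDensity ρ) + ENNReal.ofReal l * (N ρ * ENNReal.ofReal ρ) ≤
    N ρ * ENNReal.ofReal (ρ * capDensity ρ) + ENNReal.ofReal l * (P ρ * ENNReal.ofReal ρ)
  have main : (P ρ).toReal * (ρ * capDensity ρ) + l * ((N ρ).toReal * ρ) ≤
      (N ρ).toReal * (ρ * capDensity ρ) + l * ((P ρ).toReal * ρ) := by
    have : 0 ≤ ρ * (((P ρ).toReal - (N ρ).toReal) * (l - capDensity ρ)) := by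
      refine mul_nonneg hρ.le ?_
      rcases hl ρ hρ with ⟨h1, h2⟩ | ⟨h1, h2⟩
      · have := (ENNReal.toReal_le_toReal finN finP).2 h1
        exact mul_nonneg (by linarith) (by linarith)
      · have := (ENNReal.toReal_le_toReal finP finN).2 h1
        exact mul_nonneg_of_nonpos_of_nonpos (by linarith) (by linarith)
    linarith
  have hd := capDensity_pos ρ
  have := ENNReal.ofReal_le_ofReal main
  rw [ENNReal.ofReal_add (by positivity) (by positivity),
    ENNReal.ofReal_add (by positivity) (by positivity),
    ENNReal.ofReal_mul (p := (P ρ).toReal) (by positivity), ENNReal.ofReal_mul hl0,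
    ENNReal.ofReal_mul (p := (N ρ).toReal) (by positivity),
    ENNReal.ofReal_mul (p := (N ρ).toReal) (by positivity), ENNReal.ofReal_mul hl0,
    ENNReal.ofReal_mul (p := (P ρ).toReal) (by positivity),
    ENNReal.ofReal_toReal finP, ENNReal.ofReal_toReal finN] at this
  exact this

end compare

/-! ### A single sector -/

/-- The derivative, at the beginning of a sector of angle `θ`, of the sinusoid with boundary values
`u` and `v`. -/
noncomputable def slopeOut (θ u v : ℝ) : ℝ := (v - u * Real.cos θ) / Real.sin θ

/-- The derivative, at the end of a sector of angle `θ`, of the sinusoid with boundary values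
`u` and `v`. -/
noncomputable def slopeIn (θ u v : ℝ) : ℝ := (v * Real.cos θ - u) / Real.sin θ

/-- The side opposite to the angle `θ` in the spherical triangle whose other two sides have the
cotangents `u` and `v`. -/
noncomputable def sphSide (θ u v : ℝ) : ℝ :=
  Real.arccos ((Real.cos θ + u * v) / (√(1 + u ^ 2) * √(1 + v ^ 2)))

/-- The area of the central projection to the sphere of the right triangle with legs `g` and `p`
whose vertex at the leg `g` is the point of contact of the plane with the sphere. -/
noncomputable def capTriangle (g p : ℝ) : ℝ :=
  Real.arctan (p / g) - Real.arctan (p / (g * √(1 + g ^ 2 + p ^ 2)))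

theorem sectorForm_eq_slope (θ u v : ℝ) :
    sectorForm θ u v u v = u * slopeOut θ u v - v * slopeIn θ u v := by
  unfold sectorForm slopeOut slopeIn; ring

theorem slope_sq_add_sq {θ : ℝ} (h : Real.sin θ ≠ 0) (u v : ℝ) :
    u ^ 2 + slopeOut θ u v ^ 2 = v ^ 2 + slopeIn θ u v ^ 2 := by
  unfold slopeOut slopeIn
  field_simp
  have := Real.sin_sq_add_cos_sq θ
  linear_combination (u ^ 2 - v ^ 2) * this

theorem sin_arctan_eq (z : ℝ) : Real.sin (Real.arctan z) = Real.cos (Real.arctan z) * z := by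
  rw [Real.sin_arctan, Real.cos_arctan]; ring

/-- If the vector `(g, p)` is the rotation by `-θ` of a positive multiple of `(g', p')`, then the
difference of their arguments is `θ`; the arguments modulo `π` are given by the arctangent. -/
theorem arctan_sub_arctan_of_rotation {θ g p g' p' k : ℝ} (h0 : 0 < θ) (h1 : θ < Real.pi)
    (hg : g ≠ 0) (hg' : g' ≠ 0) (hk : 0 < k) (hc : k * Real.cos θ = g * g' + p * p')
    (hs : k * Real.sin θ = p * g' - p' * g) :
    Real.arctan (p / g) - Real.arctan (p' / g') = if 0 < g * g' then θ else θ - Real.pi := by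
  set x := Real.arctan (p / g) with hx
  set y := Real.arctan (p' / g') with hy
  have x1 := Real.neg_pi_div_two_lt_arctan (p / g)
  have x2 := Real.arctan_lt_pi_div_two (p / g)
  have y1 := Real.neg_pi_div_two_lt_arctan (p' / g')
  have y2 := Real.arctan_lt_pi_div_two (p' / g')
  have cx : 0 < Real.cos x := Real.cos_arctan_pos _
  have cy : 0 < Real.cos y := Real.cos_arctan_pos _
  have sx : Real.sin x = Real.cos x * (p / g) := sin_arctan_eq _
  have sy : Real.sin y = Real.cos y * (p' / g') := sin_arctan_eq _
  set K := Real.cos x * Real.cos y * k / (g * g') with hK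
  have e1 : Real.cos (x - y) = K * Real.cos θ := by
    rw [Real.cos_sub, sx, sy, hK]
    field_simp
    linear_combination (-1 : ℝ) * hc
  have e2 : Real.sin (x - y) = K * Real.sin θ := by
    rw [Real.sin_sub, sx, sy, hK]
    field_simp
    linear_combination (-1 : ℝ) * hs
  have hK2 : K ^ 2 = 1 := by
    have a1 := Real.sin_sq_add_cos_sq (x - y)
    have a2 := Real.sin_sq_add_cos_sq θ
    rw [e1, e2] at a1
    linear_combination a1 - K ^ 2 * a2
  have a2 := Real.sin_sq_add_cos_sq θ
  split_ifs with h
  · have hKpos : 0 < K := by positivity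
    have hK1 : K = 1 := by nlinarith
    have : Real.cos (x - y - θ) = 1 := by
      rw [Real.cos_sub, e1, e2, hK1]; linear_combination a2
    have := (Real.cos_eq_one_iff_of_lt_of_lt (by linarith) (by linarith)).1 this
    linarith
  · have hneg : g * g' < 0 := lt_of_le_of_ne (not_lt.1 h) (mul_ne_zero hg hg')
    have hKneg : K < 0 := div_neg_of_pos_of_neg (by positivity) hneg
    have hK1 : K = -1 := by nlinarith
    have : Real.cos (x - y - θ + Real.pi) = 1 := by
      rw [Real.cos_add_pi, Real.cos_sub, e1, e2, hK1]; linear_combination a2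
    have := (Real.cos_eq_one_iff_of_lt_of_lt (by linarith) (by linarith)).1 this
    linarith

section sector

variable {θ u v : ℝ}

theorem slope_cos (h : Real.sin θ ≠ 0) :
    (u ^ 2 + slopeOut θ u v ^ 2) * Real.cos θ = u * v + slopeOut θ u v * slopeIn θ u v := by
  unfold slopeOut slopeIn
  field_simp
  have := Real.sin_sq_add_cos_sq θ
  linear_combination (u ^ 2 * Real.cos θ - u * v) * this

theorem slope_sin (h : Real.sin θ ≠ 0) :
    (u ^ 2 + slopeOut θ u v ^ 2) * Real.sin θ = slopeOut θ u v * v - slopeIn θ u v * u := by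
  unfold slopeOut slopeIn
  field_simp
  have := Real.sin_sq_add_cos_sq θ
  linear_combination (u ^ 2) * this

theorem arctan_slope_sub (h0 : 0 < θ) (h1 : θ < Real.pi) (hu : u ≠ 0) (hv : v ≠ 0) :
    Real.arctan (slopeOut θ u v / u) - Real.arctan (slopeIn θ u v / v) =
      if 0 < u * v then θ else θ - Real.pi := by
  have hs := (Real.sin_pos_of_pos_of_lt_pi h0 h1).ne'
  exact arctan_sub_arctan_of_rotation h0 h1 hu hv (by positivity) (slope_cos hs) (slope_sin hs)

theorem sphSide_bounds (h0 : 0 < θ) (h1 : θ < Real.pi) :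
    0 < sphSide θ u v ∧ sphSide θ u v < Real.pi ∧
      Real.cos (sphSide θ u v) = (Real.cos θ + u * v) / (√(1 + u ^ 2) * √(1 + v ^ 2)) ∧
      Real.sin (sphSide θ u v) = Real.sin θ * √(1 + u ^ 2 + slopeOut θ u v ^ 2) /
        (√(1 + u ^ 2) * √(1 + v ^ 2)) := by
  have hs := Real.sin_pos_of_pos_of_lt_pi h0 h1
  have hu := sqrt_one_add_sq_pos u
  have hv := sqrt_one_add_sq_pos v
  have hM : 0 < √(1 + u ^ 2 + slopeOut θ u v ^ 2) := Real.sqrt_pos.2 (by positivity)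
  have qu : √(1 + u ^ 2) ^ 2 = 1 + u ^ 2 := Real.sq_sqrt (by positivity)
  have qv : √(1 + v ^ 2) ^ 2 = 1 + v ^ 2 := Real.sq_sqrt (by positivity)
  have qM : √(1 + u ^ 2 + slopeOut θ u v ^ 2) ^ 2 = 1 + u ^ 2 + slopeOut θ u v ^ 2 :=
    Real.sq_sqrt (by positivity)
  have hsq : (Real.sin θ * √(1 + u ^ 2 + slopeOut θ u v ^ 2) / (√(1 + u ^ 2) * √(1 + v ^ 2))) ^ 2 +
      ((Real.cos θ + u * v) / (√(1 + u ^ 2) * √(1 + v ^ 2))) ^ 2 = 1 := by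
    rw [div_pow, div_pow, mul_pow, mul_pow, qu, qv, qM, ← add_div, div_eq_one_iff_eq (by positivity)]
    unfold slopeOut
    field_simp
    have := Real.sin_sq_add_cos_sq θ
    linear_combination (1 + u ^ 2) * this
  set c := (Real.cos θ + u * v) / (√(1 + u ^ 2) * √(1 + v ^ 2)) with hc
  set s := Real.sin θ * √(1 + u ^ 2 + slopeOut θ u v ^ 2) / (√(1 + u ^ 2) * √(1 + v ^ 2)) with hsd
  have hspos : 0 < s := by positivity
  have hc1 : c < 1 := by nlinarith
  have hc2 : -1 < c := by nlinarith
  refine ⟨Real.arccos_pos.2 hc1, ?_, Real.cos_arccos hc2.le hc1.le, ?_⟩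
  · exact lt_of_le_of_ne (Real.arccos_le_pi _) fun h =>
      absurd (Real.arccos_eq_pi.1 h) (not_le.2 hc2)
  · rw [sphSide, Real.sin_arccos, ← hc, show 1 - c ^ 2 = s ^ 2 by linarith, Real.sqrt_sq hspos.le]

/-- The spherical excess of a sector, as a difference of two right triangles. -/
theorem angle_sub_sphSide (h0 : 0 < θ) (h1 : θ < Real.pi) (hu : u ≠ 0) (hv : v ≠ 0) :
    θ - sphSide θ u v = capTriangle u (slopeOut θ u v) - capTriangle v (slopeIn θ u v) := by
  have hs := Real.sin_pos_of_pos_of_lt_pi h0 h1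
  obtain ⟨l0, l1, lc, ls⟩ := sphSide_bounds (u := u) (v := v) h0 h1
  have hNu := sqrt_one_add_sq_pos u
  have hNv := sqrt_one_add_sq_pos v
  have hM : 0 < √(1 + u ^ 2 + slopeOut θ u v ^ 2) := Real.sqrt_pos.2 (by positivity)
  have eM : 1 + v ^ 2 + slopeIn θ u v ^ 2 = 1 + u ^ 2 + slopeOut θ u v ^ 2 := by
    have := slope_sq_add_sq hs.ne' u v; linarith
  have qM : √(1 + u ^ 2 + slopeOut θ u v ^ 2) ^ 2 = 1 + u ^ 2 + slopeOut θ u v ^ 2 :=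
    Real.sq_sqrt (by positivity)
  have a1 := arctan_slope_sub (u := u) (v := v) h0 h1 hu hv
  have c1 := slope_cos (u := u) (v := v) hs.ne'
  have s1 := slope_sin (u := u) (v := v) hs.ne'
  unfold capTriangle
  rw [eM]
  set M := √(1 + u ^ 2 + slopeOut θ u v ^ 2) with hMd
  set p := slopeOut θ u v with hp
  set p' := slopeIn θ u v with hp'
  have a2 := arctan_sub_arctan_of_rotation (θ := sphSide θ u v) (g := u * M) (g' := v * M)
    (p := p) (p' := p') (k := (u ^ 2 + p ^ 2) * (√(1 + u ^ 2) * √(1 + v ^ 2))) l0 l1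
    (mul_ne_zero hu hM.ne') (mul_ne_zero hv hM.ne') (by positivity)
    (by rw [lc]; field_simp; linear_combination c1 - u * v * qM)
    (by rw [ls]; field_simp; linear_combination s1)
  have hsign : 0 < u * M * (v * M) ↔ 0 < u * v := by
    rw [show u * M * (v * M) = u * v * (M * M) by ring]
    exact mul_pos_iff_of_pos_right (by positivity)
  simp only [hsign] at a2
  split_ifs at a1 a2 <;> linarith

end sector

theorem hasDerivAt_capTriangle_aux {g : ℝ} (hg : g ≠ 0) (t : ℝ) :
    HasDerivAt (fun s => s - Real.arctan (Real.sin s / √(Real.cos s ^ 2 + g ^ 2)))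
      (1 - Real.cos t / √(Real.cos t ^ 2 + g ^ 2)) t := by
  have hpos : 0 < Real.cos t ^ 2 + g ^ 2 := by positivity
  have hS : 0 < √(Real.cos t ^ 2 + g ^ 2) := Real.sqrt_pos.2 hpos
  have qS : √(Real.cos t ^ 2 + g ^ 2) ^ 2 = Real.cos t ^ 2 + g ^ 2 := Real.sq_sqrt hpos.le
  have h1 : HasDerivAt (fun s => Real.cos s ^ 2 + g ^ 2) (2 * Real.cos t * (-Real.sin t)) t := by
    simpa using ((Real.hasDerivAt_cos t).pow 2).add_const (g ^ 2)
  have h2 := h1.sqrt hpos.ne'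
  have h3 := ((Real.hasDerivAt_sin t).div h2 hS.ne').arctan
  refine ((hasDerivAt_id t).sub h3).congr_deriv ?_
  simp only [Pi.div_apply]
  set S := √(Real.cos t ^ 2 + g ^ 2)
  have := Real.sin_sq_add_cos_sq t
  have hsum : 0 < S ^ 2 + Real.sin t ^ 2 := by positivity
  congr 1
  field_simp
  ring

/-- The spherical area of a triangle with a vertex at the origin, in polar coordinates. -/
theorem integral_capArea {g : ℝ} (hg : g ≠ 0) (p p' : ℝ) :
    ∫ t in (Real.arctan (p / g))..(Real.arctan (p' / g)), capArea (|g| / Real.cos t) =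
      capTriangle g p' - capTriangle g p := by
  have hcos : ∀ t ∈ Set.uIcc (Real.arctan (p / g)) (Real.arctan (p' / g)), 0 < Real.cos t := by
    intro t ht
    refine Real.cos_pos_of_mem_Ioo ⟨?_, ?_⟩
    · exact lt_of_lt_of_le (lt_min (Real.neg_pi_div_two_lt_arctan _)
        (Real.neg_pi_div_two_lt_arctan _)) ht.1
    · exact lt_of_le_of_lt ht.2 (max_lt (Real.arctan_lt_pi_div_two _)
        (Real.arctan_lt_pi_div_two _))
  have hcap : ∀ t, 0 < Real.cos t →
      capArea (|g| / Real.cos t) = 1 - Real.cos t / √(Real.cos t ^ 2 + g ^ 2) := by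
    intro t ht
    unfold capArea
    have : √(1 + (|g| / Real.cos t) ^ 2) = √(Real.cos t ^ 2 + g ^ 2) / Real.cos t := by
      rw [div_pow, sq_abs, show 1 + g ^ 2 / Real.cos t ^ 2 =
        (Real.cos t ^ 2 + g ^ 2) / Real.cos t ^ 2 by field_simp, Real.sqrt_div (by positivity),
        Real.sqrt_sq ht.le]
    rw [this, one_div_div]
  have hval : ∀ q, Real.arctan (q / g) -
      Real.arctan (Real.sin (Real.arctan (q / g)) / √(Real.cos (Real.arctan (q / g)) ^ 2 + g ^ 2)) =
      capTriangle g q := by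
    intro q
    have hc := Real.cos_arctan_pos (q / g)
    have hsn : Real.sin (Real.arctan (q / g)) = Real.cos (Real.arctan (q / g)) * (q / g) :=
      sin_arctan_eq _
    have hc2 : Real.cos (Real.arctan (q / g)) ^ 2 * (g ^ 2 + q ^ 2) = g ^ 2 := by
      rw [Real.cos_sq_arctan]; field_simp
    set c := Real.cos (Real.arctan (q / g))
    have : √(c ^ 2 + g ^ 2) = c * √(1 + g ^ 2 + q ^ 2) := by
      rw [Real.sqrt_eq_iff_mul_self_eq (by positivity) (by positivity), mul_mul_mul_comm,
        Real.mul_self_sqrt (by positivity)]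
      linear_combination (-1 : ℝ) * hc2
    unfold capTriangle
    rw [hsn, this, mul_div_mul_left _ _ hc.ne', div_div]
  rw [intervalIntegral.integral_congr (g := fun t => 1 - Real.cos t / √(Real.cos t ^ 2 + g ^ 2))
    (fun t ht => hcap t (hcos t ht)),
    intervalIntegral.integral_eq_sub_of_hasDerivAt (fun t _ => hasDerivAt_capTriangle_aux hg t),
    hval, hval]
  refine Continuous.intervalIntegrable ?_ _ _
  refine continuous_const.sub (Real.continuous_cos.div (by fun_prop) fun t => ?_)
  exact (Real.sqrt_pos.2 (by positivity)).ne'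

/-- The planar area of a triangle with a vertex at the origin, in polar coordinates. -/
theorem integral_sq_div_two {g : ℝ} (hg : g ≠ 0) (p p' : ℝ) :
    ∫ t in (Real.arctan (p / g))..(Real.arctan (p' / g)), (|g| / Real.cos t) ^ 2 / 2 =
      g * (p' - p) / 2 := by
  have hcos : ∀ t ∈ Set.uIcc (Real.arctan (p / g)) (Real.arctan (p' / g)), 0 < Real.cos t := by
    intro t ht
    refine Real.cos_pos_of_mem_Ioo ⟨?_, ?_⟩
    · exact lt_of_lt_of_le (lt_min (Real.neg_pi_div_two_lt_arctan _)
        (Real.neg_pi_div_two_lt_arctan _)) ht.1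
    · exact lt_of_le_of_lt ht.2 (max_lt (Real.arctan_lt_pi_div_two _)
        (Real.arctan_lt_pi_div_two _))
  have hd : ∀ t ∈ Set.uIcc (Real.arctan (p / g)) (Real.arctan (p' / g)),
      HasDerivAt (fun s => g ^ 2 / 2 * Real.tan s) ((|g| / Real.cos t) ^ 2 / 2) t := by
    intro t ht
    refine ((Real.hasDerivAt_tan (hcos t ht).ne').const_mul (g ^ 2 / 2)).congr_deriv ?_
    rw [div_pow, sq_abs]; ring
  rw [intervalIntegral.integral_eq_sub_of_hasDerivAt hd, Real.tan_arctan, Real.tan_arctan]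
  · field_simp
  · refine ContinuousOn.intervalIntegrable ?_
    exact ((continuousOn_const.div Real.continuous_cos.continuousOn
      fun t ht => (hcos t ht).ne').pow 2).div_const 2

/-! ### Chains of edges in polar coordinates -/

/-- A chain of edges in polar coordinates: the edge `l`, on a line at distance `G l` from the
origin, is seen under the angles from `e l` to `f l`, measured from the foot of the perpendicular to
its line.  `chainBreak e f l` is the polar angle at which the edge `l` begins. -/
noncomputable def chainBreak (e f : ℕ → ℝ) (l : ℕ) : ℝ := ∑ i ∈ Finset.range l, (f i - e i)

/-- The reciprocal of the distance, in direction `t`, of the line of the edge `l` of a chain. -/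
noncomputable def chainLine (G e f : ℕ → ℝ) (l : ℕ) (t : ℝ) : ℝ :=
  Real.cos (t - chainBreak e f l + e l) / G l

theorem continuous_chainLine (G e f : ℕ → ℝ) (l : ℕ) : Continuous (chainLine G e f l) := by
  unfold chainLine
  fun_prop

section chain

variable {G e f : ℕ → ℝ} {m : ℕ}

theorem chainBreak_succ (l : ℕ) : chainBreak e f (l + 1) = chainBreak e f l + (f l - e l) :=
  Finset.sum_range_succ _ _

theorem chainBreak_mono (hef : ∀ l ≤ m, e l ≤ f l) {k l : ℕ} (hkl : k ≤ l) (hl : l ≤ m + 1) :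
    chainBreak e f k ≤ chainBreak e f l := by
  induction l, hkl using Nat.le_induction with
  | base => exact le_rfl
  | succ l _ ih =>
    rw [chainBreak_succ]
    have := hef l (by omega)
    linarith [ih (by omega)]

theorem chainLine_succ_sub {l : ℕ} (hj : Real.cos (f l) / G l = Real.cos (e (l + 1)) / G (l + 1))
    (t : ℝ) :
    chainLine G e f (l + 1) t - chainLine G e f l t =
      (Real.sin (f l) / G l - Real.sin (e (l + 1)) / G (l + 1)) *
        Real.sin (t - chainBreak e f (l + 1)) := by
  unfold chainLine
  rw [show t - chainBreak e f l + e l = (t - chainBreak e f (l + 1)) + f l by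
    rw [chainBreak_succ]; ring, Real.cos_add, Real.cos_add]
  linear_combination (-Real.cos (t - chainBreak e f (l + 1))) * hj

/-- Among the lines of a chain that turns consistently (to the left for `ε = 1`, to the right for
`ε = -1`), the line of an edge is extremal in the directions of this edge. -/
theorem chainLine_extremal {ε : ℝ} (hG : ∀ l, 0 < G l) (hf : ∀ l, |f l| < Real.pi / 2)
    (he : ∀ l, |e l| < Real.pi / 2) (hef : ∀ l ≤ m, e l ≤ f l)
    (hj : ∀ l < m, Real.cos (f l) / G l = Real.cos (e (l + 1)) / G (l + 1))
    (hturn : ∀ l < m, 0 ≤ ε * (f l - e (l + 1))) (htot : chainBreak e f (m + 1) ≤ Real.pi)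
    {l i : ℕ} (hl : l ≤ m) (hi : i ≤ m) {t : ℝ} (h1 : chainBreak e f l ≤ t)
    (h2 : t ≤ chainBreak e f (l + 1)) :
    ε * chainLine G e f i t ≤ ε * chainLine G e f l t := by
  have b0 : chainBreak e f 0 = 0 := rfl
  have coeff : ∀ k < m, 0 ≤ ε * (Real.sin (f k) / G k - Real.sin (e (k + 1)) / G (k + 1)) := by
    intro k hk
    have ce : 0 < Real.cos (e (k + 1)) :=
      Real.cos_pos_of_mem_Ioo ⟨by linarith [(abs_lt.1 (he (k + 1))).1], (abs_lt.1 (he (k + 1))).2⟩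
    have id : ε * (Real.sin (f k) / G k - Real.sin (e (k + 1)) / G (k + 1)) *
        Real.cos (e (k + 1)) = ε * Real.sin (f k - e (k + 1)) / G k := by
      rw [Real.sin_sub]
      linear_combination (ε * Real.sin (e (k + 1))) * hj k hk
    have hs : 0 ≤ ε * Real.sin (f k - e (k + 1)) := by
      have a1 := abs_lt.1 (hf k)
      have a2 := abs_lt.1 (he (k + 1))
      have ht := hturn k hk
      rcases le_total 0 (f k - e (k + 1)) with h | h
      · have := Real.sin_nonneg_of_nonneg_of_le_pi h (by linarith)
        rcases h.eq_or_lt with h' | h'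
        · rw [← h']; simp
        · exact mul_nonneg ((mul_nonneg_iff_of_pos_right h').1 ht) this
      · have := Real.sin_nonpos_of_nonpos_of_neg_pi_le h (by linarith)
        rcases h.eq_or_lt with h' | h'
        · rw [h']; simp
        · refine mul_nonneg_of_nonpos_of_nonpos ?_ this
          by_contra hcon
          push Not at hcon
          linarith [mul_neg_of_pos_of_neg hcon h']
    have : 0 ≤ ε * (Real.sin (f k) / G k - Real.sin (e (k + 1)) / G (k + 1)) *
        Real.cos (e (k + 1)) := by
      rw [id]; exact div_nonneg hs (hG k).le
    exact (mul_nonneg_iff_of_pos_right ce).1 this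
  have step : ∀ k < m, ε * chainLine G e f (k + 1) t - ε * chainLine G e f k t =
      ε * (Real.sin (f k) / G k - Real.sin (e (k + 1)) / G (k + 1)) *
        Real.sin (t - chainBreak e f (k + 1)) := by
    intro k hk
    rw [← mul_sub, chainLine_succ_sub (hj k hk), mul_assoc]
  have t0 : 0 ≤ t := by
    have := chainBreak_mono hef (Nat.zero_le l) (by omega)
    linarith
  have tpi : t ≤ Real.pi := by
    have := chainBreak_mono hef (show l + 1 ≤ m + 1 by omega) le_rfl
    linarith
  have bnn : ∀ k ≤ m + 1, 0 ≤ chainBreak e f k := fun k hk => by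
    have := chainBreak_mono hef (Nat.zero_le k) hk; linarith
  have bpi : ∀ k ≤ m + 1, chainBreak e f k ≤ Real.pi := fun k hk => by
    have := chainBreak_mono hef hk le_rfl; linarith
  rcases le_total i l with hil | hil
  · have : ∀ k, i ≤ k → k ≤ l → ε * chainLine G e f i t ≤ ε * chainLine G e f k t := by
      intro k hik
      induction k, hik using Nat.le_induction with
      | base => intro _; exact le_rfl
      | succ k hk ih =>
        intro hkl
        have s := step k (by omega)
        have hm := chainBreak_mono hef hkl (by omega)
        have hs : 0 ≤ Real.sin (t - chainBreak e f (k + 1)) :=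
          Real.sin_nonneg_of_nonneg_of_le_pi (by linarith) (by linarith [bnn (k + 1) (by omega)])
        have := mul_nonneg (coeff k (by omega)) hs
        linarith [ih (by omega)]
    exact this l hil le_rfl
  · induction i, hil using Nat.le_induction with
    | base => exact le_rfl
    | succ k hk ih =>
      have s := step k (by omega)
      have hm := chainBreak_mono hef (show l + 1 ≤ k + 1 by omega) (by omega)
      have hs : Real.sin (t - chainBreak e f (k + 1)) ≤ 0 :=
        Real.sin_nonpos_of_nonpos_of_neg_pi_le (by linarith)
          (by linarith [bpi (k + 1) (by omega)])
      have := mul_nonpos_of_nonneg_of_nonpos (coeff k (by omega)) hs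
      linarith [ih (by omega)]

theorem chainLine_pos {l : ℕ} (hG : ∀ l, 0 < G l) (hf : ∀ l, |f l| < Real.pi / 2)
    (he : ∀ l, |e l| < Real.pi / 2) {t : ℝ} (h1 : chainBreak e f l ≤ t)
    (h2 : t ≤ chainBreak e f (l + 1)) : 0 < chainLine G e f l t := by
  rw [chainBreak_succ] at h2
  have a1 := abs_lt.1 (hf l)
  have a2 := abs_lt.1 (he l)
  exact div_pos (Real.cos_pos_of_mem_Ioo ⟨by linarith, by linarith⟩) (hG l)

theorem exists_chain_index (hm : 0 ≤ m) {t : ℝ} (h0 : 0 ≤ t) (h1 : t ≤ chainBreak e f (m + 1)) :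
    ∃ l ≤ m, chainBreak e f l ≤ t ∧ t ≤ chainBreak e f (l + 1) := by
  induction m with
  | zero => exact ⟨0, le_rfl, by simpa [chainBreak] using h0, h1⟩
  | succ m ih =>
    rcases le_total t (chainBreak e f (m + 1)) with h | h
    · obtain ⟨l, hl, h⟩ := ih (by omega) h
      exact ⟨l, by omega, h⟩
    · exact ⟨m + 1, le_rfl, h, h1⟩

/-- Radial integrals over a chain are sums over its edges. -/
theorem integral_chain {v H : ℝ → ℝ} (hG : ∀ l, 0 < G l) (hf : ∀ l, |f l| < Real.pi / 2)
    (he : ∀ l, |e l| < Real.pi / 2) (hef : ∀ l ≤ m, e l ≤ f l) (hv : Continuous v)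
    (hH : Continuous H)
    (hvl : ∀ l ≤ m, ∀ t, chainBreak e f l ≤ t → t ≤ chainBreak e f (l + 1) →
      v t = chainLine G e f l t) :
    ∫ t in (0 : ℝ)..chainBreak e f (m + 1), H (1 / v t) =
      ∑ l ∈ Finset.range (m + 1), ∫ t in (e l)..(f l), H (G l / Real.cos t) := by
  have hle : ∀ l ≤ m, chainBreak e f l ≤ chainBreak e f (l + 1) := fun l hl =>
    chainBreak_mono hef (by omega) (by omega)
  have hint : ∀ l < m + 1, IntervalIntegrable (fun t => H (1 / v t)) volume
      (chainBreak e f l) (chainBreak e f (l + 1)) := by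
    intro l hl
    refine ContinuousOn.intervalIntegrable (hH.comp_continuousOn
      (continuousOn_const.div hv.continuousOn fun t ht => ?_))
    rw [Set.uIcc_of_le (hle l (by omega))] at ht
    rw [hvl l (by omega) t ht.1 ht.2]
    exact (chainLine_pos hG hf he ht.1 ht.2).ne'
  have hsum := intervalIntegral.sum_integral_adjacent_intervals hint
  rw [show chainBreak e f 0 = 0 from rfl] at hsum
  rw [← hsum]
  refine Finset.sum_congr rfl fun l hl => ?_
  have hl : l ≤ m := by have := Finset.mem_range.1 hl; omega
  rw [intervalIntegral.integral_congr
    (g := fun t => H (G l / Real.cos (t + (e l - chainBreak e f l)))) ?_]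
  · rw [intervalIntegral.integral_comp_add_right (fun t => H (G l / Real.cos t))]
    rw [chainBreak_succ]
    congr 1 <;> ring
  · intro t ht
    rw [Set.uIcc_of_le (hle l hl)] at ht
    simp only
    rw [hvl l hl t ht.1 ht.2, chainLine, one_div_div,
      show t - chainBreak e f l + e l = t + (e l - chainBreak e f l) by ring]

end chain

/-- A difference of two sinusoids that is nonpositive at `0` stays positive, on `[0, π)`, once it
is positive. -/
theorem sinusoid_stays_pos {α β A B s t : ℝ} (hs : 0 ≤ s) (hst : s ≤ t) (ht : t < Real.pi)
    (h0 : Real.cos (0 - α) / A ≤ Real.cos (0 - β) / B)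
    (h1 : Real.cos (s - β) / B < Real.cos (s - α) / A) :
    Real.cos (t - β) / B < Real.cos (t - α) / A := by
  have hs0 : 0 < s := by
    rcases hs.eq_or_lt with h | h
    · rw [← h] at h1; linarith
    · exact h
  have ss : 0 < Real.sin s := Real.sin_pos_of_pos_of_lt_pi hs0 (by linarith)
  have st : 0 < Real.sin t := Real.sin_pos_of_pos_of_lt_pi (by linarith) ht
  have sd : 0 ≤ Real.sin (t - s) :=
    Real.sin_nonneg_of_nonneg_of_le_pi (by linarith) (by linarith)
  have id : ∀ γ, Real.cos (t - γ) * Real.sin s - Real.cos (s - γ) * Real.sin t =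
      - Real.cos (0 - γ) * Real.sin (t - s) := by
    intro γ
    rw [Real.cos_sub, Real.cos_sub, Real.cos_sub, Real.sin_sub]
    simp only [Real.cos_zero, Real.sin_zero]
    ring
  have e : (Real.cos (t - α) / A - Real.cos (t - β) / B) * Real.sin s =
      (Real.cos (s - α) / A - Real.cos (s - β) / B) * Real.sin t +
        (Real.cos (0 - β) / B - Real.cos (0 - α) / A) * Real.sin (t - s) := by
    linear_combination (1 / A) * id α - (1 / B) * id β
  have : 0 < (Real.cos (t - α) / A - Real.cos (t - β) / B) * Real.sin s := by
    rw [e]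
    have := mul_pos (sub_pos.2 h1) st
    have := mul_nonneg (sub_nonneg.2 h0) sd
    linarith
  linarith [(mul_pos_iff_of_pos_right ss).1 this]

/-- A sinusoid is quasiconcave on its positive superlevel sets, on intervals shorter than `π`. -/
theorem sinusoid_quasiconcave {α c s t u : ℝ} (hc : 0 < c) (hst : s ≤ t) (htu : t ≤ u)
    (hsu : u - s < Real.pi) (h1 : c ≤ Real.cos (s - α)) (h2 : c ≤ Real.cos (u - α)) :
    c ≤ Real.cos (t - α) := by
  rcases hst.eq_or_lt with rfl | hst
  · exact h1
  have s1 : 0 ≤ Real.sin (t - s) := Real.sin_nonneg_of_nonneg_of_le_pi (by linarith) (by linarith)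
  have s2 : 0 ≤ Real.sin (u - t) := Real.sin_nonneg_of_nonneg_of_le_pi (by linarith) (by linarith)
  have s3 : 0 < Real.sin (u - s) := Real.sin_pos_of_pos_of_lt_pi (by linarith) hsu
  have id : Real.sin (u - s) * Real.cos (t - α) =
      Real.sin (u - t) * Real.cos (s - α) + Real.sin (t - s) * Real.cos (u - α) := by
    have e1 : Real.cos (s - α) = Real.cos (t - α) * Real.cos (t - s) +
        Real.sin (t - α) * Real.sin (t - s) := by rw [← Real.cos_sub]; congr 1; ring
    have e2 : Real.cos (u - α) = Real.cos (t - α) * Real.cos (u - t) -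
        Real.sin (t - α) * Real.sin (u - t) := by rw [← Real.cos_add]; congr 1; ring
    have e3 : Real.sin (u - s) = Real.sin (u - t) * Real.cos (t - s) +
        Real.cos (u - t) * Real.sin (t - s) := by rw [← Real.sin_add]; congr 1; ring
    rw [e1, e2, e3]
    ring
  have sub : Real.sin (u - s) ≤ Real.sin (u - t) + Real.sin (t - s) := by
    rw [show u - s = (u - t) + (t - s) by ring, Real.sin_add]
    have := mul_le_of_le_one_right s2 (Real.cos_le_one (t - s))
    have := mul_le_of_le_one_left s1 (Real.cos_le_one (u - t))
    linarith
  have : Real.sin (u - s) * c ≤ Real.sin (u - s) * Real.cos (t - α) := by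
    rw [id]
    calc Real.sin (u - s) * c ≤ (Real.sin (u - t) + Real.sin (t - s)) * c := by gcongr
      _ = Real.sin (u - t) * c + Real.sin (t - s) * c := by ring
      _ ≤ _ := by gcongr
  exact le_of_mul_le_mul_left this s3

/-- Comparison of the spherical and the planar area between two chains with the same distances of
the end points from the origin, the first one turning to the left and the second one, which covers
the larger angle, to the right. -/
theorem capArea_chain_sub_le {m n : ℕ} {G e f G' e' f' : ℕ → ℝ}
    (hG : ∀ l, 0 < G l) (hf : ∀ l, |f l| < Real.pi / 2) (he : ∀ l, |e l| < Real.pi / 2)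
    (hef : ∀ l ≤ m, e l ≤ f l)
    (hj : ∀ l < m, Real.cos (f l) / G l = Real.cos (e (l + 1)) / G (l + 1))
    (hturn : ∀ l < m, e (l + 1) ≤ f l)
    (hG' : ∀ l, 0 < G' l) (hf' : ∀ l, |f' l| < Real.pi / 2) (he' : ∀ l, |e' l| < Real.pi / 2)
    (hef' : ∀ l ≤ n, e' l ≤ f' l)
    (hj' : ∀ l < n, Real.cos (f' l) / G' l = Real.cos (e' (l + 1)) / G' (l + 1))
    (hturn' : ∀ l < n, f' l ≤ e' (l + 1))
    (hstart : Real.cos (e 0) / G 0 = Real.cos (e' 0) / G' 0)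
    (hend : Real.cos (f m) / G m = Real.cos (f' n) / G' n)
    (hlt : chainBreak e f (m + 1) < chainBreak e' f' (n + 1))
    (hpi : chainBreak e' f' (n + 1) < Real.pi) :
    ∃ μ : ℝ, 0 ≤ μ ∧ μ ≤ 1 ∧
      (∑ l ∈ Finset.range (m + 1), ∫ t in (e l)..(f l), capArea (G l / Real.cos t)) -
        (∑ l ∈ Finset.range (n + 1), ∫ t in (e' l)..(f' l), capArea (G' l / Real.cos t)) ≤
      μ * ((∑ l ∈ Finset.range (m + 1), ∫ t in (e l)..(f l), (G l / Real.cos t) ^ 2 / 2) -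
        ∑ l ∈ Finset.range (n + 1), ∫ t in (e' l)..(f' l), (G' l / Real.cos t) ^ 2 / 2) := by
  set a := chainBreak e f (m + 1) with ha
  set κ := chainBreak e' f' (n + 1) - a with hκd
  have hκ : 0 < κ := by linarith
  have hb : chainBreak e' f' (n + 1) = a + κ := by ring
  have ha0 : 0 ≤ a := chainBreak_mono hef (Nat.zero_le _) le_rfl
  have hne : (Finset.range (m + 1)).Nonempty := ⟨0, by simp⟩
  have hne' : (Finset.range (n + 1)).Nonempty := ⟨0, by simp⟩
  set p : ℝ → ℝ := fun t => (Finset.range (m + 1)).sup' hne fun l => chainLine G e f l t with hp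
  set q : ℝ → ℝ := fun t => (Finset.range (n + 1)).inf' hne' fun l => chainLine G' e' f' l t with hq
  have hpc : Continuous p :=
    Continuous.finset_sup'_apply hne fun l _ => continuous_chainLine G e f l
  have hqc : Continuous q :=
    Continuous.finset_inf'_apply hne' fun l _ => continuous_chainLine G' e' f' l
  have hp_le : ∀ l ≤ m, ∀ t, chainLine G e f l t ≤ p t := fun l hl t =>
    Finset.le_sup' (fun l => chainLine G e f l t) (Finset.mem_range.2 (by omega))
  have hq_le : ∀ l ≤ n, ∀ t, q t ≤ chainLine G' e' f' l t := fun l hl t =>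
    Finset.inf'_le (fun l => chainLine G' e' f' l t) (Finset.mem_range.2 (by omega))
  have hp_ex : ∀ t, ∃ l ≤ m, p t = chainLine G e f l t := fun t => by
    obtain ⟨l, hl, h⟩ := Finset.exists_mem_eq_sup' hne fun l => chainLine G e f l t
    exact ⟨l, by have := Finset.mem_range.1 hl; omega, h⟩
  have hq_ex : ∀ t, ∃ l ≤ n, q t = chainLine G' e' f' l t := fun t => by
    obtain ⟨l, hl, h⟩ := Finset.exists_mem_eq_inf' hne' fun l => chainLine G' e' f' l t
    exact ⟨l, by have := Finset.mem_range.1 hl; omega, h⟩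
  have hpl : ∀ l ≤ m, ∀ t, chainBreak e f l ≤ t → t ≤ chainBreak e f (l + 1) →
      p t = chainLine G e f l t := by
    intro l hl t h1 h2
    refine le_antisymm (Finset.sup'_le _ _ fun i hi => ?_) (hp_le l hl t)
    have := chainLine_extremal (ε := 1) hG hf he hef hj
      (fun l hl => by linarith [hturn l hl]) (by linarith) hl
      (show i ≤ m by have := Finset.mem_range.1 hi; omega) h1 h2
    linarith
  have hql : ∀ l ≤ n, ∀ t, chainBreak e' f' l ≤ t → t ≤ chainBreak e' f' (l + 1) →
      q t = chainLine G' e' f' l t := by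
    intro l hl t h1 h2
    refine le_antisymm (hq_le l hl t) (Finset.le_inf' _ _ fun i hi => ?_)
    have := chainLine_extremal (ε := -1) hG' hf' he' hef' hj'
      (fun l hl => by linarith [hturn' l hl]) (by linarith) hl
      (show i ≤ n by have := Finset.mem_range.1 hi; omega) h1 h2
    linarith
  have hp0 : ∀ t ∈ Set.Icc 0 a, 0 < p t := by
    intro t ht
    obtain ⟨l, hl, h1, h2⟩ := exists_chain_index (e := e) (f := f) (Nat.zero_le m) ht.1 ht.2
    rw [hpl l hl t h1 h2]
    exact chainLine_pos hG hf he h1 h2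
  have hq0 : ∀ t ∈ Set.Icc 0 (a + κ), 0 < q t := by
    intro t ht
    obtain ⟨l, hl, h1, h2⟩ := exists_chain_index (e := e') (f := f') (Nat.zero_le n) ht.1
      (by linarith [ht.2])
    rw [hql l hl t h1 h2]
    exact chainLine_pos hG' hf' he' h1 h2
  have hpq0 : p 0 = q 0 := by
    rw [hpl 0 (by omega) 0 le_rfl (chainBreak_mono hef (Nat.zero_le _) (by omega)),
      hql 0 (by omega) 0 le_rfl (chainBreak_mono hef' (Nat.zero_le _) (by omega))]
    simpa [chainLine, chainBreak] using hstart
  have hpqa : p a = q (a + κ) := by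
    rw [hpl m le_rfl a (chainBreak_mono hef (by omega) le_rfl) le_rfl,
      hql n le_rfl (a + κ) (by rw [← hb]; exact chainBreak_mono hef' (by omega) le_rfl) hb.ge,
      ← hb, ha, chainLine, chainLine, chainBreak_succ, chainBreak_succ]
    convert hend using 3 <;> ring
  have hup : ∀ s t, 0 ≤ s → s ≤ t → t ≤ a → q s < p s → q t < p t := by
    intro s t hs hst hta hlt
    obtain ⟨l, hl, hpe⟩ := hp_ex s
    obtain ⟨i, hi, hqe⟩ := hq_ex s
    rw [hpe, hqe] at hlt
    have h0 : chainLine G e f l 0 ≤ chainLine G' e' f' i 0 :=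
      ((hp_le l hl 0).trans hpq0.le).trans (hq_le i hi 0)
    refine lt_of_le_of_lt (hq_le i hi t) (lt_of_lt_of_le ?_ (hp_le l hl t))
    unfold chainLine at h0 hlt ⊢
    simp only [sub_add] at h0 hlt ⊢
    exact sinusoid_stays_pos hs hst (by linarith) h0 hlt
  have hdown : ∀ s t, 0 ≤ s → s ≤ t → t ≤ a → q (t + κ) < p t → q (s + κ) < p s := by
    intro s t hs hst hta hlt
    obtain ⟨l, hl, hpe⟩ := hp_ex t
    obtain ⟨i, hi, hqe⟩ := hq_ex (t + κ)
    rw [hpe, hqe] at hlt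
    have h0 : chainLine G e f l a ≤ chainLine G' e' f' i (a + κ) :=
      ((hp_le l hl a).trans hpqa.le).trans (hq_le i hi (a + κ))
    refine lt_of_le_of_lt (hq_le i hi (s + κ)) (lt_of_lt_of_le ?_ (hp_le l hl s))
    unfold chainLine at h0 hlt ⊢
    -- reflect in the midpoint of `[0, a]`
    have rP : ∀ x, Real.cos (x - chainBreak e f l + e l) =
        Real.cos ((a - x) - (a - (chainBreak e f l - e l))) := fun x => by
      rw [← Real.cos_neg]; congr 1; ring
    have rN : ∀ x, Real.cos (x + κ - chainBreak e' f' i + e' i) =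
        Real.cos ((a - x) - (a + κ - (chainBreak e' f' i - e' i))) := fun x => by
      rw [← Real.cos_neg]; congr 1; ring
    rw [rP, rN] at h0 hlt ⊢
    rw [sub_self] at h0
    exact sinusoid_stays_pos (by linarith) (by linarith) (by linarith) h0 hlt
  have hquasi : ∀ c > 0, ∀ s t u, 0 ≤ s → s ≤ t → t ≤ u → u ≤ a + κ → c ≤ q s → c ≤ q u →
      c ≤ q t := by
    intro c hc s t u hs hst htu hu h1 h2
    refine Finset.le_inf' _ _ fun i hi => ?_
    have hi : i ≤ n := by have := Finset.mem_range.1 hi; omega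
    have k1 := h1.trans (hq_le i hi s)
    have k2 := h2.trans (hq_le i hi u)
    unfold chainLine at k1 k2 ⊢
    rw [le_div_iff₀ (hG' i)] at k1 k2 ⊢
    simp only [sub_add] at k1 k2 ⊢
    exact sinusoid_quasiconcave (mul_pos hc (hG' i)) hst htu (by linarith) k1 k2
  obtain ⟨l, hl0, hl1, hl⟩ := capArea_sub_le hκ ha0 hpc hqc hp0 hq0 hup hdown hquasi
  refine ⟨l, hl0, hl1, ?_⟩
  have hsq : Continuous fun r : ℝ => r ^ 2 / 2 := by fun_prop
  rw [← hb] at hl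
  rw [integral_chain hG hf he hef hpc continuous_capArea hpl,
    integral_chain hG' hf' he' hef' hqc continuous_capArea hql,
    integral_chain (H := fun r => r ^ 2 / 2) hG hf he hef hpc hsq hpl,
    integral_chain (H := fun r => r ^ 2 / 2) hG' hf' he' hef' hqc hsq hql] at hl
  exact hl

/-! ### Convex polygons with a cone point -/

theorem cos_arctan_div_abs {g : ℝ} (hg : g ≠ 0) (p : ℝ) :
    Real.cos (Real.arctan (p / g)) / |g| = 1 / √(g ^ 2 + p ^ 2) := by
  rw [Real.cos_arctan, show 1 + (p / g) ^ 2 = (g ^ 2 + p ^ 2) / g ^ 2 by field_simp,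
    Real.sqrt_div (by positivity), Real.sqrt_sq_eq_abs, one_div_div]
  have : |g| ≠ 0 := abs_ne_zero.2 hg
  field_simp

theorem chainBreak_succ_le {e f : ℕ → ℝ} (k : ℕ) (h : ∀ l < k, f l ≤ e (l + 1)) :
    chainBreak e f (k + 1) ≤ f k - e 0 := by
  induction k with
  | zero => simp [chainBreak]
  | succ k ih =>
    rw [chainBreak_succ]
    linarith [ih fun l hl => h l (by omega), h k (by omega)]

theorem abs_arctan_lt (x : ℝ) : |Real.arctan x| < Real.pi / 2 :=
  abs_lt.2 ⟨Real.neg_pi_div_two_lt_arctan x, Real.arctan_lt_pi_div_two x⟩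

theorem sum_range_succ_split (m k : ℕ) (h : ℕ → ℝ) :
    ∑ j ∈ Finset.range (m + 1 + (k + 1)), h (j + 1) =
      ∑ l ∈ Finset.range (m + 1), h (1 + l) +
        ∑ l ∈ Finset.range (k + 1), h (m + 1 + (k + 1) - l) := by
  rw [Finset.sum_range_add, ← Finset.sum_range_reflect (fun l => h (m + 1 + l + 1)) (k + 1)]
  congr 1
  · exact Finset.sum_congr rfl fun l _ => by rw [add_comm]
  · refine Finset.sum_congr rfl fun l hl => ?_
    have := Finset.mem_range.1 hl
    congr 1; omega

theorem sum_range_shift_of_periodic {n : ℕ} {h : ℕ → ℝ} (hper : ∀ j, h (j + n) = h j) (k : ℕ) :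
    ∑ j ∈ Finset.range n, h (j + k) = ∑ j ∈ Finset.range n, h j := by
  induction k with
  | zero => rfl
  | succ k ih =>
    rw [← ih]
    have h1 := Finset.sum_range_succ (fun j => h (j + k)) n
    have h2 := Finset.sum_range_succ' (fun j => h (j + k)) n
    have h3 : h (n + k) = h k := by rw [add_comm, hper]
    simp only [zero_add, h3, show ∀ j, j + 1 + k = j + (k + 1) from fun j => by omega] at h1 h2
    linarith

/-- The support numbers `g` with respect to the angles `ω` describe a convex polygon: all edges
have nonnegative lengths. -/
def IsConvexSupport (ω g : ℕ → ℝ) : Prop :=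
  ∀ j, slopeIn (ω j) (g j) (g (j + 1)) ≤ slopeOut (ω (j + 1)) (g (j + 1)) (g (j + 2))

/-- The angle at the cone point minus the perimeter, for a spherical polygon whose vertices are at
distances with cotangents `g j` from the cone point. -/
noncomputable def sphDefect (n : ℕ) (ω g : ℕ → ℝ) : ℝ :=
  ∑ j ∈ Finset.range n, (ω j - sphSide (ω j) (g j) (g (j + 1)))

section polygon

variable {n : ℕ} {ω g : ℕ → ℝ}

/-- The angle from the foot of the perpendicular to the line of the edge `j` to its final point. -/
noncomputable def angleOut (ω g : ℕ → ℝ) (j : ℕ) : ℝ :=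
  Real.arctan (slopeOut (ω j) (g j) (g (j + 1)) / g j)

/-- The angle from the foot of the perpendicular to the line of the edge `j` to its initial point.
It is meaningful for `j ≥ 1` only. -/
noncomputable def angleIn (ω g : ℕ → ℝ) (j : ℕ) : ℝ :=
  Real.arctan (slopeIn (ω (j - 1)) (g (j - 1)) (g j) / g j)

theorem angleOut_sub_angleIn (hω : ∀ j, 0 < ω j) (hω' : ∀ j, ω j < Real.pi)
    (hne : ∀ j, g j ≠ 0) (j : ℕ) :
    angleOut ω g j - angleIn ω g (j + 1) =
      if 0 < g j * g (j + 1) then ω j else ω j - Real.pi :=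
  arctan_slope_sub (hω j) (hω' j) (hne j) (hne (j + 1))

theorem angle_joint (hω : ∀ j, 0 < ω j) (hω' : ∀ j, ω j < Real.pi)
    (hne : ∀ j, g j ≠ 0) (j : ℕ) :
    Real.cos (angleOut ω g j) / |g j| = Real.cos (angleIn ω g (j + 1)) / |g (j + 1)| := by
  unfold angleOut angleIn
  rw [cos_arctan_div_abs (hne j), cos_arctan_div_abs (hne (j + 1)), Nat.add_sub_cancel,
    slope_sq_add_sq (Real.sin_pos_of_pos_of_lt_pi (hω j) (hω' j)).ne']

theorem angleIn_le_angleOut (hconv : IsConvexSupport ω g) {j : ℕ} (hj : 0 < j) (hg : 0 < g j) :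
    angleIn ω g j ≤ angleOut ω g j := by
  obtain ⟨k, rfl⟩ : ∃ k, j = k + 1 := ⟨j - 1, by omega⟩
  refine Real.arctan_strictMono.monotone ?_
  exact div_le_div_of_nonneg_right (hconv k) hg.le

theorem angleOut_le_angleIn (hconv : IsConvexSupport ω g) {j : ℕ} (hj : 0 < j) (hg : g j < 0) :
    angleOut ω g j ≤ angleIn ω g j := by
  obtain ⟨k, rfl⟩ : ∃ k, j = k + 1 := ⟨j - 1, by omega⟩
  refine Real.arctan_strictMono.monotone ?_
  exact div_le_div_of_nonpos_of_le hg.le (hconv k)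

/-- The positive support numbers between two negative ones take up an angle greater than `π`. -/
theorem pi_lt_sum_positive_run (hω : ∀ j, 0 < ω j) (hω' : ∀ j, ω j < Real.pi)
    (hne : ∀ j, g j ≠ 0) (hconv : IsConvexSupport ω g) {i j : ℕ} (hij : i + 1 < j)
    (hi : g i < 0) (hj : g j < 0) (hpos : ∀ k, i < k → k < j → 0 < g k) :
    Real.pi < ∑ k ∈ Finset.Ico i j, ω k := by
  have key : ∀ k, i + 1 ≤ k → k < j →
      Real.pi + angleOut ω g i - angleIn ω g k ≤ ∑ l ∈ Finset.Ico i k, ω l := by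
    intro k hik
    induction k, hik using Nat.le_induction with
    | base =>
      intro h
      have := angleOut_sub_angleIn hω hω' hne i
      rw [if_neg (by
        have := mul_neg_of_neg_of_pos hi (hpos (i + 1) (by omega) h); linarith)] at this
      simp
      linarith
    | succ k hk ih =>
      intro h
      have h1 := ih (by omega)
      have hk0 := hpos k (by omega) (by omega)
      have := angleOut_sub_angleIn hω hω' hne k
      rw [if_pos (mul_pos hk0 (hpos (k + 1) (by omega) h))] at this
      rw [Finset.sum_Ico_succ_top (by omega)]
      have := angleIn_le_angleOut hconv (by omega) hk0
      linarith
  obtain ⟨k, rfl⟩ : ∃ k, j = k + 1 := ⟨j - 1, by omega⟩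
  have h1 := key k (by omega) (by omega)
  have hk0 := hpos k (by omega) (by omega)
  have h2 := angleOut_sub_angleIn hω hω' hne k
  rw [if_neg (by have := mul_neg_of_pos_of_neg hk0 hj; linarith)] at h2
  rw [Finset.sum_Ico_succ_top (by omega)]
  have h3 := angleIn_le_angleOut hconv (by omega) hk0
  have h4 := (abs_lt.1 (abs_arctan_lt (slopeOut (ω i) (g i) (g (i + 1)) / g i))).1
  have h5 := (abs_lt.1 (abs_arctan_lt
    (slopeIn (ω (k + 1 - 1)) (g (k + 1 - 1)) (g (k + 1)) / g (k + 1)))).2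
  unfold angleOut angleIn at *
  linarith

/-- The spherical area of the edge `j` of the polygon, as seen from the origin. -/
noncomputable def edgeCap (ω g : ℕ → ℝ) (j : ℕ) : ℝ :=
  capTriangle (g j) (slopeOut (ω j) (g j) (g (j + 1))) -
    capTriangle (g j) (slopeIn (ω (j - 1)) (g (j - 1)) (g j))

/-- Twice the planar area of the edge `j` of the polygon, as seen from the origin. -/
noncomputable def edgeArea (ω g : ℕ → ℝ) (j : ℕ) : ℝ :=
  g j * (slopeOut (ω j) (g j) (g (j + 1)) - slopeIn (ω (j - 1)) (g (j - 1)) (g j))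

theorem sphDefect_eq_sum_edgeCap (hω : ∀ j, 0 < ω j) (hω' : ∀ j, ω j < Real.pi)
    (hne : ∀ j, g j ≠ 0) (hωp : ∀ j, ω (j + n) = ω j) (hgp : ∀ j, g (j + n) = g j) :
    sphDefect n ω g = ∑ j ∈ Finset.range n, edgeCap ω g (j + 1) := by
  unfold sphDefect edgeCap
  simp only [Nat.add_sub_cancel]
  rw [Finset.sum_sub_distrib (fun j => capTriangle (g (j + 1)) (slopeOut (ω (j + 1)) (g (j + 1))
    (g (j + 1 + 1)))), sum_range_shift_of_periodic
    (h := fun j => capTriangle (g j) (slopeOut (ω j) (g j) (g (j + 1))))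
    (fun j => by simp only [hωp, hgp, show j + n + 1 = j + 1 + n by omega]) 1,
    ← Finset.sum_sub_distrib]
  exact Finset.sum_congr rfl fun j _ => angle_sub_sphSide (hω j) (hω' j) (hne j) (hne (j + 1))

theorem mixedArea_eq_sum_edgeArea (hωp : ∀ j, ω (j + n) = ω j) (hgp : ∀ j, g (j + n) = g j) :
    mixedArea n ω g g = ∑ j ∈ Finset.range n, edgeArea ω g (j + 1) := by
  unfold mixedArea edgeArea
  simp only [Nat.add_sub_cancel, mul_sub, sectorForm_eq_slope]
  rw [Finset.sum_sub_distrib, Finset.sum_sub_distrib, sum_range_shift_of_periodic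
    (h := fun j => g j * slopeOut (ω j) (g j) (g (j + 1)))
    (fun j => by simp only [hωp, hgp, show j + n + 1 = j + 1 + n by omega]) 1]

theorem edgeCap_eq_integral (hne : ∀ j, g j ≠ 0) (j : ℕ) :
    ∫ t in (angleIn ω g j)..(angleOut ω g j), capArea (|g j| / Real.cos t) = edgeCap ω g j :=
  integral_capArea (hne j) _ _

theorem edgeArea_eq_integral (hne : ∀ j, g j ≠ 0) (j : ℕ) :
    ∫ t in (angleIn ω g j)..(angleOut ω g j), (|g j| / Real.cos t) ^ 2 / 2 = edgeArea ω g j / 2 :=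
  integral_sq_div_two (hne j) _ _

/-- If all support numbers are positive, the central projection to the sphere decreases the area. -/
theorem sphDefect_le_of_pos (hω : ∀ j, 0 < ω j) (hω' : ∀ j, ω j < Real.pi)
    (hpos : ∀ j, 0 < g j) (hωp : ∀ j, ω (j + n) = ω j) (hgp : ∀ j, g (j + n) = g j)
    (hconv : IsConvexSupport ω g) : 2 * sphDefect n ω g ≤ mixedArea n ω g g := by
  have hne : ∀ j, g j ≠ 0 := fun j => (hpos j).ne'
  rw [sphDefect_eq_sum_edgeCap hω hω' hne hωp hgp, mixedArea_eq_sum_edgeArea hωp hgp,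
    Finset.mul_sum]
  refine Finset.sum_le_sum fun j _ => ?_
  have hle := angleIn_le_angleOut hconv (Nat.succ_pos j) (hpos (j + 1))
  have h : edgeCap ω g (j + 1) ≤ edgeArea ω g (j + 1) / 2 := by
    rw [← edgeCap_eq_integral hne, ← edgeArea_eq_integral hne]
    have hcos : ∀ t ∈ Set.Icc (angleIn ω g (j + 1)) (angleOut ω g (j + 1)), 0 < Real.cos t :=
      fun t ht => Real.cos_pos_of_mem_Ioo
        ⟨lt_of_lt_of_le (Real.neg_pi_div_two_lt_arctan _) ht.1,
          lt_of_le_of_lt ht.2 (Real.arctan_lt_pi_div_two _)⟩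
    have hcont : ContinuousOn (fun t => |g (j + 1)| / Real.cos t)
        (Set.uIcc (angleIn ω g (j + 1)) (angleOut ω g (j + 1))) := by
      rw [Set.uIcc_of_le hle]
      exact continuousOn_const.div Real.continuous_cos.continuousOn fun t ht => (hcos t ht).ne'
    refine intervalIntegral.integral_mono_on hle
      (continuous_capArea.comp_continuousOn hcont).intervalIntegrable
      ((hcont.pow 2).div_const 2).intervalIntegrable fun t ht => ?_
    exact capArea_le (div_nonneg (abs_nonneg _) (hcos t ht).le)
  linarith

/-- The polygon consists of a left-turning and a right-turning chain of edges, if the support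
number `0` is negative and the support number `1` is positive. -/
theorem sphDefect_le_of_sign_change (hω : ∀ j, 0 < ω j) (hω' : ∀ j, ω j < Real.pi)
    (hne : ∀ j, g j ≠ 0) (hωp : ∀ j, ω (j + n) = ω j) (hgp : ∀ j, g (j + n) = g j)
    (hconv : IsConvexSupport ω g) (htot : ∑ j ∈ Finset.range n, ω j < 2 * Real.pi)
    (h0 : g 0 < 0) (h1 : 0 < g 1) (hn : 0 < n) :
    ∃ μ : ℝ, 0 ≤ μ ∧ μ ≤ 1 ∧ sphDefect n ω g ≤ μ * (mixedArea n ω g g / 2) := by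
  classical
  have hgn : g n = g 0 := by simpa using hgp 0
  have hn2 : 2 ≤ n := by
    by_contra h
    have : n = 1 := by omega
    rw [this] at hgn; linarith
  have hex : ∃ j, 2 ≤ j ∧ g j < 0 := ⟨n, hn2, by rw [hgn]; exact h0⟩
  -- the first negative support number after the positive ones
  obtain ⟨m, hm, hmmin⟩ : ∃ m, (2 ≤ m ∧ g m < 0) ∧ ∀ j < m, 2 ≤ j → 0 < g j :=
    ⟨Nat.find hex, Nat.find_spec hex, fun j hj h2 => by
      have := Nat.find_min hex hj
      push Not at this
      exact lt_of_le_of_ne (this h2) (hne j).symm⟩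
  have hmn : m ≤ n := by
    by_contra h
    have := hmmin n (by omega) hn2
    rw [hgn] at this; linarith
  have hposP : ∀ j, 1 ≤ j → j < m → 0 < g j := fun j hj hjm => by
    rcases hj.eq_or_lt with h | h
    · rw [← h]; exact h1
    · exact hmmin j hjm h
  have hrun := pi_lt_sum_positive_run hω hω' hne hconv (i := 0) (j := m) (by omega) h0 hm.2
    (fun k hk hkm => hposP k hk hkm)
  -- a second run of positive support numbers would need too large an angle
  have hnegN : ∀ j, m ≤ j → j ≤ n → g j < 0 := by
    intro j hmj hjn
    by_contra hcon
    have hex2 : ∃ k, m ≤ k ∧ 0 < g k := ⟨j, hmj, lt_of_le_of_ne (not_lt.1 hcon) (hne j).symm⟩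
    set l := Nat.find hex2 with hl
    have hl1 : m ≤ l ∧ 0 < g l := Nat.find_spec hex2
    have hlmin : ∀ k < l, m ≤ k → g k < 0 := fun k hk hmk => by
      have := Nat.find_min hex2 hk
      push Not at this
      exact lt_of_le_of_ne (this hmk) (hne k)
    have hlj : l ≤ j := Nat.find_min' hex2 ⟨hmj, lt_of_le_of_ne (not_lt.1 hcon) (hne j).symm⟩
    have hlm : l ≠ m := fun h => by rw [h] at hl1; linarith [hm.2]
    have hln : l ≠ n := fun h => by rw [h, hgn] at hl1; linarith
    have hex3 : ∃ k, l ≤ k ∧ g k < 0 := ⟨n, by omega, by rw [hgn]; exact h0⟩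
    set q := Nat.find hex3 with hq
    have hq1 : l ≤ q ∧ g q < 0 := Nat.find_spec hex3
    have hqmin : ∀ k < q, l ≤ k → 0 < g k := fun k hk hlk => by
      have := Nat.find_min hex3 hk
      push Not at this
      exact lt_of_le_of_ne (this hlk) (hne k).symm
    have hqn : q ≤ n := Nat.find_min' hex3 ⟨by omega, by rw [hgn]; exact h0⟩
    have hql : q ≠ l := fun h => by rw [h] at hq1; linarith [hl1.2]
    have hrun2 := pi_lt_sum_positive_run hω hω' hne hconv (i := l - 1) (j := q) (by omega)
      (hlmin (l - 1) (by omega) (by omega)) hq1.2 (fun k hk hkq => hqmin k hkq (by omega))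
    have hsub : ∑ k ∈ Finset.Ico 0 m ∪ Finset.Ico (l - 1) q, ω k ≤
        ∑ k ∈ Finset.range n, ω k := by
      refine Finset.sum_le_sum_of_subset_of_nonneg ?_ fun k _ _ => (hω k).le
      intro k hk
      simp only [Finset.mem_union, Finset.mem_Ico, Finset.mem_range] at hk ⊢
      omega
    rw [Finset.sum_union (by
      rw [Finset.disjoint_left]
      intro k hk hk'
      simp only [Finset.mem_Ico] at hk hk'
      omega)] at hsub
    linarith
  obtain ⟨M, rfl⟩ : ∃ M, m = M + 2 := ⟨m - 2, by omega⟩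
  obtain ⟨N, hN⟩ : ∃ N, n = M + 1 + (N + 1) := ⟨n - (M + 2), by omega⟩
  set e : ℕ → ℝ := fun l => angleIn ω g (1 + l) with he
  set f : ℕ → ℝ := fun l => angleOut ω g (1 + l) with hf
  set e' : ℕ → ℝ := fun l => angleOut ω g (n - l) with he'
  set f' : ℕ → ℝ := fun l => angleIn ω g (n - l) with hf'
  have hper : angleOut ω g n = angleOut ω g 0 := by
    have a1 : ω n = ω 0 := by simpa using hωp 0
    have a2 : g (n + 1) = g 1 := by rw [add_comm]; exact hgp 1
    unfold angleOut
    rw [a1, a2, hgn, zero_add]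
  have joint := angle_joint hω hω' hne
  have face := angleOut_sub_angleIn hω hω' hne
  have hturnN : ∀ l < N, f' l ≤ e' (l + 1) := by
    intro l hl
    have hk : n - l = (n - (l + 1)) + 1 := by omega
    have := face (n - (l + 1))
    rw [if_pos (mul_pos_of_neg_of_neg (hnegN _ (by omega) (by omega))
      (hnegN _ (by omega) (by omega))), ← hk] at this
    simp only [he', hf']
    linarith [hω (n - (l + 1))]
  have hsum : chainBreak e f (M + 1) - chainBreak e' f' (N + 1) =
      ∑ j ∈ Finset.range n, (angleOut ω g (j + 1) - angleIn ω g (j + 1)) := by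
    rw [hN, sum_range_succ_split M N (fun j => angleOut ω g j - angleIn ω g j), chainBreak,
      chainBreak, sub_eq_add_neg, ← Finset.sum_neg_distrib, he', hf', hN]
    congr 1
    exact Finset.sum_congr rfl fun l _ => by ring
  have hsum2 : ∑ j ∈ Finset.range n, (angleOut ω g (j + 1) - angleIn ω g (j + 1)) =
      ∑ j ∈ Finset.range n, ω j - 2 * Real.pi := by
    rw [Finset.sum_sub_distrib, sum_range_shift_of_periodic (h := angleOut ω g) (fun j => by
      simp only [angleOut, hωp, hgp, show j + n + 1 = j + 1 + n by omega]) 1,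
      ← Finset.sum_sub_distrib]
    have : ∀ j ∈ Finset.range n, angleOut ω g j - angleIn ω g (j + 1) =
        ω j - ((if j = 0 then Real.pi else 0) + if j = M + 1 then Real.pi else 0) := by
      intro j hj
      have hj := Finset.mem_range.1 hj
      rw [face j]
      rcases Nat.eq_zero_or_pos j with rfl | hj0
      · rw [if_neg (by have := mul_neg_of_neg_of_pos h0 h1; simpa using this.le), if_pos rfl,
          if_neg (by omega)]
        ring
      · rcases Nat.lt_trichotomy j (M + 1) with h | rfl | h
        · rw [if_pos (mul_pos (hposP _ hj0 (by omega)) (hposP _ (by omega) (by omega))),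
            if_neg (by omega), if_neg (by omega)]
          ring
        · rw [if_neg (by
            have := mul_neg_of_pos_of_neg (hposP (M + 1) (by omega) (by omega)) hm.2
            exact not_lt.2 this.le), if_neg (by omega), if_pos rfl]
          ring
        · rw [if_pos (mul_pos_of_neg_of_neg (hnegN _ (by omega) (by omega))
            (hnegN _ (by omega) (by omega))), if_neg (by omega), if_neg (by omega)]
          ring
    rw [Finset.sum_congr rfl this, Finset.sum_sub_distrib, Finset.sum_add_distrib,
      Finset.sum_ite_eq', Finset.sum_ite_eq', if_pos (Finset.mem_range.2 hn),
      if_pos (Finset.mem_range.2 (by omega))]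
    ring
  have hpi : chainBreak e' f' (N + 1) < Real.pi := by
    have a1 := chainBreak_succ_le N hturnN
    have a2 : f' N < Real.pi / 2 := Real.arctan_lt_pi_div_two _
    have a3 : -(Real.pi / 2) < e' 0 := Real.neg_pi_div_two_lt_arctan _
    linarith
  obtain ⟨μ, hμ0, hμ1, hμ⟩ := capArea_chain_sub_le (m := M) (n := N) (G := fun l => |g (1 + l)|)
    (e := e) (f := f) (G' := fun l => |g (n - l)|) (e' := e') (f' := f')
    (fun l => abs_pos.2 (hne _)) (fun l => abs_arctan_lt _) (fun l => abs_arctan_lt _)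
    (fun l hl => angleIn_le_angleOut hconv (by omega) (hposP _ (by omega) (by omega)))
    (fun l _ => by
      have := joint (1 + l)
      rwa [show 1 + l + 1 = 1 + (l + 1) by omega] at this)
    (fun l hl => by
      have := face (1 + l)
      rw [if_pos (mul_pos (hposP _ (by omega) (by omega)) (hposP _ (by omega) (by omega))),
        show 1 + l + 1 = 1 + (l + 1) by omega] at this
      simp only [he, hf]
      linarith [hω (1 + l)])
    (fun l => abs_pos.2 (hne _)) (fun l => abs_arctan_lt _) (fun l => abs_arctan_lt _)
    (fun l hl => angleOut_le_angleIn hconv (by omega) (hnegN _ (by omega) (by omega)))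
    (fun l hl => by
      have := joint (n - (l + 1))
      rw [show n - (l + 1) + 1 = n - l by omega] at this
      exact this.symm)
    hturnN
    (by
      have := joint 0
      simp only [he, he', Nat.sub_zero, add_zero, hper, hgn]
      exact this.symm)
    (by
      have := joint (1 + M)
      rw [show 1 + M + 1 = n - N by omega] at this
      exact this)
    (by linarith) hpi
  refine ⟨μ, hμ0, hμ1, ?_⟩
  have i1 : ∀ l, ∫ t in (e l)..(f l), capArea (|g (1 + l)| / Real.cos t) = edgeCap ω g (1 + l) :=
    fun l => edgeCap_eq_integral hne _
  have i2 : ∀ l, ∫ t in (e' l)..(f' l), capArea (|g (n - l)| / Real.cos t) =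
      - edgeCap ω g (n - l) := fun l => by
    rw [intervalIntegral.integral_symm, ← edgeCap_eq_integral hne]
  have i3 : ∀ l, ∫ t in (e l)..(f l), (|g (1 + l)| / Real.cos t) ^ 2 / 2 =
      edgeArea ω g (1 + l) / 2 := fun l => edgeArea_eq_integral hne _
  have i4 : ∀ l, ∫ t in (e' l)..(f' l), (|g (n - l)| / Real.cos t) ^ 2 / 2 =
      - (edgeArea ω g (n - l) / 2) := fun l => by
    rw [intervalIntegral.integral_symm, ← edgeArea_eq_integral hne]
  simp only [i1, i2, i3, i4, Finset.sum_neg_distrib, sub_neg_eq_add] at hμ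
  have t1 := sum_range_succ_split M N (edgeCap ω g)
  have t2 := sum_range_succ_split M N (fun j => edgeArea ω g j / 2)
  rw [← hN] at t1 t2
  rw [← t1, ← t2, ← sphDefect_eq_sum_edgeCap hω hω' hne hωp hgp, ← Finset.sum_div,
    ← mixedArea_eq_sum_edgeArea hωp hgp] at hμ
  exact hμ

theorem two_mul_sphDefect_le_of_ne_zero (hω : ∀ j, 0 < ω j) (hω' : ∀ j, ω j < Real.pi)
    (hne : ∀ j, g j ≠ 0) (hωp : ∀ j, ω (j + n) = ω j) (hgp : ∀ j, g (j + n) = g j)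
    (hconv : IsConvexSupport ω g) (htot : ∑ j ∈ Finset.range n, ω j < 2 * Real.pi)
    (hn : 0 < n) (hA : 0 < sphDefect n ω g) : 2 * sphDefect n ω g ≤ mixedArea n ω g g := by
  by_cases hpos : ∀ j, 0 < g j
  · exact sphDefect_le_of_pos hω hω' hpos hωp hgp hconv
  push Not at hpos
  obtain ⟨j₁, hj₁⟩ := hpos
  have hj₁ : g j₁ < 0 := lt_of_le_of_ne hj₁ (hne j₁)
  obtain ⟨k, hk, hk'⟩ : ∃ k, g k < 0 ∧ 0 < g (k + 1) := by
    by_contra hcon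
    push Not at hcon
    have hneg : ∀ i, g (j₁ + i) < 0 := fun i => by
      induction i with
      | zero => exact hj₁
      | succ i ih => exact lt_of_le_of_ne (hcon _ ih) (hne _)
    have hall : ∀ j, g j < 0 := fun j => by
      have hp : ∀ i, g (j + i * n) = g j := fun i => by
        induction i with
        | zero => simp
        | succ i ih => rw [← ih, ← hgp (j + i * n)]; congr 1; ring
      rw [← hp j₁, show j + j₁ * n = j₁ + (j + j₁ * n - j₁) by
        have := Nat.le_mul_of_pos_right j₁ hn; omega]
      exact hneg _
    -- a convex polygon all of whose edges turn to the right has negative total angle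
    have hsum : ∑ j ∈ Finset.range n, ω j =
        ∑ j ∈ Finset.range n, (angleOut ω g (j + 1) - angleIn ω g (j + 1)) := by
      rw [Finset.sum_sub_distrib, sum_range_shift_of_periodic (h := angleOut ω g) (fun j => by
        simp only [angleOut, hωp, hgp, show j + n + 1 = j + 1 + n by omega]) 1,
        ← Finset.sum_sub_distrib]
      refine Finset.sum_congr rfl fun j _ => ?_
      rw [angleOut_sub_angleIn hω hω' hne, if_pos (mul_pos_of_neg_of_neg (hall _) (hall _))]
    have h1 : 0 < ∑ j ∈ Finset.range n, ω j :=
      Finset.sum_pos (fun j _ => hω j) ⟨0, Finset.mem_range.2 hn⟩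
    have h2 : ∑ j ∈ Finset.range n, (angleOut ω g (j + 1) - angleIn ω g (j + 1)) ≤ 0 :=
      Finset.sum_nonpos fun j _ => by
        linarith [angleOut_le_angleIn hconv (Nat.succ_pos j) (hall (j + 1))]
    linarith
  have hshift : ∀ h : ℕ → ℝ, (∀ j, h (j + n) = h j) →
      ∑ j ∈ Finset.range n, h (j + k) = ∑ j ∈ Finset.range n, h j :=
    fun h hp => sum_range_shift_of_periodic hp k
  have sA : sphDefect n (fun j => ω (j + k)) (fun j => g (j + k)) = sphDefect n ω g := by
    have := hshift (fun j => ω j - sphSide (ω j) (g j) (g (j + 1)))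
      (fun j => by simp only [hωp, hgp, show j + n + 1 = j + 1 + n by omega])
    rw [sphDefect, sphDefect, ← this]
    exact Finset.sum_congr rfl fun j _ => by
      simp only [show j + 1 + k = j + k + 1 by omega]
  have sF : mixedArea n (fun j => ω (j + k)) (fun j => g (j + k)) (fun j => g (j + k)) =
      mixedArea n ω g g := by
    have := hshift (fun j => sectorForm (ω j) (g j) (g (j + 1)) (g j) (g (j + 1)))
      (fun j => by simp only [hωp, hgp, show j + n + 1 = j + 1 + n by omega])
    rw [mixedArea, mixedArea, ← this]
    exact Finset.sum_congr rfl fun j _ => by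
      simp only [show j + 1 + k = j + k + 1 by omega]
  obtain ⟨μ, hμ0, hμ1, hμ⟩ := sphDefect_le_of_sign_change (n := n) (ω := fun j => ω (j + k))
    (g := fun j => g (j + k)) (fun j => hω _) (fun j => hω' _) (fun j => hne _)
    (fun j => by rw [← hωp (j + k)]; congr 1; omega)
    (fun j => by rw [← hgp (j + k)]; congr 1; omega)
    (fun j => by
      have := hconv (j + k)
      simpa only [show j + 1 + k = j + k + 1 by omega, show j + 2 + k = j + k + 2 by omega]
        using this)
    (by rw [hshift ω hωp]; exact htot) (by simpa using hk) (by rw [add_comm]; exact hk') hn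
  rw [sA, sF] at hμ
  have hF : 0 < mixedArea n ω g g := by
    by_contra h
    push Not at h
    have := mul_nonpos_of_nonneg_of_nonpos hμ0 (show mixedArea n ω g g / 2 ≤ 0 by linarith)
    linarith
  have := mul_le_of_le_one_left (show 0 ≤ mixedArea n ω g g / 2 by linarith) hμ1
  linarith

/-- A convex polygon around a cone point of angle less than `2π` has positive area if the
corresponding spherical polygon has a perimeter smaller than the angle of the cone point. -/
theorem mixedArea_pos_of_sphDefect_pos (hω : ∀ j, 0 < ω j) (hω' : ∀ j, ω j < Real.pi)
    (hωp : ∀ j, ω (j + n) = ω j) (hgp : ∀ j, g (j + n) = g j)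
    (hconv : IsConvexSupport ω g) (htot : ∑ j ∈ Finset.range n, ω j < 2 * Real.pi)
    (hn : 0 < n) (hA : 0 < sphDefect n ω g) : 0 < mixedArea n ω g g := by
  -- increase all support numbers slightly, so that none of them vanishes
  have hconv' : ∀ s : ℝ, 0 ≤ s → IsConvexSupport ω (fun j => g j + s) := by
    intro s hs j
    have hin : ∀ θ, 0 < θ → θ < Real.pi → ∀ u v, slopeIn θ (u + s) (v + s) ≤ slopeIn θ u v := by
      intro θ h0 h1 u v
      have hsin := Real.sin_pos_of_pos_of_lt_pi h0 h1
      refine div_le_div_of_nonneg_right ?_ hsin.le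
      nlinarith [Real.cos_le_one θ]
    have hout : ∀ θ, 0 < θ → θ < Real.pi → ∀ u v, slopeOut θ u v ≤ slopeOut θ (u + s) (v + s) := by
      intro θ h0 h1 u v
      have hsin := Real.sin_pos_of_pos_of_lt_pi h0 h1
      refine div_le_div_of_nonneg_right ?_ hsin.le
      nlinarith [Real.cos_le_one θ]
    exact (hin _ (hω _) (hω' _) _ _).trans ((hconv j).trans (hout _ (hω _) (hω' _) _ _))
  have hcA : Continuous fun s : ℝ => sphDefect n ω (fun j => g j + s) := by
    unfold sphDefect sphSide
    refine continuous_finsetSum _ fun j _ => continuous_const.sub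
      (Real.continuous_arccos.comp ?_)
    refine Continuous.div (by fun_prop) (by fun_prop) fun s => ?_
    exact (mul_pos (sqrt_one_add_sq_pos _) (sqrt_one_add_sq_pos _)).ne'
  have hcF : Continuous fun s : ℝ => mixedArea n ω (fun j => g j + s) (fun j => g j + s) := by
    unfold mixedArea sectorForm
    fun_prop
  have e0 : (fun j => g j + 0) = g := funext fun j => add_zero _
  have tA : Filter.Tendsto (fun s : ℝ => sphDefect n ω (fun j => g j + s))
      (nhdsWithin 0 (Set.Ioi 0)) (nhds (sphDefect n ω g)) := by
    have := hcA.tendsto 0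
    rw [e0] at this
    exact this.mono_left nhdsWithin_le_nhds
  have tF : Filter.Tendsto (fun s : ℝ => mixedArea n ω (fun j => g j + s) (fun j => g j + s))
      (nhdsWithin 0 (Set.Ioi 0)) (nhds (mixedArea n ω g g)) := by
    have := hcF.tendsto 0
    rw [e0] at this
    exact this.mono_left nhdsWithin_le_nhds
  have hnz : ∀ᶠ s in nhdsWithin (0 : ℝ) (Set.Ioi 0), ∀ j ∈ Finset.range n, g j + s ≠ 0 := by
    rw [Filter.eventually_all_finset]
    intro j _
    by_cases hj : g j = 0
    · filter_upwards [self_mem_nhdsWithin] with s hs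
      rw [hj, zero_add]
      exact ne_of_gt hs
    · have : Filter.Tendsto (fun s : ℝ => g j + s) (nhds 0) (nhds (g j)) := by
        have h : Continuous fun s : ℝ => g j + s := by fun_prop
        simpa using h.tendsto 0
      exact (this.mono_left nhdsWithin_le_nhds).eventually_ne hj
  have hmod : ∀ j, g j = g (j % n) := fun j => by
    have hp : ∀ i k, g (k + n * i) = g k := fun i k => by
      induction i with
      | zero => simp
      | succ i ih => rw [← ih, ← hgp (k + n * i)]; congr 1; ring
    conv_lhs => rw [← Nat.mod_add_div j n]
    exact hp _ _
  have hev : ∀ᶠ s in nhdsWithin (0 : ℝ) (Set.Ioi 0),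
      2 * sphDefect n ω (fun j => g j + s) ≤
        mixedArea n ω (fun j => g j + s) (fun j => g j + s) := by
    filter_upwards [hnz, tA.eventually (lt_mem_nhds hA), self_mem_nhdsWithin] with s h1 h2 h3
    refine two_mul_sphDefect_le_of_ne_zero hω hω' (fun j => ?_) hωp (fun j => by rw [hgp])
      (hconv' s (le_of_lt h3)) htot hn h2
    rw [hmod j]
    exact h1 _ (Finset.mem_range.2 (Nat.mod_lt _ hn))
  have := le_of_tendsto_of_tendsto (tA.const_mul 2) tF hev
  linarith

end polygon

end

/-! ### Trigonometry of a pyramid -/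

theorem cos_euclAngle_of_sin_pos {a b c : ℝ} (h : 0 < Real.sin (euclAngle a b c)) :
    Real.cos (euclAngle a b c) = (b ^ 2 + c ^ 2 - a ^ 2) / (2 * b * c) := by
  unfold euclAngle at h ⊢
  rw [Real.sin_arccos, Real.sqrt_pos] at h
  exact Real.cos_arccos (by nlinarith) (by nlinarith)

/-- Sixteen times the squared area of the triangle with the given side lengths. -/
noncomputable def heron (a b c : ℝ) : ℝ :=
  2 * (a ^ 2 * b ^ 2 + b ^ 2 * c ^ 2 + c ^ 2 * a ^ 2) - (a ^ 4 + b ^ 4 + c ^ 4)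

theorem sin_euclAngle {a b c : ℝ} (hb : 0 < b) (hc : 0 < c) :
    Real.sin (euclAngle a b c) = √(heron a b c) / (2 * b * c) := by
  unfold euclAngle heron
  rw [Real.sin_arccos, eq_div_iff (by positivity),
    ← Real.sqrt_sq (show 0 ≤ 2 * b * c by positivity), ← Real.sqrt_mul' _ (by positivity),
    Real.sqrt_sq (by positivity)]
  congr 1
  field_simp
  ring

theorem euclAngle_eq_angle {E : Type*} [NormedAddCommGroup E] [InnerProductSpace ℝ E] (x y : E) :
    euclAngle (‖x - y‖) (‖x‖) (‖y‖) = InnerProductGeometry.angle x y := by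
  unfold euclAngle InnerProductGeometry.angle
  congr 1
  rw [norm_sub_sq_real, show ‖x‖ ^ 2 + ‖y‖ ^ 2 - (‖x‖ ^ 2 - 2 * inner ℝ x y + ‖y‖ ^ 2) =
    2 * inner ℝ x y by ring, mul_assoc, mul_div_mul_left _ _ two_ne_zero]

/-- The Gram determinant of three unit vectors that make the angles `a`, `b`, `c`. -/
noncomputable def trihedralGram (a b c : ℝ) : ℝ :=
  1 + 2 * Real.cos a * Real.cos b * Real.cos c
    - Real.cos a ^ 2 - Real.cos b ^ 2 - Real.cos c ^ 2

theorem trihedralGram_rotate (a b c : ℝ) : trihedralGram a b c = trihedralGram b c a := by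
  unfold trihedralGram; ring

theorem trihedralGram_swap (a b c : ℝ) : trihedralGram a b c = trihedralGram a c b := by
  unfold trihedralGram; ring

theorem trihedralGram_eq (a b c : ℝ) : trihedralGram a b c =
    (Real.sin b * Real.sin c) ^ 2 - (Real.cos a - Real.cos b * Real.cos c) ^ 2 := by
  unfold trihedralGram
  rw [mul_pow, Real.sin_sq, Real.sin_sq]
  ring

theorem trihedralGram_angle_pos {E : Type*} [NormedAddCommGroup E] [InnerProductSpace ℝ E]
    {x y z : E} (h : LinearIndependent ℝ ![x, y, z]) :
    0 < trihedralGram (InnerProductGeometry.angle y z) (InnerProductGeometry.angle z x)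
      (InnerProductGeometry.angle x y) := by
  have hd := (Matrix.posDef_gram_of_linearIndependent h).det_pos
  have hx : 0 < ‖x‖ := norm_pos_iff.2 (h.ne_zero 0)
  have hy : 0 < ‖y‖ := norm_pos_iff.2 (h.ne_zero 1)
  have hz : 0 < ‖z‖ := norm_pos_iff.2 (h.ne_zero 2)
  rw [Matrix.det_fin_three] at hd
  simp only [Matrix.gram_apply, Matrix.cons_val_zero, Matrix.cons_val_one, Matrix.cons_val,
    real_inner_self_eq_norm_sq] at hd
  rw [real_inner_comm x y, real_inner_comm y z, real_inner_comm z x,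
    ← InnerProductGeometry.cos_angle_mul_norm_mul_norm x y,
    ← InnerProductGeometry.cos_angle_mul_norm_mul_norm y z,
    ← InnerProductGeometry.cos_angle_mul_norm_mul_norm z x] at hd
  have hk : 0 < (‖x‖ * ‖y‖ * ‖z‖) ^ 2 := by positivity
  refine pos_of_mul_pos_left (b := (‖x‖ * ‖y‖ * ‖z‖) ^ 2) ?_ hk.le
  unfold trihedralGram
  convert hd using 1
  ring

theorem sin_pos_of_trihedralGram_pos {a b c : ℝ} (hb : 0 ≤ b) (hb' : b ≤ Real.pi)
    (h : 0 < trihedralGram a b c) : 0 < Real.sin b := by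
  refine lt_of_le_of_ne (Real.sin_nonneg_of_nonneg_of_le_pi hb hb') fun h0 => ?_
  rw [trihedralGram_eq, ← h0] at h
  nlinarith [sq_nonneg (Real.cos a - Real.cos b * Real.cos c)]

theorem sphAngle_nonneg (a b c : ℝ) : 0 ≤ sphAngle a b c := Real.arccos_nonneg _

theorem sphAngle_le_pi (a b c : ℝ) : sphAngle a b c ≤ Real.pi := Real.arccos_le_pi _

section trihedral

variable {a b c : ℝ}

theorem cos_sphAngle (hb : 0 < Real.sin b) (hc : 0 < Real.sin c) (h : 0 < trihedralGram a b c) :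
    Real.cos (sphAngle a b c) =
      (Real.cos a - Real.cos b * Real.cos c) / (Real.sin b * Real.sin c) := by
  rw [trihedralGram_eq, sub_pos] at h
  have hp : 0 < Real.sin b * Real.sin c := mul_pos hb hc
  have := abs_le.1 (abs_le_of_sq_le_sq h.le hp.le)
  unfold sphAngle
  rw [Real.cos_arccos]
  · rw [le_div_iff₀ hp]; linarith
  · rw [div_le_one hp]; linarith

theorem sin_sphAngle (hb : 0 < Real.sin b) (hc : 0 < Real.sin c) :
    Real.sin (sphAngle a b c) = √(trihedralGram a b c) / (Real.sin b * Real.sin c) := by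
  have hp : 0 < Real.sin b * Real.sin c := mul_pos hb hc
  unfold sphAngle
  rw [Real.sin_arccos, eq_div_iff hp.ne', trihedralGram_eq]
  conv_lhs => rw [← Real.sqrt_sq hp.le]
  rw [Real.sqrt_sq hp.le, ← Real.sqrt_sq hp.le, ← Real.sqrt_mul' _ (by positivity),
    Real.sqrt_sq hp.le]
  congr 1
  field_simp

theorem sin_sphAngle_pos (hb : 0 < Real.sin b) (hc : 0 < Real.sin c)
    (h : 0 < trihedralGram a b c) : 0 < Real.sin (sphAngle a b c) := by
  rw [sin_sphAngle hb hc]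
  have := Real.sqrt_pos.2 h
  positivity

theorem pos_and_lt_pi_of_sin_pos {x : ℝ} (h0 : 0 ≤ x) (h1 : x ≤ Real.pi) (h : 0 < Real.sin x) :
    0 < x ∧ x < Real.pi := by
  refine ⟨lt_of_le_of_ne h0 ?_, lt_of_le_of_ne h1 ?_⟩ <;> rintro rfl <;> simp at h

/-- The normal derivative of the support function along the side `b` of a trihedral angle is a
multiple of the cotangent of the dihedral angle at that side. -/
theorem slopeOut_cot (ha : 0 < Real.sin a) (hb : 0 < Real.sin b) (hc : 0 < Real.sin c)
    (h : 0 < trihedralGram a b c) :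
    slopeOut (sphAngle a b c) (Real.cos b / Real.sin b) (Real.cos c / Real.sin c) =
      Real.cos (sphAngle c b a) / Real.sin (sphAngle c b a) / Real.sin b := by
  have h' : trihedralGram c b a = trihedralGram a b c := by unfold trihedralGram; ring
  have hs := Real.sqrt_pos.2 h
  unfold slopeOut
  rw [cos_sphAngle hb hc h, sin_sphAngle hb hc, cos_sphAngle hb ha (h' ▸ h),
    sin_sphAngle hb ha, h']
  field_simp
  rw [Real.sin_sq]
  ring

theorem slopeIn_cot (ha : 0 < Real.sin a) (hb : 0 < Real.sin b) (hc : 0 < Real.sin c)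
    (h : 0 < trihedralGram a b c) :
    slopeIn (sphAngle a b c) (Real.cos b / Real.sin b) (Real.cos c / Real.sin c) =
      -(Real.cos (sphAngle b c a) / Real.sin (sphAngle b c a) / Real.sin c) := by
  have h' : trihedralGram b c a = trihedralGram a b c := by unfold trihedralGram; ring
  have hs := Real.sqrt_pos.2 h
  unfold slopeIn
  rw [cos_sphAngle hb hc h, sin_sphAngle hb hc, cos_sphAngle hc ha (h' ▸ h),
    sin_sphAngle hc ha, h']
  field_simp
  rw [Real.sin_sq]
  ring

theorem sphSide_sphAngle (ha : 0 ≤ a) (ha' : a ≤ Real.pi) (hb : 0 < Real.sin b)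
    (hc : 0 < Real.sin c) (h : 0 < trihedralGram a b c) :
    sphSide (sphAngle a b c) (Real.cos b / Real.sin b) (Real.cos c / Real.sin c) = a := by
  have key : ∀ {t : ℝ}, 0 < Real.sin t →
      √(1 + (Real.cos t / Real.sin t) ^ 2) = 1 / Real.sin t := fun {t} ht => by
    rw [Real.sqrt_eq_iff_mul_self_eq (by positivity) (by positivity)]
    field_simp
    linarith [Real.sin_sq_add_cos_sq t]
  unfold sphSide
  rw [key hb, key hc, cos_sphAngle hb hc h]
  convert Real.arccos_cos ha ha' using 2
  field_simp
  ring

theorem cot_add_cot_nonneg (hb : 0 < Real.sin b) (hc : 0 < Real.sin c) (h0 : 0 ≤ b + c)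
    (h : b + c ≤ Real.pi) : 0 ≤ Real.cos b / Real.sin b + Real.cos c / Real.sin c := by
  have : Real.cos b / Real.sin b + Real.cos c / Real.sin c =
      Real.sin (b + c) / (Real.sin b * Real.sin c) := by
    rw [Real.sin_add]; field_simp; ring
  rw [this]
  exact div_nonneg (Real.sin_nonneg_of_nonneg_of_le_pi h0 h) (by positivity)

end trihedral

section tetrahedron

variable {r₁ r₂ r₃ l₁ l₂ l₃ : ℝ}

/-- The dihedral angle at a base edge of a pyramid, computed at either end of the edge. -/
theorem sphAngle_base_symm (hr₁ : 0 < r₁) (hr₃ : 0 < r₃)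
    (hl₁ : 0 < l₁) (hl₂ : 0 < l₂) (hl₃ : 0 < l₃)
    (a₁ : 0 < Real.sin (euclAngle r₂ r₁ l₁)) (a₂ : 0 < Real.sin (euclAngle r₃ r₁ l₃))
    (a₃ : 0 < Real.sin (euclAngle l₂ l₁ l₃)) (b₁ : 0 < Real.sin (euclAngle r₂ r₃ l₂))
    (b₂ : 0 < Real.sin (euclAngle r₁ r₃ l₃)) (b₃ : 0 < Real.sin (euclAngle l₁ l₃ l₂)) :
    sphAngle (euclAngle r₂ r₁ l₁) (euclAngle r₃ r₁ l₃) (euclAngle l₂ l₁ l₃) =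
      sphAngle (euclAngle r₂ r₃ l₂) (euclAngle r₁ r₃ l₃) (euclAngle l₁ l₃ l₂) := by
  unfold sphAngle
  congr 1
  rw [cos_euclAngle_of_sin_pos a₁, cos_euclAngle_of_sin_pos a₂, cos_euclAngle_of_sin_pos a₃,
    cos_euclAngle_of_sin_pos b₁, cos_euclAngle_of_sin_pos b₂, cos_euclAngle_of_sin_pos b₃]
  have e1 : heron r₁ r₃ l₃ = heron r₃ r₁ l₃ := by unfold heron; ring
  have e2 : heron l₁ l₃ l₂ = heron l₂ l₁ l₃ := by unfold heron; ring
  rw [sin_euclAngle hr₁ hl₃] at a₂ ⊢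
  rw [sin_euclAngle hl₁ hl₃] at a₃ ⊢
  rw [sin_euclAngle hr₃ hl₃, sin_euclAngle hl₃ hl₂, e1, e2]
  have p1 : √(heron r₃ r₁ l₃) ≠ 0 := fun h => by rw [h] at a₂; simp at a₂
  have p2 : √(heron l₂ l₁ l₃) ≠ 0 := fun h => by rw [h] at a₃; simp at a₃
  field_simp
  ring

theorem sin_apex_pos (hr₁ : 0 < r₁) (hr₂ : 0 < r₂) (hl₁ : 0 < l₁)
    (a₁ : 0 < Real.sin (euclAngle r₂ r₁ l₁)) : 0 < Real.sin (euclAngle l₁ r₁ r₂) := by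
  have e : heron l₁ r₁ r₂ = heron r₂ r₁ l₁ := by unfold heron; ring
  rw [sin_euclAngle hr₁ hl₁] at a₁
  rw [sin_euclAngle hr₁ hr₂, e]
  have : 0 < √(heron r₂ r₁ l₁) := by
    by_contra h
    exact absurd a₁ (not_lt.2 (div_nonpos_of_nonpos_of_nonneg (not_lt.1 h) (by positivity)))
  positivity

/-- The dihedral angle at a lateral edge of a pyramid is also the dihedral angle of the trihedral
angle at the apex. -/
theorem cos_lateral_apex (hr₁ : 0 < r₁) (hr₂ : 0 < r₂) (hr₃ : 0 < r₃)
    (hl₁ : 0 < l₁) (hl₃ : 0 < l₃)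
    (a₁ : 0 < Real.sin (euclAngle r₂ r₁ l₁)) (a₂ : 0 < Real.sin (euclAngle r₃ r₁ l₃))
    (a₃ : 0 < Real.sin (euclAngle l₂ l₁ l₃)) (f₂ : 0 < Real.sin (euclAngle l₂ r₂ r₃))
    (hG : 0 < trihedralGram (euclAngle l₂ l₁ l₃) (euclAngle r₂ r₁ l₁) (euclAngle r₃ r₁ l₃)) :
    Real.cos (sphAngle (euclAngle l₂ l₁ l₃) (euclAngle r₂ r₁ l₁) (euclAngle r₃ r₁ l₃)) *
        (Real.sin (euclAngle l₁ r₁ r₂) * Real.sin (euclAngle l₃ r₁ r₃)) =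
      Real.cos (euclAngle l₂ r₂ r₃) -
        Real.cos (euclAngle l₁ r₁ r₂) * Real.cos (euclAngle l₃ r₁ r₃) := by
  have f₁ := sin_apex_pos hr₁ hr₂ hl₁ a₁
  have f₃ := sin_apex_pos hr₁ hr₃ hl₃ a₂
  rw [cos_sphAngle a₁ a₂ hG, cos_euclAngle_of_sin_pos a₁, cos_euclAngle_of_sin_pos a₂,
    cos_euclAngle_of_sin_pos a₃, cos_euclAngle_of_sin_pos f₁, cos_euclAngle_of_sin_pos f₂,
    cos_euclAngle_of_sin_pos f₃]
  have e1 : heron l₁ r₁ r₂ = heron r₂ r₁ l₁ := by unfold heron; ring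
  have e2 : heron l₃ r₁ r₃ = heron r₃ r₁ l₃ := by unfold heron; ring
  rw [sin_euclAngle hr₁ hl₁] at a₁ ⊢
  rw [sin_euclAngle hr₁ hl₃] at a₂ ⊢
  rw [sin_euclAngle hr₁ hr₂, sin_euclAngle hr₁ hr₃, e1, e2]
  have p1 : √(heron r₂ r₁ l₁) ≠ 0 := fun h => by rw [h] at a₁; simp at a₁
  have p2 : √(heron r₃ r₁ l₃) ≠ 0 := fun h => by rw [h] at a₂; simp at a₂
  field_simp
  ring

/-- The cotangent of the angle at the base of a triangle, in terms of the angle at the apex. -/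
theorem cot_base_eq_apex (hr₁ : 0 < r₁) (hr₂ : 0 < r₂) (hl₁ : 0 < l₁)
    (a₁ : 0 < Real.sin (euclAngle r₂ r₁ l₁)) :
    Real.cos (euclAngle r₂ r₁ l₁) / Real.sin (euclAngle r₂ r₁ l₁) / r₁ =
      (1 / r₂ - Real.cos (euclAngle l₁ r₁ r₂) * (1 / r₁)) / Real.sin (euclAngle l₁ r₁ r₂) := by
  have f₁ := sin_apex_pos hr₁ hr₂ hl₁ a₁
  rw [cos_euclAngle_of_sin_pos a₁, cos_euclAngle_of_sin_pos f₁]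
  have e1 : heron l₁ r₁ r₂ = heron r₂ r₁ l₁ := by unfold heron; ring
  rw [sin_euclAngle hr₁ hl₁] at a₁ ⊢
  rw [sin_euclAngle hr₁ hr₂, e1]
  have p1 : √(heron r₂ r₁ l₁) ≠ 0 := fun h => by rw [h] at a₁; simp at a₁
  field_simp
  ring

end tetrahedron

theorem sectorForm_apex {θ c s t c₁ c₂ c₃ Δ : ℝ} (hΔ : 0 < Δ) (hs : 0 < s) (ht : 0 < t)
    (h1 : Real.sin θ * (s * t) = Δ) (h2 : Real.cos θ * (s * t) = c) (x y z u v w : ℝ)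
    (hs2 : s ^ 2 = 1 - c₁ ^ 2) (ht2 : t ^ 2 = 1 - c₃ ^ 2) (hc : c = c₂ - c₁ * c₃) :
    sectorForm θ ((y - c₁ * x) / s) ((z - c₃ * x) / t) ((v - c₁ * u) / s) ((w - c₃ * u) / t) =
      ((y - c₁ * x) * (w - c₃ * u) + (v - c₁ * u) * (z - c₃ * x)
        - (c₂ - c₁ * c₃) * ((y - c₁ * x) * (v - c₁ * u) / (1 - c₁ ^ 2)
          + (z - c₃ * x) * (w - c₃ * u) / (1 - c₃ ^ 2))) / Δ := by
  have e1 : Real.sin θ = Δ / (s * t) := by rw [eq_div_iff (by positivity), h1]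
  have e2 : Real.cos θ = (c₂ - c₁ * c₃) / (s * t) := by rw [eq_div_iff (by positivity), h2, hc]
  unfold sectorForm
  rw [e1, e2, ← hs2, ← ht2]
  field_simp

/-- For a trihedral angle with the cosines `c₁`, `c₂`, `c₃` of the face angles, the sum over the
three edges of the quadratic form of the edge in `(x, y, z)`, weighted by `(u, v, w)`, does not
change when the weights are exchanged with one of the two arguments of the polarized form. -/
theorem apex_trilinear {c₁ c₂ c₃ : ℝ} (h₁ : 1 - c₁ ^ 2 ≠ 0) (h₂ : 1 - c₂ ^ 2 ≠ 0)
    (h₃ : 1 - c₃ ^ 2 ≠ 0) (x y z u v w : ℝ) :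
    u * (2 * ((y - c₁ * x) * (z - c₃ * x)) - (c₂ - c₁ * c₃) *
          ((y - c₁ * x) * (y - c₁ * x) / (1 - c₁ ^ 2) +
            (z - c₃ * x) * (z - c₃ * x) / (1 - c₃ ^ 2))) +
      v * (2 * ((z - c₂ * y) * (x - c₁ * y)) - (c₃ - c₂ * c₁) *
          ((z - c₂ * y) * (z - c₂ * y) / (1 - c₂ ^ 2) +
            (x - c₁ * y) * (x - c₁ * y) / (1 - c₁ ^ 2))) +
      w * (2 * ((x - c₃ * z) * (y - c₂ * z)) - (c₁ - c₃ * c₂) *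
          ((x - c₃ * z) * (x - c₃ * z) / (1 - c₃ ^ 2) +
            (y - c₂ * z) * (y - c₂ * z) / (1 - c₂ ^ 2))) =
    x * ((v - c₁ * u) * (z - c₃ * x) + (y - c₁ * x) * (w - c₃ * u) - (c₂ - c₁ * c₃) *
          ((v - c₁ * u) * (y - c₁ * x) / (1 - c₁ ^ 2) +
            (w - c₃ * u) * (z - c₃ * x) / (1 - c₃ ^ 2))) +
      y * ((w - c₂ * v) * (x - c₁ * y) + (z - c₂ * y) * (u - c₁ * v) - (c₃ - c₂ * c₁) *
          ((w - c₂ * v) * (z - c₂ * y) / (1 - c₂ ^ 2) +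
            (u - c₁ * v) * (x - c₁ * y) / (1 - c₁ ^ 2))) +
      z * ((u - c₃ * w) * (y - c₂ * z) + (x - c₃ * z) * (v - c₂ * w) - (c₁ - c₃ * c₂) *
          ((u - c₃ * w) * (x - c₃ * z) / (1 - c₃ ^ 2) +
            (v - c₂ * w) * (y - c₂ * z) / (1 - c₂ ^ 2))) := by
  field_simp
  ring

/-! ### Derivatives of the angles -/

section deriv

variable {E : Type*} [NormedAddCommGroup E] [NormedSpace ℝ E]

theorem hasFDerivAt_arccos_div {N M : E → ℝ} {N' M' : E →L[ℝ] ℝ} {p : E}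
    (hN : HasFDerivAt N N' p) (hM : HasFDerivAt M M' p) (hM0 : M p ≠ 0)
    (h : 0 < Real.sin (Real.arccos (N p / M p))) :
    HasFDerivAt (fun q => Real.arccos (N q / M q))
      ((-(1 / Real.sin (Real.arccos (N p / M p))) / M p) • (N' - (N p / M p) • M')) p := by
  rw [Real.sin_arccos] at h ⊢
  have h1 := Real.sqrt_pos.1 h
  have hd := (Real.hasDerivAt_arccos (x := N p / M p) (by rintro e; rw [e] at h1; norm_num at h1)
    (by rintro e; rw [e] at h1; norm_num at h1)).comp_hasFDerivAt p
    (hN.mul ((hasDerivAt_inv hM0).comp_hasFDerivAt p hM))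
  have he : (fun q => Real.arccos (N q / M q)) = Real.arccos ∘ (N * (fun y => y⁻¹) ∘ M) := by
    funext q
    simp [div_eq_mul_inv]
  rw [he]
  refine hd.congr_fderiv ?_
  ext x
  simp
  field_simp
  ring

theorem hasFDerivAt_euclAngle {X Y : E → ℝ} {X' Y' : E →L[ℝ] ℝ} {p : E} {l : ℝ}
    (hX : HasFDerivAt X X' p) (hY : HasFDerivAt Y Y' p) (hX0 : 0 < X p) (hY0 : 0 < Y p)
    (hl : 0 < l) (h : 0 < Real.sin (euclAngle (Y p) (X p) l)) :
    HasFDerivAt (fun q => euclAngle (Y q) (X q) l)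
      ((1 / X p) • ((1 / Real.sin (euclAngle l (X p) (Y p))) •
        (Y' - Real.cos (euclAngle l (X p) (Y p)) • X'))) p := by
  have f₁ := sin_apex_pos hX0 hY0 hl h
  have hd := hasFDerivAt_arccos_div (((hX.pow 2).add_const (l ^ 2)).sub (hY.pow 2))
    ((hX.const_mul 2).mul_const l) (by simp; exact ⟨hX0.ne', hl.ne'⟩) h
  refine hd.congr_fderiv ?_
  ext x
  have e1 : heron l (X p) (Y p) = heron (Y p) (X p) l := by unfold heron; ring
  rw [cos_euclAngle_of_sin_pos f₁, sin_euclAngle hX0 hY0, e1]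
  have e2 := sin_euclAngle (a := Y p) hX0 hl
  rw [e2] at h
  unfold euclAngle at e2
  simp only [Pi.sub_apply, e2]
  have p1 : √(heron (Y p) (X p) l) ≠ 0 := fun h' => by rw [h'] at h; simp at h
  simp
  field_simp
  ring

theorem hasFDerivAt_sphAngle {b c : E → ℝ} {b' c' : E →L[ℝ] ℝ} {p : E} {a : ℝ}
    (hb : HasFDerivAt b b' p) (hc : HasFDerivAt c c' p) (hb0 : 0 < Real.sin (b p))
    (hc0 : 0 < Real.sin (c p)) (h : 0 < trihedralGram a (b p) (c p)) :
    HasFDerivAt (fun q => sphAngle a (b q) (c q))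
      ((-(Real.cos (c p) / Real.sin (c p) - Real.cos (sphAngle a (b p) (c p)) *
          (Real.cos (b p) / Real.sin (b p))) / Real.sin (sphAngle a (b p) (c p))) • b' +
        (-(Real.cos (b p) / Real.sin (b p) - Real.cos (sphAngle a (b p) (c p)) *
          (Real.cos (c p) / Real.sin (c p))) / Real.sin (sphAngle a (b p) (c p))) • c') p := by
  have hs := sin_sphAngle_pos hb0 hc0 h
  have hd := hasFDerivAt_arccos_div ((hb.cos.mul hc.cos).const_sub (Real.cos a))
    (hb.sin.mul hc.sin) (mul_pos hb0 hc0).ne' hs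
  refine hd.congr_fderiv ?_
  ext x
  have e1 := cos_sphAngle hb0 hc0 h
  have e2 : Real.sin (Real.arccos ((Real.cos a - (Real.cos (b p) * Real.cos (c p))) /
    (Real.sin (b p) * Real.sin (c p)))) = Real.sin (sphAngle a (b p) (c p)) := rfl
  simp only [Pi.mul_apply, e2]
  rw [e1]
  simp
  field_simp
  ring

end deriv

namespace GeodesicTriangulation

/-! ### The darts around a vertex and around a triangle -/

section darts

variable {V D : Type*} [Fintype V] [Fintype D] (T : GeodesicTriangulation V D)

theorem src_rot (d : D) : T.src (T.rot d) = T.src d :=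
  (T.src_eq_iff _ _).2 (Equiv.Perm.sameCycle_apply_left.2 (Equiv.Perm.SameCycle.refl _ _))

theorem src_rev (d : D) : T.src (T.rev d) = T.src (T.next d) := by
  rw [← T.src_rot (T.next d), rot, T.next_next_next]

theorem src_next_rev (d : D) : T.src (T.next (T.rev d)) = T.src d := by
  rw [← T.src_rev, T.rev_rev]

theorem src_next_rot (d : D) : T.src (T.next (T.rot d)) = T.src (T.next (T.next d)) :=
  T.src_next_rev _

theorem len_rot (d : D) : T.len (T.rot d) = T.len (T.next (T.next d)) := T.len_rev _

theorem rho_rot (r : V → ℝ) (d : D) : T.rho r (T.rot d) =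
    euclAngle (r (T.src (T.next (T.next d)))) (r (T.src d)) (T.len (T.next (T.next d))) := by
  rw [rho, src_next_rot, src_rot, len_rot]

/-- The darts issuing from a vertex, listed in the cyclic order of the rotation. -/
theorem exists_cycle [DecidableEq V] (i : V) : ∃ n, 0 < n ∧ ∃ d, T.rot^[n] d = d ∧
    (∀ j, T.src (T.rot^[j] d) = i) ∧ (∀ e, T.src e = i → ∃ j < n, T.rot^[j] d = e) ∧
    ∀ F : D → ℝ, ∑ e with T.src e = i, F e = ∑ j ∈ Finset.range n, F (T.rot^[j] d) := by
  classical
  obtain ⟨d, rfl⟩ := T.src_surjective i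
  set f : Equiv.Perm D := (T.next.trans T.next).trans T.rev with hf
  have hfr : ⇑f = T.rot := rfl
  have hper : d ∈ Function.periodicPts T.rot := by
    refine Function.mk_mem_periodicPts (orderOf_pos f) ?_
    rw [Function.IsPeriodicPt, Function.IsFixedPt, ← hfr, ← Equiv.Perm.coe_pow, pow_orderOf_eq_one]
    rfl
  have hn := Function.minimalPeriod_pos_of_mem_periodicPts hper
  have hsrc : ∀ j, T.src (T.rot^[j] d) = T.src d := fun j => by
    induction j with
    | zero => rfl
    | succ j ih => rw [Function.iterate_succ_apply', src_rot, ih]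
  have hsurj : ∀ e, T.src e = T.src d →
      ∃ j < Function.minimalPeriod T.rot d, T.rot^[j] d = e := fun e he => by
    obtain ⟨k, hk⟩ := ((T.src_eq_iff d e).1 he.symm).exists_nat_pow_eq
    refine ⟨k % Function.minimalPeriod T.rot d, Nat.mod_lt _ hn, ?_⟩
    rw [Function.iterate_mod_minimalPeriod_eq, ← hk, ← hfr, ← Equiv.Perm.coe_pow]
  refine ⟨_, hn, d, Function.iterate_minimalPeriod, hsrc, hsurj, fun F => ?_⟩
  symm
  refine Finset.sum_nbij (fun j => T.rot^[j] d) (fun j _ => by simp [hsrc]) ?_ ?_ fun _ _ => rfl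
  · intro j hj k hk h
    exact Function.iterate_injOn_Iio_minimalPeriod (by simpa using hj) (by simpa using hk) h
  · intro e he
    obtain ⟨j, hj, h⟩ := hsurj e (by simpa using he)
    exact ⟨j, by simpa using hj, h⟩

theorem three_mul_sum_dart (F : D → ℝ) :
    3 * ∑ d, F d = ∑ d, (F d + F (T.next d) + F (T.next (T.next d))) := by
  rw [Finset.sum_add_distrib, Finset.sum_add_distrib, Equiv.sum_comp T.next,
    Equiv.sum_comp T.next (fun d => F (T.next d)), Equiv.sum_comp T.next]
  ring

end darts

/-! ### The pyramids of a generalized polytope -/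

section pyramid

variable {V D : Type*} [Fintype V] [Fintype D] {T : GeodesicTriangulation V D} {r : V → ℝ}

theorem trihedralGram_pos {d : D} (h : T.HasPyramid r d) :
    0 < trihedralGram (T.corner d) (T.rho r d) (T.rho r (T.rot d)) := by
  obtain ⟨a, p, q, s, hind, h1, h2, h3, h4, h5, h6⟩ := h
  have hlin : LinearIndependent ℝ ![a - p, q - p, s - p] := by
    have := (affineIndependent_iff_linearIndependent_vsub ℝ _ (1 : Fin 4)).1 hind
    have hi : Function.Injective
        (![⟨0, by decide⟩, ⟨2, by decide⟩, ⟨3, by decide⟩] : Fin 3 → {x : Fin 4 // x ≠ 1}) := by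
      decide
    have e : ![a - p, q - p, s - p] = (fun i : {x : Fin 4 // x ≠ 1} =>
        ![a, p, q, s] (i : Fin 4) -ᵥ ![a, p, q, s] 1) ∘
        ![⟨0, by decide⟩, ⟨2, by decide⟩, ⟨3, by decide⟩] := by
      funext i
      fin_cases i <;> rfl
    rw [e]
    exact this.comp _ hi
  have hG := trihedralGram_angle_pos hlin
  have e1 : T.corner d = InnerProductGeometry.angle (q - p) (s - p) := by
    rw [← euclAngle_eq_angle, sub_sub_sub_cancel_right, ← dist_eq_norm, ← dist_eq_norm,
      ← dist_eq_norm, dist_comm q p, h1, h2, h3, corner]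
  have e2 : T.rho r d = InnerProductGeometry.angle (a - p) (q - p) := by
    rw [← euclAngle_eq_angle, sub_sub_sub_cancel_right, ← dist_eq_norm, ← dist_eq_norm,
      ← dist_eq_norm, dist_comm q p, h1, h4, h5, rho]
  have e3 : T.rho r (T.rot d) = InnerProductGeometry.angle (s - p) (a - p) := by
    rw [InnerProductGeometry.angle_comm, ← euclAngle_eq_angle, sub_sub_sub_cancel_right,
      ← dist_eq_norm, ← dist_eq_norm, ← dist_eq_norm, h3, h4, h6, rho_rot]
  rw [trihedralGram_swap, e1, e2, e3]
  exact hG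

theorem sin_corner_pos {d : D} (h : T.HasPyramid r d) : 0 < Real.sin (T.corner d) := by
  have := trihedralGram_pos h
  rw [trihedralGram_rotate, trihedralGram_rotate] at this
  exact sin_pos_of_trihedralGram_pos (Real.arccos_nonneg _) (Real.arccos_le_pi _) this

theorem sin_rho_pos {d : D} (h : T.HasPyramid r d) : 0 < Real.sin (T.rho r d) :=
  sin_pos_of_trihedralGram_pos (Real.arccos_nonneg _) (Real.arccos_le_pi _) (trihedralGram_pos h)

theorem sin_rho_rot_pos {d : D} (h : T.HasPyramid r d) : 0 < Real.sin (T.rho r (T.rot d)) := by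
  have := trihedralGram_pos h
  rw [trihedralGram_rotate] at this
  exact sin_pos_of_trihedralGram_pos (Real.arccos_nonneg _) (Real.arccos_le_pi _) this

theorem lateralDihedral_mem {d : D} (h : T.HasPyramid r d) :
    0 < T.lateralDihedral r d ∧ T.lateralDihedral r d < Real.pi :=
  pos_and_lt_pi_of_sin_pos (sphAngle_nonneg _ _ _) (sphAngle_le_pi _ _ _)
    (sin_sphAngle_pos (sin_rho_pos h) (sin_rho_rot_pos h) (trihedralGram_pos h))

variable (T r) in
/-- The cotangent of the angle between a dart and the lateral edge at its initial vertex `i`.  These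
are the support numbers of the polygon polar to the section of the solid angle at `i` by a plane
orthogonal to the lateral edge at distance one from `i`. -/
noncomputable def cotRho (d : D) : ℝ := Real.cos (T.rho r d) / Real.sin (T.rho r d)

theorem sphSide_eq_corner {d : D} (h : T.HasPyramid r d) :
    sphSide (T.lateralDihedral r d) (T.cotRho r d) (T.cotRho r (T.rot d)) = T.corner d :=
  sphSide_sphAngle (Real.arccos_nonneg _) (Real.arccos_le_pi _) (sin_rho_pos h)
    (sin_rho_rot_pos h) (trihedralGram_pos h)

/-- The dihedral angle at the side of the triangle of `d` that ends at the initial vertex of `d`,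
computed at that vertex. -/
theorem sphAngle_eq_baseDihedral (hP : T.IsGeneralizedPolytope r) (d : D) :
    sphAngle (T.rho r d) (T.rho r (T.rot d)) (T.corner d) =
      T.baseDihedral r (T.next (T.next d)) := by
  have h1 := sin_rho_pos (hP.2 d)
  have h2 := sin_rho_rot_pos (hP.2 d)
  have h3 := sin_corner_pos (hP.2 d)
  have k1 := sin_rho_pos (hP.2 (T.next (T.next d)))
  have k2 := sin_rho_rot_pos (hP.2 (T.next (T.next d)))
  have k3 := sin_corner_pos (hP.2 (T.next (T.next d)))
  rw [rho_rot] at h2 k2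
  unfold baseDihedral
  rw [rho_rot, rho_rot]
  unfold rho corner at *
  simp only [T.next_next_next] at *
  exact sphAngle_base_symm (hP.1 _) (hP.1 _) (T.len_pos _) (T.len_pos _) (T.len_pos _) h1 h2 h3
    k2 k1 k3

theorem sin_baseDihedral_pos {d : D} (h : T.HasPyramid r d) :
    0 < Real.sin (T.baseDihedral r d) :=
  sin_sphAngle_pos (sin_rho_pos h) (sin_corner_pos h)
    (by have := trihedralGram_pos h
        rwa [trihedralGram_rotate, trihedralGram_rotate, trihedralGram_swap] at this)

/-- The local convexity at the boundary edges is the convexity of the support numbers `cotRho`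
around each vertex. -/
theorem slopeIn_le_slopeOut (hP : T.IsGeneralizedConvexPolytope r) (d : D) :
    slopeIn (T.lateralDihedral r d) (T.cotRho r d) (T.cotRho r (T.rot d)) ≤
      slopeOut (T.lateralDihedral r (T.rot d)) (T.cotRho r (T.rot d))
        (T.cotRho r (T.rot (T.rot d))) := by
  have hd := hP.1.2 d
  have hr := hP.1.2 (T.rot d)
  have hn := hP.1.2 (T.next (T.next d))
  have hs := sin_rho_pos hr
  have e1 := slopeIn_cot (sin_corner_pos hd) (sin_rho_pos hd) (sin_rho_rot_pos hd)
    (trihedralGram_pos hd)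
  have e2 := slopeOut_cot (sin_corner_pos hr) (sin_rho_pos hr) (sin_rho_rot_pos hr)
    (trihedralGram_pos hr)
  rw [sphAngle_eq_baseDihedral hP.1] at e1
  have hconv := hP.2 (T.rot d)
  rw [boundaryDihedral, rot, T.rev_rev, ← rot] at hconv
  have := cot_add_cot_nonneg (sin_baseDihedral_pos hr) (sin_baseDihedral_pos hn)
    (add_nonneg (sphAngle_nonneg _ _ _) (sphAngle_nonneg _ _ _)) hconv
  change slopeIn (sphAngle _ _ _) (_ / _) (_ / _) ≤ slopeOut (sphAngle _ _ _) (_ / _) (_ / _)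
  rw [e1, e2, ← sub_nonneg]
  have e3 := div_nonneg this hs.le
  rw [add_div] at e3
  unfold baseDihedral at e3 ⊢
  linarith

/-! ### The derivative of the curvatures -/

variable (T r) in
/-- The angle at the apex in the triangle spanned by a dart and the apex. -/
noncomputable def apexAngle (d : D) : ℝ :=
  euclAngle (T.len d) (r (T.src d)) (r (T.src (T.next d)))

variable (T r) in
/-- The derivative of `rho r d` with respect to the radii in the direction `x`, multiplied by the
length of the lateral edge at the initial vertex of `d`. -/
noncomputable def rhoVariation (x : V → ℝ) (d : D) : ℝ :=
  (x (T.src (T.next d)) - Real.cos (T.apexAngle r d) * x (T.src d)) / Real.sin (T.apexAngle r d)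

variable (T r) in
/-- The polarized area form at the vertex `i`: the sum over the triangles at `i` of the mixed areas
in the sectors that the pyramids cut out around the lateral edge.  The arguments are families of
support numbers, one for each dart. -/
noncomputable def vertexForm [DecidableEq V] (i : V) (X Y : D → ℝ) : ℝ :=
  ∑ d with T.src d = i, sectorForm (T.lateralDihedral r d) (X d) (X (T.rot d)) (Y d) (Y (T.rot d))

variable (T r) in
/-- The derivative of `rho r d` as a linear form. -/
noncomputable def rhoDeriv (d : D) : (V → ℝ) →L[ℝ] ℝ :=
  (1 / r (T.src d)) • ((1 / Real.sin (T.apexAngle r d)) •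
    (ContinuousLinearMap.proj (R := ℝ) (φ := fun _ : V => ℝ) (T.src (T.next d)) -
      Real.cos (T.apexAngle r d) • ContinuousLinearMap.proj (T.src d)))

theorem rhoDeriv_apply (x : V → ℝ) (d : D) :
    T.rhoDeriv r d x = T.rhoVariation r x d / r (T.src d) := by
  simp only [rhoDeriv, rhoVariation, smul_apply, sub_apply,
    ContinuousLinearMap.proj_apply, smul_eq_mul]
  ring

theorem hasFDerivAt_rho (hP : T.IsGeneralizedPolytope r) (d : D) :
    HasFDerivAt (fun q => T.rho q d) (T.rhoDeriv r d) r :=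
  hasFDerivAt_euclAngle (hasFDerivAt_apply _ _) (hasFDerivAt_apply _ _) (hP.1 _) (hP.1 _)
    (T.len_pos d) (sin_rho_pos (hP.2 d))

/-- The derivative of the curvature at a vertex is the mixed area of the polygon with the support
numbers `cotRho` and of the variation of the radii. -/
theorem exists_hasFDerivAt_curvature [DecidableEq V] (hP : T.IsGeneralizedPolytope r) (i : V) :
    ∃ L : (V → ℝ) →L[ℝ] ℝ, HasFDerivAt (fun q => T.curvature q i) L r ∧
      ∀ x, L x = T.vertexForm r i (T.cotRho r) (T.rhoVariation r x) / r i := by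
  have hd := (HasFDerivAt.fun_sum (u := Finset.univ.filter fun d => T.src d = i) fun d _ =>
    hasFDerivAt_sphAngle (hasFDerivAt_rho hP d) (hasFDerivAt_rho hP (T.rot d))
      (sin_rho_pos (hP.2 d)) (sin_rho_rot_pos (hP.2 d))
      (trihedralGram_pos (hP.2 d))).const_sub (2 * Real.pi)
  refine ⟨_, hd, fun x => ?_⟩
  rw [vertexForm, neg_apply, sum_apply,
    ← Finset.sum_neg_distrib, Finset.sum_div]
  refine Finset.sum_congr rfl fun d h => ?_
  have hs : T.src d = i := (Finset.mem_filter.1 h).2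
  simp only [add_apply, smul_apply, smul_eq_mul,
    rhoDeriv_apply, src_rot, hs]
  unfold sectorForm lateralDihedral cotRho
  ring

theorem fderiv_curvature [DecidableEq V] (hP : T.IsGeneralizedPolytope r) :
    DifferentiableAt ℝ T.curvature r ∧ ∀ x i, fderiv ℝ T.curvature r x i =
      T.vertexForm r i (T.cotRho r) (T.rhoVariation r x) / r i := by
  choose L hL hL' using exists_hasFDerivAt_curvature (T := T) hP
  have hd : HasFDerivAt T.curvature (ContinuousLinearMap.pi L) r := hasFDerivAt_pi.2 hL
  refine ⟨hd.differentiableAt, fun x i => ?_⟩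
  rw [hd.fderiv, ContinuousLinearMap.pi_apply, hL']

theorem curvatureJacobian_mulVec [DecidableEq V] (x : V → ℝ) :
    (T.curvatureJacobian r).mulVec x = fderiv ℝ T.curvature r x := by
  funext i
  conv_rhs => rw [pi_eq_sum_univ' x]
  rw [map_sum, Finset.sum_apply]
  refine Finset.sum_congr rfl fun j _ => ?_
  rw [map_smul, Pi.smul_apply, smul_eq_mul, mul_comm]
  rfl

/-! ### The total form -/

theorem sin_apexAngle_pos (hP : T.IsGeneralizedPolytope r) (d : D) :
    0 < Real.sin (T.apexAngle r d) :=
  sin_apex_pos (hP.1 _) (hP.1 _) (T.len_pos d) (sin_rho_pos (hP.2 d))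

theorem apexAngle_rot (d : D) : T.apexAngle r (T.rot d) = T.apexAngle r (T.next (T.next d)) := by
  rw [apexAngle, apexAngle, src_next_rot, src_rot, len_rot, T.next_next_next, euclAngle, euclAngle]
  ring_nf

theorem cotRho_div (hP : T.IsGeneralizedPolytope r) (d : D) :
    T.cotRho r d / r (T.src d) = T.rhoVariation r (fun i => 1 / r i) d :=
  cot_base_eq_apex (hP.1 _) (hP.1 _) (T.len_pos d) (sin_rho_pos (hP.2 d))

variable (T r) in
/-- The determinant of the three unit vectors along the lateral edges of a pyramid. -/
noncomputable def apexVolume (d : D) : ℝ :=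
  √(trihedralGram (T.apexAngle r d) (T.apexAngle r (T.next d)) (T.apexAngle r (T.next (T.next d))))

theorem cos_lateralDihedral (hP : T.IsGeneralizedPolytope r) (d : D) :
    Real.cos (T.lateralDihedral r d) *
        (Real.sin (T.apexAngle r d) * Real.sin (T.apexAngle r (T.next (T.next d)))) =
      Real.cos (T.apexAngle r (T.next d)) -
        Real.cos (T.apexAngle r d) * Real.cos (T.apexAngle r (T.next (T.next d))) := by
  have h1 := sin_rho_rot_pos (hP.2 d)
  have hG := trihedralGram_pos (hP.2 d)
  rw [rho_rot] at h1 hG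
  rw [← apexAngle_rot, lateralDihedral, rho_rot]
  unfold apexAngle
  rw [src_next_rot, src_rot, len_rot]
  exact cos_lateral_apex (hP.1 _) (hP.1 _) (hP.1 _) (T.len_pos _) (T.len_pos _)
    (sin_rho_pos (hP.2 d)) h1 (sin_corner_pos (hP.2 d)) (sin_apexAngle_pos hP _) hG

theorem sin_lateralDihedral (hP : T.IsGeneralizedPolytope r) (d : D) :
    Real.sin (T.lateralDihedral r d) *
        (Real.sin (T.apexAngle r d) * Real.sin (T.apexAngle r (T.next (T.next d)))) =
      T.apexVolume r d := by
  have h0 := lateralDihedral_mem (hP.2 d)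
  have h1 := Real.sin_pos_of_pos_of_lt_pi h0.1 h0.2
  have h2 := sin_apexAngle_pos hP d
  have h3 := sin_apexAngle_pos hP (T.next (T.next d))
  have hc := cos_lateralDihedral hP d
  rw [apexVolume, eq_comm, Real.sqrt_eq_iff_mul_self_eq_of_pos (by positivity),
    trihedralGram_swap, trihedralGram_rotate, trihedralGram_rotate, trihedralGram_eq, ← hc]
  linear_combination (Real.sin (T.apexAngle r d) *
    Real.sin (T.apexAngle r (T.next (T.next d)))) ^ 2 *
      Real.sin_sq_add_cos_sq (T.lateralDihedral r d)

theorem apexVolume_next (d : D) : T.apexVolume r (T.next d) = T.apexVolume r d := by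
  rw [apexVolume, apexVolume, T.next_next_next, ← trihedralGram_rotate]

theorem apexVolume_pos (hP : T.IsGeneralizedPolytope r) (d : D) : 0 < T.apexVolume r d := by
  have h0 := lateralDihedral_mem (hP.2 d)
  rw [← sin_lateralDihedral hP]
  exact mul_pos (Real.sin_pos_of_pos_of_lt_pi h0.1 h0.2)
    (mul_pos (sin_apexAngle_pos hP _) (sin_apexAngle_pos hP _))

theorem rhoVariation_rot (x : V → ℝ) (d : D) : T.rhoVariation r x (T.rot d) =
    (x (T.src (T.next (T.next d))) - Real.cos (T.apexAngle r (T.next (T.next d))) *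
      x (T.src d)) / Real.sin (T.apexAngle r (T.next (T.next d))) := by
  rw [rhoVariation, src_next_rot, src_rot, apexAngle_rot]

/-- The contributions of a single pyramid to `∑ u_i V_i(x, x)` and to `∑ x_i V_i(u, x)` agree. -/
theorem sum_triangle_sectorForm (hP : T.IsGeneralizedPolytope r) (x u : V → ℝ) (F G : D → ℝ)
    (hF : ∀ d, F d = u (T.src d) * sectorForm (T.lateralDihedral r d)
      (T.rhoVariation r x d) (T.rhoVariation r x (T.rot d))
      (T.rhoVariation r x d) (T.rhoVariation r x (T.rot d)))
    (hG : ∀ d, G d = x (T.src d) * sectorForm (T.lateralDihedral r d)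
      (T.rhoVariation r u d) (T.rhoVariation r u (T.rot d))
      (T.rhoVariation r x d) (T.rhoVariation r x (T.rot d))) (d : D) :
    F d + F (T.next d) + F (T.next (T.next d)) = G d + G (T.next d) + G (T.next (T.next d)) := by
  have key : ∀ (e : D) (p q : V → ℝ), _ := fun e p q =>
    sectorForm_apex (apexVolume_pos hP e) (sin_apexAngle_pos hP e)
      (sin_apexAngle_pos hP (T.next (T.next e))) (sin_lateralDihedral hP e)
      (cos_lateralDihedral hP e) (p (T.src e)) (p (T.src (T.next e)))
      (p (T.src (T.next (T.next e)))) (q (T.src e)) (q (T.src (T.next e)))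
      (q (T.src (T.next (T.next e)))) (Real.sin_sq _) (Real.sin_sq _) rfl
  have hne : ∀ e, 1 - Real.cos (T.apexAngle r e) ^ 2 ≠ 0 := fun e => by
    rw [← Real.sin_sq]
    exact (pow_pos (sin_apexAngle_pos hP e) 2).ne'
  have htri := apex_trilinear (hne d) (hne (T.next d)) (hne (T.next (T.next d)))
    (x (T.src d)) (x (T.src (T.next d))) (x (T.src (T.next (T.next d))))
    (u (T.src d)) (u (T.src (T.next d))) (u (T.src (T.next (T.next d))))
  simp only [hF, hG, rhoVariation_rot]
  have k₁ := key d
  have k₂ := key (T.next d)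
  have k₃ := key (T.next (T.next d))
  simp only [T.next_next_next, apexVolume_next] at k₂ k₃
  simp only [rhoVariation, k₁, k₂, k₃, T.next_next_next]
  simp only [← mul_div_assoc, ← add_div]
  congr 1
  linear_combination htri

/-- The total form `∑ h_i V_i(x, x)`, where `h` are the inverses of the radii, is the pairing of `x`
with the derivative of the curvatures in the direction `x`. -/
theorem sum_vertexForm [DecidableEq V] (hP : T.IsGeneralizedPolytope r) (x : V → ℝ) :
    ∑ i, 1 / r i * T.vertexForm r i (T.rhoVariation r x) (T.rhoVariation r x) =
      ∑ i, x i * (T.vertexForm r i (T.cotRho r) (T.rhoVariation r x) / r i) := by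
  have hsum : ∀ (w : V → ℝ) (Φ : D → ℝ),
      ∑ i, w i * ∑ d with T.src d = i, Φ d = ∑ d, w (T.src d) * Φ d := fun w Φ => by
    rw [← Finset.sum_fiberwise Finset.univ T.src]
    refine Finset.sum_congr rfl fun i _ => ?_
    rw [Finset.mul_sum]
    exact Finset.sum_congr rfl fun d hd => by rw [(Finset.mem_filter.1 hd).2]
  have hdiv : ∀ i, T.vertexForm r i (T.cotRho r) (T.rhoVariation r x) / r i =
      T.vertexForm r i (T.rhoVariation r fun i => 1 / r i) (T.rhoVariation r x) := fun i => by
    rw [vertexForm, vertexForm, Finset.sum_div]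
    refine Finset.sum_congr rfl fun d hd => ?_
    have e2 := cotRho_div hP (T.rot d)
    rw [← cotRho_div hP, ← e2, src_rot, (Finset.mem_filter.1 hd).2]
    unfold sectorForm
    ring
  simp only [hdiv]
  unfold vertexForm
  rw [hsum (fun i => 1 / r i), hsum x]
  refine mul_left_cancel₀ (three_ne_zero (α := ℝ)) ?_
  rw [T.three_mul_sum_dart, T.three_mul_sum_dart]
  exact Finset.sum_congr rfl fun d _ =>
    sum_triangle_sectorForm hP x (fun i => 1 / r i) _ _ (fun _ => rfl) (fun _ => rfl) d

/-- The Minkowski inequality at a vertex: on variations that do not change the curvature at the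
vertex, the form is nonpositive, and it vanishes only for trivial variations. -/
theorem vertexForm_nonpos [DecidableEq V] (hP : T.IsGeneralizedConvexPolytope r) (i : V)
    (h0 : 0 < T.curvature r i) (h1 : T.curvature r i < T.angleDefect i) (X : D → ℝ)
    (hX : T.vertexForm r i (T.cotRho r) X = 0) :
    T.vertexForm r i X X ≤ 0 ∧ (T.vertexForm r i X X = 0 → ∀ d, T.src d = i → X d = 0) := by
  obtain ⟨n, hn, d, hper, -, hsurj, hsum⟩ := T.exists_cycle i
  set ω : ℕ → ℝ := fun j => T.lateralDihedral r (T.rot^[j] d) with hω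
  have hform : ∀ Y Z : D → ℝ, T.vertexForm r i Y Z =
      mixedArea n ω (fun j => Y (T.rot^[j] d)) (fun j => Z (T.rot^[j] d)) := fun Y Z => by
    simp only [vertexForm, hsum, mixedArea, Function.iterate_succ_apply', hω]
  have hperiod : ∀ j, T.rot^[j + n] d = T.rot^[j] d := fun j => by
    rw [Function.iterate_add_apply, hper]
  have hpos : ∀ j, 0 < ω j := fun j => (lateralDihedral_mem (hP.1.2 _)).1
  have hlt : ∀ j, ω j < Real.pi := fun j => (lateralDihedral_mem (hP.1.2 _)).2
  have htot : ∑ j ∈ Finset.range n, ω j < 2 * Real.pi := by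
    rw [curvature, hsum] at h0
    linarith
  have hdef : 0 < sphDefect n ω (fun j => T.cotRho r (T.rot^[j] d)) := by
    have : ∀ j, ω j - sphSide (ω j) (T.cotRho r (T.rot^[j] d)) (T.cotRho r (T.rot^[j + 1] d)) =
        T.lateralDihedral r (T.rot^[j] d) - T.corner (T.rot^[j] d) := fun j => by
      rw [Function.iterate_succ_apply', hω, sphSide_eq_corner (hP.1.2 _)]
    simp only [sphDefect, this]
    rw [Finset.sum_sub_distrib, ← hsum, ← hsum]
    rw [curvature, angleDefect] at h1
    linarith
  have hconv : IsConvexSupport ω (fun j => T.cotRho r (T.rot^[j] d)) := fun j => by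
    simp only [hω, Function.iterate_succ_apply']
    exact slopeIn_le_slopeOut hP _
  have harea := mixedArea_pos_of_sphDefect_pos hpos hlt (fun j => by simp only [hω, hperiod])
    (fun j => by simp only [hperiod]) hconv htot hn hdef
  rw [hform] at hX ⊢
  obtain ⟨h2, h3⟩ := mixedArea_self_nonpos_of_orthogonal hn hpos hlt htot
    (h := fun j => T.cotRho r (T.rot^[j] d)) (by simp only [hper]; rfl)
    (by simp only [hper]; rfl) harea hX
  refine ⟨h2, fun h e he => ?_⟩
  obtain ⟨j, hj, rfl⟩ := hsurj e he
  exact h3 h j hj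

/-- A vector is determined by the variations of the angles `rho`. -/
theorem eq_zero_of_rhoVariation_eq_zero (hP : T.IsGeneralizedPolytope r) {x : V → ℝ}
    (h : ∀ d, T.rhoVariation r x d = 0) : x = 0 := by
  funext i
  obtain ⟨d, rfl⟩ := T.src_surjective i
  have hs := sin_apexAngle_pos hP d
  have hr : T.apexAngle r (T.rev d) = T.apexAngle r d := by
    rw [apexAngle, apexAngle, src_rev, src_next_rev, T.len_rev, euclAngle, euclAngle]
    ring_nf
  have h1 := h d
  have h2 := h (T.rev d)
  rw [rhoVariation, div_eq_zero_iff, or_iff_left hs.ne'] at h1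
  rw [rhoVariation, hr, div_eq_zero_iff, or_iff_left hs.ne', src_rev, src_next_rev] at h2
  have h3 : Real.sin (T.apexAngle r d) ^ 2 * x (T.src d) = 0 := by
    rw [Real.sin_sq]
    linear_combination h2 + Real.cos (T.apexAngle r d) * h1
  exact (mul_eq_zero.1 h3).resolve_left (pow_pos hs 2).ne'

end pyramid

end GeodesicTriangulation

theorem mainTheorem2 {V D : Type*} [Fintype V] [DecidableEq V] [Fintype D]
    (T : GeodesicTriangulation V D) (r : V → ℝ)
    (hP : T.IsGeneralizedConvexPolytope r)
    (hκ : ∀ i, 0 < T.curvature r i ∧ T.curvature r i < T.angleDefect i) :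
    DifferentiableAt ℝ T.curvature r ∧ (T.curvatureJacobian r).det ≠ 0 := by
  obtain ⟨hdiff, hder⟩ := GeodesicTriangulation.fderiv_curvature hP.1
  refine ⟨hdiff, fun hdet => ?_⟩
  obtain ⟨x, hx0, hx⟩ := Matrix.exists_mulVec_eq_zero_iff.2 hdet
  rw [GeodesicTriangulation.curvatureJacobian_mulVec] at hx
  have horth : ∀ i, T.vertexForm r i (T.cotRho r) (T.rhoVariation r x) / r i = 0 := fun i => by
    rw [← hder, hx, Pi.zero_apply]
  have hloc := fun i => GeodesicTriangulation.vertexForm_nonpos hP i (hκ i).1 (hκ i).2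
    (T.rhoVariation r x) ((div_eq_zero_iff.1 (horth i)).resolve_right (hP.1.1 i).ne')
  have hsum := GeodesicTriangulation.sum_vertexForm hP.1 x
  simp only [horth, mul_zero, Finset.sum_const_zero] at hsum
  have hr : ∀ i, 0 < 1 / r i := fun i => one_div_pos.2 (hP.1.1 i)
  -- a vanishing sum of nonpositive terms: every summand is zero
  have hzero := (Finset.sum_eq_zero_iff_of_nonpos fun i _ =>
    mul_nonpos_of_nonneg_of_nonpos (hr i).le (hloc i).1).1 hsum
  exact hx0 (GeodesicTriangulation.eq_zero_of_rhoVariation_eq_zero hP.1 fun d =>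
    (hloc _).2 ((mul_eq_zero.1 (hzero (T.src d) (Finset.mem_univ _))).resolve_left (hr _).ne') d rfl)
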